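/- **Setting.** Let $\Phi$ be a (reduced, crystallographic, not necessarily irreducible) simply-laced root system with simple roots $\alpha_1,\dots,\alpha_r$, simple reflections $\sigma_1,\dots,\sigma_r$, Weyl group $W$, root lattice $\Lambda=\bigoplus\mathbb Z\alpha_i$ (ordered by $\lambda\le\mu$ iff $\mu-\lambda\in\sum\mathbb Z_{\ge 0}\alpha_i$), height function $d(\sum k_i\alpha_i)=\sum k_i$, and fundamental weights $\varpi_1,\dots,\varpi_r$. Write $i\sim j$ if $i\ne j$ are adjacent in the Dynkin diagram. Let $q$ be a prime power, $\ell=(l_1,\dots,l_r)\in\mathbb Z_{\ge0}^r$, $\rho=\sum\varpi_k$ and $\theta=\rho+\sum l_k\varpi_k$. For $\lambda=\sum k_i\alpha_i$ put $\mathbf x^\lambda=\prod x_i^{k_i}$ and $\varphi_k(\lambda)=l_k+\sum_{j\sim k}k_j$. **The numerator $N(\mathbf x;\ell)$.** On tuples let $(\sigma_i\mathbf x)_j$ be $x_ix_j\sqrt q$ if $i\sim j$, $1/(qx_i)$ if $j=i$, and $x_j$ otherwise; let $(\epsilon_i\mathbf x)_j$ be $-x_j$ if $i\sim j$ and $x_j$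 otherwise. For $f\in\mathbb C(x_1,\dots,x_r)$ put $f^{\pm}_{i}(\mathbf x)=\tfrac12\bigl(f(\mathbf x)\pm(-1)^{l_i}f(\epsilon_i\mathbf x)\bigr)$ and $$(f|_\ell\sigma_i)(\mathbf x)=-\frac{1-qx_i}{qx_i(1-x_i)}(x_i\sqrt q)^{l_i}f_i^+(\sigma_i\mathbf x)+\frac1{x_i\sqrt q}(x_i\sqrt q)^{l_i}f_i^-(\sigma_i\mathbf x);$$ this extends to a right action of $W$ on $\mathbb C(x_1,\dots,x_r)$. Let $\Delta(\mathbf x)=\prod_{\alpha>0}(1-q^{d(\alpha)}\mathbf x^{2\alpha})$, $D(\mathbf x)=\prod_{\alpha>0}(1-q^{d(\alpha)-1}\mathbf x^{2\alpha})$, $j(w,\mathbf x)=\Delta(\mathbf x)/\Delta(w\mathbf x)$, $$f(\mathbf x;\ell)=\Delta(\mathbf x)^{-1}\sum_{w\in W}j(w,\mathbf x)\,(1|_\ell w)(\mathbf x),\qquad N(\mathbf x;\ell)=f(\mathbf x;\ell)\,D(\mathbf x).$$ **Functional equations.** For a polynomial $\sum_{\lambda\in\Lambda}a_\lambda\mathbf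 x^\lambda\in\mathbb C[x_1,\dots,x_r]$ (with $a_\lambda=0$ when $\lambda$ has a negative coordinate) consider the following system: for all $k$ and all $\lambda,\mu\in\Lambda$ with $\mu=\sigma_k\lambda+(l_k+1)\alpha_k$ and $\mu\ge\lambda$, setting $\beta=\lambda-\mu+\alpha_k$, $$q\,a_{\lambda-\alpha_k}+a_\lambda=q^{d(\beta)/2}\bigl(a_\mu+a_{\mu+\alpha_k}/q\bigr)\quad\text{if }\varphi_k(\mu)\text{ is even},\tag{a}$$ $$q^2a_{\lambda-2\alpha_k}-a_\lambda=\sqrt q\,q^{d(\beta)/2}\bigl(a_\mu-a_{\mu+2\alpha_k}/q^2\bigr)\quad\text{if }\varphi_k(\mu)\text{ is odd}.\tag{b}$$ **Theorem.** Let $V_\theta$ be the finite-dimensional irreducible representation of highest weight $\theta$ of the complex semisimple Lie algebra with root system $\Phi$, and suppose that $\theta$ is the only regular dominant weight of $V_\theta$ (regular: lying on no reflection hyperplane). Then $N(\mathbf x;\ell)$ is uniquely determined by the functional equations (a), (b) and the normalisation $a_0=1$. That is, $N(\mathbf x;\ell)$ is a polynomial with constant coefficient $a_0=1$ whose coefficients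 satisfy (a), (b), and every polynomial in $\mathbb C[x_1,\dots,x_r]$ with constant coefficient $1$ whose coefficients satisfy (a), (b) is equal to $N(\mathbf x;\ell)$. -/

import Mathlib

/-!
Numerators of twisted quadratic Weyl group multiple Dirichlet series attached to a simply-laced
root system `P` with base `b` (simple roots `α_k`, `k : b.support`), a prime power `q` and a
twisting parameter `l : b.support → ℕ`.
-/

noncomputable section

namespace TwistedWMDS

open RootPairing

variable {ι M N : Type*} [AddCommGroup M] [Module ℝ M] [AddCommGroup N] [Module ℝ N]
  {P : RootPairing ι ℝ M N}

/-! ### The Weyl group -/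

/-- The product `σ_{i₁} ⋯ σ_{iₙ}` of simple reflections in the Weyl group. -/
def wordProd (b : P.Base) (L : List b.support) : P.weylGroup :=
  (L.map fun k : b.support => weylGroup.ofIdx P (k : ι)).prod

lemma exists_wordProd_eq [Finite ι] [P.IsCrystallographic] [P.IsReduced]
    (b : P.Base) (w : P.weylGroup) :
    ∃ L : List b.support, wordProd b L = w := by
  set S : Submonoid P.weylGroup := MonoidHom.mrange (FreeMonoid.lift
    (fun k : b.support => weylGroup.ofIdx P (k : ι))) with hS
  have hmem : ∀ i, weylGroup.ofIdx P i ∈ S := by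
    intro i
    have conj : ∀ i j : ι, weylGroup.ofIdx P (P.reflectionPerm j i) =
        weylGroup.ofIdx P j * weylGroup.ofIdx P i * weylGroup.ofIdx P j := by
      intro i j
      apply Subtype.ext
      apply Equiv.weightHom_injective
      change Equiv.weightHom P (Equiv.reflection P _) = Equiv.weightHom P
        (Equiv.reflection P j * Equiv.reflection P i * Equiv.reflection P j)
      rw [map_mul, map_mul]
      simp only [Equiv.weightHom_apply, Equiv.reflection_weightEquiv]
      rw [reflection_reflectionPerm]
    refine b.induction_reflect i (p := fun i => weylGroup.ofIdx P i ∈ S) ?_ ?_ ?_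
    · intro i hi
      rw [conj]
      exact S.mul_mem (S.mul_mem hi hi) hi
    · intro k hk
      exact ⟨FreeMonoid.of ⟨k, hk⟩, by simp⟩
    · intro i j hi hj
      have hj' : weylGroup.ofIdx P j ∈ S := ⟨FreeMonoid.of ⟨j, hj⟩, by simp⟩
      rw [conj]
      exact S.mul_mem (S.mul_mem hj' hi) hj'
  have key : w ∈ S := by
    obtain ⟨w, hw⟩ := w
    refine weylGroup.induction P (pred := fun g hg => (⟨g, hg⟩ : P.weylGroup) ∈ S)
      (fun i => hmem i) S.one_mem (fun x y hx hy h1 h2 => S.mul_mem h1 h2) hw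
  obtain ⟨L, hL⟩ := key
  exact ⟨FreeMonoid.toList L, by rw [← hL, FreeMonoid.lift_apply, wordProd]⟩

/-- An expression of `w` as a word in the simple reflections. -/
def word [Finite ι] [P.IsCrystallographic] [P.IsReduced]
    (b : P.Base) (w : P.weylGroup) : List b.support :=
  (exists_wordProd_eq b w).choose

lemma wordProd_word [Finite ι] [P.IsCrystallographic] [P.IsReduced] (b : P.Base) (w : P.weylGroup) :
    wordProd b (word b w) = w :=
  (exists_wordProd_eq b w).choose_spec

lemma finite_weylGroup [Finite ι] [P.IsRootSystem] : Finite P.weylGroup := by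
  have : Function.Injective fun w : P.weylGroup => Equiv.indexHom P w.1 := by
    intro u v huv
    apply Subtype.ext
    apply Equiv.weightHom_injective
    apply LinearEquiv.toLinearMap_injective
    apply LinearMap.ext_on (IsRootSystem.span_root_eq_top (P := P))
    rintro _ ⟨i, rfl⟩
    have h : (u.1 : P.Aut).indexEquiv i = (v.1 : P.Aut).indexEquiv i :=
      congrArg (fun e : ι ≃ ι => e i) huv
    change u.1.weightMap (P.root i) = v.1.weightMap (P.root i)
    rw [Hom.root_weightMap_apply, Hom.root_weightMap_apply]
    exact congrArg P.root h
  exact Finite.of_injective _ this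

/-! ### The field of rational functions and the twisted action -/

/-- The field `ℂ(x₁, …, x_r)`, with one variable for each simple root. -/
abbrev RatField (b : P.Base) : Type _ := FractionRing (MvPolynomial b.support ℂ)

/-- The real number `√q`, as a complex number. -/
def sqrtC (q : ℕ) : ℂ := ((Real.sqrt (q : ℝ) : ℝ) : ℂ)

/-- The variable `x_k`. -/
def xvar (b : P.Base) (k : b.support) : RatField b :=
  algebraMap (MvPolynomial b.support ℂ) (RatField b) (MvPolynomial.X k)

/-- The constant function `c`. -/
def const (b : P.Base) (c : ℂ) : RatField b :=
  algebraMap (MvPolynomial b.support ℂ) (RatField b) (MvPolynomial.C c)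

/-- The rational function `f(g₁, …, g_r)`: if `f` is the quotient of the polynomials `u` and `v`,
this is `u(g) / v(g)`. It is used only for tuples `g` at which no nonzero polynomial vanishes. -/
def ratSubst (b : P.Base) (g : b.support → RatField b) (f : RatField b) : RatField b :=
  MvPolynomial.eval₂ ((algebraMap (MvPolynomial b.support ℂ) (RatField b)).comp MvPolynomial.C) g
      (IsLocalization.sec (nonZeroDivisors (MvPolynomial b.support ℂ)) f).1 /
    MvPolynomial.eval₂ ((algebraMap (MvPolynomial b.support ℂ) (RatField b)).comp MvPolynomial.C) g
      (IsLocalization.sec (nonZeroDivisors (MvPolynomial b.support ℂ)) f).2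

/-- Adjacency of two nodes of the Dynkin diagram. -/
def Adj (b : P.Base) (i j : b.support) : Prop := i ≠ j ∧ P.pairing i j ≠ 0

open Classical in
/-- The tuple `σ_i x`. -/
def sigmaPt (b : P.Base) (q : ℕ) (i j : b.support) : RatField b :=
  if j = i then 1 / (const b q * xvar b j)
  else if Adj b i j then xvar b i * xvar b j * const b (sqrtC q)
  else xvar b j

open Classical in
/-- The tuple `ε_i x`. -/
def epsPt (b : P.Base) (i j : b.support) : RatField b :=
  if Adj b i j then -xvar b j else xvar b j

/-- `f(σ_i x)` -/
def sigmaSubst (b : P.Base) (q : ℕ) (i : b.support) (f : RatField b) : RatField b :=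
  ratSubst b (sigmaPt b q i) f

/-- `f(ε_i x)` -/
def epsSubst (b : P.Base) (i : b.support) (f : RatField b) : RatField b :=
  ratSubst b (epsPt b i) f

/-- `f⁺_{i,ℓ}(x) = (f(x) + (-1)^{l_i} f(ε_i x)) / 2` -/
def plusPart (b : P.Base) (l : b.support → ℕ) (i : b.support) (f : RatField b) : RatField b :=
  (f + (-1) ^ l i * epsSubst b i f) / 2

/-- `f⁻_{i,ℓ}(x) = (f(x) - (-1)^{l_i} f(ε_i x)) / 2` -/
def minusPart (b : P.Base) (l : b.support → ℕ) (i : b.support) (f : RatField b) : RatField b :=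
  (f - (-1) ^ l i * epsSubst b i f) / 2

/-- The twisted action `f|_ℓ σ_i` of a simple reflection. -/
def slash (b : P.Base) (q : ℕ) (l : b.support → ℕ) (f : RatField b) (i : b.support) :
    RatField b :=
  -((1 - const b q * xvar b i) / (const b q * xvar b i * (1 - xvar b i))) *
      (xvar b i * const b (sqrtC q)) ^ l i * sigmaSubst b q i (plusPart b l i f) +
    1 / (xvar b i * const b (sqrtC q)) *
      (xvar b i * const b (sqrtC q)) ^ l i * sigmaSubst b q i (minusPart b l i f)

/-- The right action `f|_ℓ w` of the Weyl group: `f|_ℓ σ_{i₁} ⋯ σ_{iₙ}` is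
`(⋯(f|_ℓ σ_{i₁})|_ℓ ⋯)|_ℓ σ_{iₙ}`. -/
def slashW [Finite ι] [P.IsCrystallographic] [P.IsReduced]
    (b : P.Base) (q : ℕ) (l : b.support → ℕ) (f : RatField b)
    (w : P.weylGroup) : RatField b :=
  (word b w).foldl (slash b q l) f

/-- The untwisted change of variables `f(w x)`, where `(σ_{i₁} ⋯ σ_{iₙ}) x = σ_{i₁}(⋯(σ_{iₙ} x))`. -/
def substW [Finite ι] [P.IsCrystallographic] [P.IsReduced]
    (b : P.Base) (q : ℕ) (f : RatField b) (w : P.weylGroup) : RatField b :=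
  (word b w).foldl (fun g i => sigmaSubst b q i g) f

/-! ### The averaged rational function and its numerator -/

/-- The coefficient of `α_j` in the root `α_i`. -/
def rootCoord (b : P.Base) (i : ι) (j : b.support) : ℤ :=
  b.toWeightBasisInt.repr (P.rootSpanMem ℤ i) j

/-- `x^{2α}` for the root `α` with index `i`. -/
def xpowTwo (b : P.Base) (i : ι) : RatField b :=
  ∏ j : b.support, xvar b j ^ (2 * rootCoord b i j)

open Classical in
/-- `∏_{α > 0} (1 - q^{d(α) - c} x^{2α})`, where `d` is the height. -/
def posProd [Finite ι] (b : P.Base) (q : ℕ) (c : ℤ) : RatField b :=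
  letI := Fintype.ofFinite ι
  ∏ i : ι with b.IsPos i, (1 - const b q ^ (b.height i - c) * xpowTwo b i)

/-- `Δ(x) = ∏_{α > 0} (1 - q^{d(α)} x^{2α})` -/
def Delta [Finite ι] (b : P.Base) (q : ℕ) : RatField b := posProd b q 0

/-- `D(x) = ∏_{α > 0} (1 - q^{d(α) - 1} x^{2α})` -/
def Den [Finite ι] (b : P.Base) (q : ℕ) : RatField b := posProd b q 1

/-- `j(w, x) = Δ(x) / Δ(w x)` -/
def jFactor [Finite ι] [P.IsCrystallographic] [P.IsReduced]
    (b : P.Base) (q : ℕ) (w : P.weylGroup) : RatField b :=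
  Delta b q / substW b q (Delta b q) w

/-- `f(x; ℓ) = Δ(x)⁻¹ ∑_{w ∈ W} j(w, x) (1|_ℓ w)(x)` -/
def fAvg [Finite ι] [P.IsCrystallographic] [P.IsReduced] [P.IsRootSystem]
    (b : P.Base) (q : ℕ) (l : b.support → ℕ) : RatField b :=
  letI : Finite P.weylGroup := finite_weylGroup
  letI := Fintype.ofFinite P.weylGroup
  (Delta b q)⁻¹ * ∑ w : P.weylGroup, jFactor b q w * slashW b q l 1 w

/-- The numerator `N(x; ℓ) = f(x; ℓ) D(x)`, as a rational function. -/
def numer [Finite ι] [P.IsCrystallographic] [P.IsReduced] [P.IsRootSystem]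
    (b : P.Base) (q : ℕ) (l : b.support → ℕ) : RatField b :=
  fAvg b q l * Den b q

/-! ### The functional equations of the coefficients

The root lattice `Λ` is identified with `b.support → ℤ` through the basis of simple roots. -/

/-- The element `∑ λ_j α_j` of the root lattice. -/
def latticePt (b : P.Base) (v : b.support → ℤ) : M := ∑ j : b.support, v j • P.root j

/-- The coefficient `a_λ` of `x^λ` in a polynomial, for all `λ ∈ Λ`. -/
def coeffL (b : P.Base) (p : MvPolynomial b.support ℂ) (v : b.support → ℤ) : ℂ :=
  if ∀ j, 0 ≤ v j then
    MvPolynomial.coeff (Finsupp.equivFunOnFinite.symm fun j => (v j).toNat) p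
  else 0

open Classical in
/-- The simple root `α_k` as an element of `Λ`. -/
def simpleVec (b : P.Base) (k : b.support) : b.support → ℤ := Pi.single k 1

open Classical in
/-- `φ_k(λ) = l_k + ∑_{j ~ k} λ_j` -/
def phi (b : P.Base) (l : b.support → ℕ) (k : b.support) (v : b.support → ℤ) : ℤ :=
  l k + ∑ j : b.support with Adj b j k, v j

/-- The functional equations for the coefficients `a_λ` of a polynomial: for all `k` and all
`λ ≤ μ` in `Λ` with `μ = σ_k λ + (l_k + 1) α_k`, putting `β = λ - μ + α_k`,
* `q a_{λ - α_k} + a_λ = q^{d(β)/2} (a_μ + a_{μ + α_k} / q)` if `φ_k(μ)` is even;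
* `q² a_{λ - 2α_k} - a_λ = √q q^{d(β)/2} (a_μ - a_{μ + 2α_k} / q²)` if `φ_k(μ)` is odd.

Here `q^{d(β)/2}` is written as `(√q)^{d(β)}`. -/
def FunctionalEquations (b : P.Base) (q : ℕ) (l : b.support → ℕ)
    (p : MvPolynomial b.support ℂ) : Prop :=
  ∀ (k : b.support) (lam mu : b.support → ℤ),
    latticePt b mu = P.reflection k (latticePt b lam) + (l k + 1) • P.root k →
    lam ≤ mu →
    (Even (phi b l k mu) →
      q * coeffL b p (lam - simpleVec b k) + coeffL b p lam =
        sqrtC q ^ (∑ j, (lam - mu + simpleVec b k) j) *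
          (coeffL b p mu + coeffL b p (mu + simpleVec b k) / q)) ∧
    (Odd (phi b l k mu) →
      (q : ℂ) ^ 2 * coeffL b p (lam - 2 • simpleVec b k) - coeffL b p lam =
        sqrtC q * sqrtC q ^ (∑ j, (lam - mu + simpleVec b k) j) *
          (coeffL b p mu - coeffL b p (mu + 2 • simpleVec b k) / (q : ℂ) ^ 2))

/-! ### Weights and the representation `V_θ` -/

/-- The fundamental weight `ϖ_k`: the vectors `ϖ_k` are dual to the simple coroots. -/
def fundWeight [P.IsRootSystem] (b : P.Base) (k : b.support) : M :=
  P.toLinearMap.toPerfPair.symm (b.toCoweightBasis.coord k)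

/-- `θ = ρ + ∑ l_k ϖ_k`, where `ρ = ∑ ϖ_k`. -/
def theta [P.IsRootSystem] (b : P.Base) (l : b.support → ℕ) : M :=
  ∑ k : b.support, fundWeight b k + ∑ k : b.support, l k • fundWeight b k

/-- `ξ` lies in the closed dominant chamber. -/
def IsDominant (b : P.Base) (ξ : M) : Prop := ∀ k ∈ b.support, 0 ≤ P.toLinearMap ξ (P.coroot k)

/-- `ξ` lies on no reflection hyperplane, i.e. in the interior of a Weyl chamber. -/
def IsRegularWeight (P : RootPairing ι ℝ M N) (ξ : M) : Prop :=
  ∀ i, P.toLinearMap ξ (P.coroot i) ≠ 0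

open Classical in
/-- The complex semisimple Lie algebra with root system `P`, presented by Chevalley generators
and Serre relations. -/
abbrev SerreLie [P.IsCrystallographic] (b : P.Base) : Type _ :=
  Matrix.ToLieAlgebra ℂ b.cartanMatrix

open Classical in
/-- The Chevalley generator `h_k`. -/
def hGen [P.IsCrystallographic] (b : P.Base) (k : b.support) : SerreLie b :=
  LieSubmodule.Quotient.mk (N := CartanMatrix.Relations.toIdeal ℂ b.cartanMatrix)
    (FreeLieAlgebra.of ℂ (CartanMatrix.Generators.H k))

open Classical in
/-- The Chevalley generator `e_k`. -/
def eGen [P.IsCrystallographic] (b : P.Base) (k : b.support) : SerreLie b :=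
  LieSubmodule.Quotient.mk (N := CartanMatrix.Relations.toIdeal ℂ b.cartanMatrix)
    (FreeLieAlgebra.of ℂ (CartanMatrix.Generators.E k))

variable [P.IsCrystallographic] (b : P.Base)
  (V : Type*) [AddCommGroup V] [Module ℂ V] [LieRingModule (SerreLie b) V]

/-- `v` lies in the weight space `V_ξ`: `h_k v = ⟨ξ, α_k^∨⟩ v` for all `k`. -/
def HasWeight (ξ : M) (v : V) : Prop :=
  ∀ k : b.support, ⁅hGen b k, v⁆ = ((P.toLinearMap ξ (P.coroot k) : ℝ) : ℂ) • v

/-- `ξ` is a weight of `V`. -/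
def IsWeightOf (ξ : M) : Prop := ∃ v : V, v ≠ 0 ∧ HasWeight b V ξ v

/-- `V` is the finite-dimensional irreducible representation of highest weight `θ`. -/
structure IsIrrepOfHighestWeight [LieModule ℂ (SerreLie b) V] (θ : M) : Prop where
  finite : Module.Finite ℂ V
  irreducible : LieModule.IsIrreducible ℂ (SerreLie b) V
  exists_highest : ∃ v : V, v ≠ 0 ∧ (∀ k : b.support, ⁅eGen b k, v⁆ = 0) ∧ HasWeight b V θ v

end TwistedWMDS

end

/-!
In the variables `y_j = √q x_j` the change of variables `σ_i` acts on a Laurent monomial `y^v`, `v`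
in the root lattice, through the linear reflection of `v`, and `ε_i` multiplies it by
`(-1)^⟨v, α_i^∨⟩`. With `τ_i f = (Δ(x) / Δ(σ_i x)) (f|_ℓ σ_i) = -y_i² (f|_ℓ σ_i)`, the numerator is
`N = Δ⁻¹ h D`, where `h = ∑_w τ_w 1` and `τ_w` is the product of the `τ_i` along a word for `w`. The
`τ_i` satisfy the Coxeter relations (`tau_tau`, `tau_braid`, `tau_comm`). By an exchange argument for
reduced words (`IsBraidRel.rel_of_act_eq`) the operator `τ_w` does not depend on the word, so
`τ_k h = h` (`tau_average`).

*`N` is a polynomial.* For a reduced word of `w`, the only denominators of `τ_w 1` are the factors of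
`D` at the positive roots made negative by `w`. Hence `D h` is a polynomial, and only `w = 1`
contributes to its constant coefficient, which is `1` (`exists_poly_average`). On polynomials `τ_k`
is congruent to `-1` modulo `1 - y_k²` (`tau_add_self_mem`). Together with `τ_k h = h` this makes `h`
divisible by `1 - y_k²`, hence, applying the `τ_i`, by `1 - y^{2α}` for every root `α`
(`average_mem_multiples`). The factors `1 - y^{2α}` are pairwise coprime, and coprime to the
denominators involved, so `Δ` divides `D h` (`exists_poly_numer`).

*`N` satisfies the functional equations.* The invariance of `h` becomes
`(1 - q y_k²) N = (q - y_k²) τ_k N` (`tau_numer`). Comparing the coefficients of the monomials `y^v`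
of each parity of `⟨v, α_k^∨⟩` gives (a) and (b); in the case of (a) a common factor `1 - √q y_k` is
first cancelled (`functionalEquations_numer`). None of this uses the assumption on `θ`.

*Uniqueness.* The difference of two solutions is a solution with constant coefficient `0`. Suppose
that it is not zero. Among the `λ` with `a_λ ≠ 0`, choose one for which `θ - λ` has maximal length
and, among these, one of minimal height. On the line through `λ` in the direction of `α_k`, maximality
leaves a single term on each side of the functional equation. If `⟨θ - λ, α_k^∨⟩ < 0`, then the
coefficient at the mirror image of `λ` is nonzero too, against minimality; if `⟨θ - λ, α_k^∨⟩ = 0`,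
then the equation reads `-a_λ = q a_λ`. So `θ - λ` is regular and dominant
(`FunctionalEquations.exists_regular_dominant`). By the representation theory of `sl₂` and the
positivity of the Cartan matrix, `θ - λ` is then a weight of `V_θ`
(`isWeightOf_of_regular_dominant`), so it is `θ`, and `a_0 ≠ 0`, a contradiction.
-/

noncomputable section

namespace TwistedWMDS

open RootPairing

variable {ι M N : Type*} [AddCommGroup M] [Module ℝ M] [AddCommGroup N] [Module ℝ N]
  {P : RootPairing ι ℝ M N}

/-! ### The root lattice -/

section

lemma latticePt_add (b : P.Base) (v w : b.support → ℤ) :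
    latticePt b (v + w) = latticePt b v + latticePt b w := by
  simp [latticePt, add_smul, Finset.sum_add_distrib]

lemma latticePt_smul (b : P.Base) (n : ℤ) (v : b.support → ℤ) :
    latticePt b (n • v) = n • latticePt b v := by
  simp [latticePt, mul_smul, Finset.smul_sum]

open Classical in
lemma latticePt_single (b : P.Base) (k : b.support) (n : ℤ) :
    latticePt b (Pi.single k n) = n • P.root k := by
  rw [latticePt, Finset.sum_eq_single k] <;> simp +contextual

lemma latticePt_injective (b : P.Base) : Function.Injective (latticePt b) := by
  intro v w h
  have := Fintype.linearIndependent_iffₛ.mp (b.linearIndepOn_root.restrict_scalars' ℤ) v w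
    (by simpa [latticePt] using h)
  exact funext this

variable [P.IsCrystallographic]

/-- The integer `⟨v, α_k^∨⟩` for `v` in the root lattice. -/
def pair (b : P.Base) (k : b.support) : (b.support → ℤ) →+ ℤ :=
  AddMonoidHom.mk' (fun v => ∑ j : b.support, v j * P.pairingIn ℤ j k) fun v w => by
    rw [← Finset.sum_add_distrib]
    exact Finset.sum_congr rfl fun j _ => add_mul _ _ _

lemma pair_apply (b : P.Base) (k : b.support) (v : b.support → ℤ) :
    pair b k v = ∑ j : b.support, v j * P.pairingIn ℤ j k := rfl

lemma toLinearMap_latticePt (b : P.Base) (k : b.support) (v : b.support → ℤ) :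
    P.toLinearMap (latticePt b v) (P.coroot k) = pair b k v := by
  rw [latticePt, map_sum, LinearMap.sum_apply, pair_apply, Int.cast_sum]
  refine Finset.sum_congr rfl fun j _ => ?_
  rw [map_zsmul, LinearMap.smul_apply, zsmul_eq_mul, Int.cast_mul]
  congr 1
  exact (P.algebraMap_pairingIn ℤ (j : ι) (k : ι)).symm

open Classical in
lemma pair_single (b : P.Base) (k j : b.support) (n : ℤ) :
    pair b k (Pi.single j n) = n * P.pairingIn ℤ j k := by
  rw [pair_apply, Finset.sum_eq_single j] <;> simp +contextual [Pi.single_apply]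

lemma pair_simpleVec_self (b : P.Base) (k : b.support) : pair b k (simpleVec b k) = 2 := by
  rw [simpleVec, pair_single, pairingIn_same]; rfl

/-- The simple reflection `σ_k` on the root lattice. -/
def refl (b : P.Base) (k : b.support) : (b.support → ℤ) →+ (b.support → ℤ) :=
  AddMonoidHom.id _ -
    (AddMonoidHom.flip (smulAddHom ℤ (b.support → ℤ)) (simpleVec b k)).comp (pair b k)

lemma refl_apply (b : P.Base) (k : b.support) (v : b.support → ℤ) :
    refl b k v = v - pair b k v • simpleVec b k := rfl

lemma pair_refl (b : P.Base) (k : b.support) (v : b.support → ℤ) :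
    pair b k (refl b k v) = - pair b k v := by
  rw [refl_apply, map_sub, map_zsmul, pair_simpleVec_self, smul_eq_mul]; ring

lemma refl_refl (b : P.Base) (k : b.support) (v : b.support → ℤ) :
    refl b k (refl b k v) = v := by
  rw [refl_apply, pair_refl, refl_apply]; simp

lemma refl_injective (b : P.Base) (k : b.support) : Function.Injective (refl b k) :=
  Function.LeftInverse.injective (refl_refl b k)

lemma refl_simpleVec_self (b : P.Base) (k : b.support) :
    refl b k (simpleVec b k) = - simpleVec b k := by
  rw [refl_apply, pair_simpleVec_self]; module

lemma latticePt_refl (b : P.Base) (k : b.support) (v : b.support → ℤ) :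
    latticePt b (refl b k v) = P.reflection k (latticePt b v) := by
  classical
  have hs : latticePt b (simpleVec b k) = P.root k := by
    rw [simpleVec, latticePt_single, one_smul]
  rw [refl_apply, sub_eq_add_neg, ← neg_smul, latticePt_add, latticePt_smul, hs,
    RootPairing.reflection_apply, neg_smul, ← sub_eq_add_neg]
  congr 1
  rw [← Int.cast_smul_eq_zsmul ℝ, ← toLinearMap_latticePt]
  rfl

/-! ### Coordinates of roots -/

omit [P.IsCrystallographic] in
lemma latticePt_rootCoord (b : P.Base) (i : ι) : latticePt b (rootCoord b i) = P.root i := by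
  have h := congrArg (Submodule.subtype _) (b.toWeightBasisInt.sum_repr (P.rootSpanMem ℤ i))
  rw [map_sum] at h
  simpa [latticePt, rootCoord] using h

omit [P.IsCrystallographic] in
lemma rootCoord_simple (b : P.Base) (k : b.support) : rootCoord b k = simpleVec b k := by
  apply latticePt_injective b
  rw [latticePt_rootCoord, simpleVec, latticePt_single, one_smul]

lemma rootCoord_reflectionPerm (b : P.Base) (k : b.support) (i : ι) :
    rootCoord b (P.reflectionPerm k i) = refl b k (rootCoord b i) := by
  apply latticePt_injective b
  rw [latticePt_rootCoord, latticePt_refl, latticePt_rootCoord, root_reflectionPerm]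

omit [P.IsCrystallographic] in
lemma height_eq_sum_rootCoord (b : P.Base) (i : ι) : b.height i = ∑ j, rootCoord b i j := by
  classical
  have h := b.height_eq_sum (i := i)
    (f := fun j => if h : j ∈ b.support then rootCoord b i ⟨j, h⟩ else 0) (by
      rw [← latticePt_rootCoord b i, latticePt, ← Finset.sum_coe_sort b.support]
      simp)
  rw [h, ← Finset.sum_coe_sort b.support]
  simp

omit [P.IsCrystallographic] in
/-- Every root is positive or negative. -/
lemma rootCoord_nonneg_or_nonpos (b : P.Base) (i : ι) :
    0 ≤ rootCoord b i ∨ rootCoord b i ≤ 0 := by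
  classical
  obtain ⟨f, -, hf, he⟩ := b.exists_root_eq_sum_int i
  have : rootCoord b i = fun j : b.support => f j := by
    apply latticePt_injective b
    rw [latticePt_rootCoord, he, latticePt, ← Finset.sum_coe_sort b.support]
  rw [this]
  rcases hf with hf | hf
  · exact Or.inl fun j => hf.le j
  · exact Or.inr fun j => hf.le j

omit [P.IsCrystallographic] in
lemma isPos_iff_nonneg (b : P.Base) (i : ι) : b.IsPos i ↔ 0 ≤ rootCoord b i := by
  rw [Base.isPos_iff', height_eq_sum_rootCoord]
  refine ⟨fun h => ?_, fun h => Finset.sum_nonneg fun j _ => h j⟩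
  rcases rootCoord_nonneg_or_nonpos b i with h1 | h1
  · exact h1
  · intro j
    have h2 := (Finset.sum_eq_zero_iff_of_nonpos fun j _ => h1 j).1
      (le_antisymm (Finset.sum_nonpos fun j _ => h1 j) h)
    exact (h2 j (Finset.mem_univ j)).ge

omit [P.IsCrystallographic] in
lemma rootCoord_ne_zero (b : P.Base) (i : ι) : rootCoord b i ≠ 0 := by
  intro h
  apply b.height_ne_zero i
  rw [height_eq_sum_rootCoord, h]; simp

/-! ### Simply-laced diagrams -/

omit [P.IsCrystallographic] in
lemma adj_comm (b : P.Base) {i j : b.support} (h : Adj b i j) : Adj b j i :=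
  ⟨h.1.symm, fun h' => h.2 (P.pairing_eq_zero_iff'.1 h')⟩

lemma pairingIn_of_adj (b : P.Base) (hsl : b.cartanMatrix.IsSimplyLaced) {i j : b.support}
    (h : Adj b i j) : P.pairingIn ℤ i j = -1 := by
  rcases hsl h.1 with h1 | h1
  · exfalso
    apply h.2
    have h2 : P.pairingIn ℤ (i : ι) (j : ι) = 0 := h1
    rw [← P.algebraMap_pairingIn ℤ (i : ι) (j : ι), h2, map_zero]
  · exact h1

lemma pairingIn_of_not_adj (b : P.Base) {i j : b.support} (hij : i ≠ j) (h : ¬ Adj b i j) :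
    P.pairingIn ℤ i j = 0 := by
  have : P.pairing i j = 0 := by
    by_contra h'
    exact h ⟨hij, h'⟩
  rw [← P.algebraMap_pairingIn ℤ i j] at this
  simpa using this

lemma pair_simpleVec_of_adj (b : P.Base) (hsl : b.cartanMatrix.IsSimplyLaced) {i j : b.support}
    (h : Adj b i j) : pair b j (simpleVec b i) = -1 := by
  rw [simpleVec, pair_single, pairingIn_of_adj b hsl h, one_mul]

lemma pair_simpleVec_of_not_adj (b : P.Base) {i j : b.support} (hij : i ≠ j) (h : ¬ Adj b i j) :
    pair b j (simpleVec b i) = 0 := by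
  rw [simpleVec, pair_single, pairingIn_of_not_adj b hij h, one_mul]

open Classical in
lemma pair_eq (b : P.Base) (hsl : b.cartanMatrix.IsSimplyLaced) (k : b.support)
    (v : b.support → ℤ) : pair b k v = 2 * v k - ∑ j : b.support with Adj b j k, v j := by
  have h1 : ∀ j : b.support, v j * P.pairingIn ℤ j k =
      (if j = k then 2 * v k else 0) - (if Adj b j k then v j else 0) := by
    intro j
    by_cases hj : j = k
    · subst hj
      have : ¬ Adj b j j := fun h => h.1 rfl
      simp [this]; ring
    · by_cases ha : Adj b j k
      · simp [hj, ha, pairingIn_of_adj b hsl ha]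
      · simp [hj, ha, pairingIn_of_not_adj b hj ha]
  rw [pair_apply, Finset.sum_congr rfl fun j _ => h1 j, Finset.sum_sub_distrib]
  simp [Finset.sum_filter]

lemma refl_simpleVec_of_adj (b : P.Base) (hsl : b.cartanMatrix.IsSimplyLaced) {i j : b.support}
    (h : Adj b i j) : refl b j (simpleVec b i) = simpleVec b i + simpleVec b j := by
  rw [refl_apply, pair_simpleVec_of_adj b hsl h]; module

lemma refl_simpleVec_of_not_adj (b : P.Base) {i j : b.support} (hij : i ≠ j) (h : ¬ Adj b i j) :
    refl b j (simpleVec b i) = simpleVec b i := by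
  rw [refl_apply, pair_simpleVec_of_not_adj b hij h]; module

lemma refl_braid (b : P.Base) (hsl : b.cartanMatrix.IsSimplyLaced) {i j : b.support}
    (h : Adj b i j) (v : b.support → ℤ) :
    refl b i (refl b j (refl b i v)) = refl b j (refl b i (refl b j v)) := by
  have h1 := pair_simpleVec_of_adj b hsl h
  have h2 := pair_simpleVec_of_adj b hsl (adj_comm b h)
  simp only [refl_apply, map_sub, map_zsmul, h1, h2, pair_simpleVec_self]
  module

lemma refl_comm (b : P.Base) {i j : b.support} (hij : i ≠ j)
    (h : ¬ Adj b i j) (v : b.support → ℤ) :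
    refl b i (refl b j v) = refl b j (refl b i v) := by
  have h1 := pair_simpleVec_of_not_adj b hij h
  have h2 := pair_simpleVec_of_not_adj b hij.symm fun h' => h (adj_comm b h')
  simp only [refl_apply, map_sub, map_zsmul, h1, h2]
  module

/-! ### Words and reduced words -/

/-- The action of the word `σ_{i₁} ⋯ σ_{iₙ}` on the root lattice. -/
def act (b : P.Base) (L : List b.support) : (b.support → ℤ) →+ (b.support → ℤ) :=
  L.foldr (fun k f => (refl b k).comp f) (AddMonoidHom.id _)

@[simp] lemma act_nil (b : P.Base) (v : b.support → ℤ) : act b [] v = v := rfl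

@[simp] lemma act_cons (b : P.Base) (k : b.support) (L : List b.support) (v : b.support → ℤ) :
    act b (k :: L) v = refl b k (act b L v) := rfl

@[simp] lemma act_append (b : P.Base) (L L' : List b.support) (v : b.support → ℤ) :
    act b (L ++ L') v = act b L (act b L' v) := by
  induction L with
  | nil => rfl
  | cons k L ih => simp [ih]

lemma act_reverse_act (b : P.Base) (L : List b.support) (v : b.support → ℤ) :
    act b L.reverse (act b L v) = v := by
  induction L generalizing v with
  | nil => rfl
  | cons k L ih => simp [refl_refl, ih]

lemma latticePt_act (b : P.Base) (L : List b.support) (v : b.support → ℤ) :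
    latticePt b (act b L v) = wordProd b L • latticePt b v := by
  induction L with
  | nil => simp [wordProd]
  | cons k L ih =>
    rw [act_cons, latticePt_refl, ih]
    simp only [wordProd, List.map_cons, List.prod_cons, mul_smul, weylGroup.ofIdx_smul]
    rfl

lemma act_eq_of_wordProd_eq (b : P.Base) {L L' : List b.support} (h : wordProd b L = wordProd b L')
    (v : b.support → ℤ) : act b L v = act b L' v := by
  apply latticePt_injective b
  rw [latticePt_act, h, latticePt_act]

/-- `v` is the coordinate vector of a root. -/
def IsRootVec (b : P.Base) (v : b.support → ℤ) : Prop := ∃ i, rootCoord b i = v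

lemma isRootVec_refl (b : P.Base) (k : b.support) {v : b.support → ℤ} (h : IsRootVec b v) :
    IsRootVec b (refl b k v) := by
  obtain ⟨i, rfl⟩ := h
  exact ⟨_, rootCoord_reflectionPerm b k i⟩

lemma isRootVec_act (b : P.Base) (L : List b.support) {v : b.support → ℤ} (h : IsRootVec b v) :
    IsRootVec b (act b L v) := by
  induction L with
  | nil => exact h
  | cons k L ih => exact isRootVec_refl b k ih

omit [P.IsCrystallographic] in
lemma isRootVec_simpleVec (b : P.Base) (k : b.support) : IsRootVec b (simpleVec b k) :=
  ⟨k, rootCoord_simple b k⟩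

omit [P.IsCrystallographic] in
lemma IsRootVec.nonneg_of_not_nonpos {b : P.Base} {v : b.support → ℤ} (h : IsRootVec b v)
    (h' : ¬ v ≤ 0) : 0 ≤ v := by
  obtain ⟨i, rfl⟩ := h
  exact (rootCoord_nonneg_or_nonpos b i).resolve_right h'

omit [P.IsCrystallographic] in
lemma IsRootVec.not_nonpos_of_nonneg {b : P.Base} {v : b.support → ℤ} (h : IsRootVec b v)
    (h' : 0 ≤ v) : ¬ v ≤ 0 := by
  obtain ⟨i, rfl⟩ := h
  exact fun h1 => rootCoord_ne_zero b i (le_antisymm h1 h')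

/-- A word `σ_{i₁} ⋯ σ_{iₙ}` is reduced if `σ_{i₁} ⋯ σ_{i_{m-1}} α_{i_m} > 0` for all `m`. -/
inductive Reduced (b : P.Base) : List b.support → Prop
  | nil : Reduced b []
  | snoc (L : List b.support) (k : b.support) :
      Reduced b L → 0 ≤ act b L (simpleVec b k) → Reduced b (L ++ [k])

/-- An equivalence relation on words that is compatible with right multiplication, contains the
defining relations of the Weyl group as a Coxeter group, and relates only words with the same action
on the root lattice. -/
structure IsBraidRel (b : P.Base) (r : List b.support → List b.support → Prop) : Prop where
  equiv : Equivalence r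
  snoc : ∀ {L L'} (k : b.support), r L L' → r (L ++ [k]) (L' ++ [k])
  sq : ∀ L k, r (L ++ [k] ++ [k]) L
  braid : ∀ L {i j}, Adj b i j → r (L ++ [i] ++ [j] ++ [i]) (L ++ [j] ++ [i] ++ [j])
  comm : ∀ L {i j}, i ≠ j → ¬ Adj b i j → r (L ++ [i] ++ [j]) (L ++ [j] ++ [i])
  act_eq : ∀ {L L'}, r L L' → act b L = act b L'

/-- The exchange property, in the form that a reduced word sending `α_i` to a negative root is related
to a reduced word ending in `σ_i`. The induction on the length looks at the last letter `σ_j` and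
reduces to the rank two subsystem spanned by `α_i` and `α_j`. -/
lemma IsBraidRel.exchange {b : P.Base} (hsl : b.cartanMatrix.IsSimplyLaced)
    {r : List b.support → List b.support → Prop} (hr : IsBraidRel b r) (n : ℕ) :
    ∀ (R : List b.support), R.length = n → Reduced b R → ∀ i, act b R (simpleVec b i) ≤ 0 →
      ∃ R', R'.length + 1 = R.length ∧ Reduced b R' ∧ 0 ≤ act b R' (simpleVec b i) ∧
        r R (R' ++ [i]) := by
  induction n using Nat.strong_induction_on with
  | _ n ih =>
  intro R hn hR i hi
  cases hR with
  | nil =>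
    exfalso
    exact (isRootVec_simpleVec b i).not_nonpos_of_nonneg
      (by simp [simpleVec]) hi
  | snoc R₁ j hR₁ hj =>
  have hlen : R₁.length < n := by rw [← hn]; simp
  by_cases hij : i = j
  · subst hij
    exact ⟨R₁, by simp, hR₁, hj, hr.equiv.refl _⟩
  have key : ∀ {R'}, r R₁ R' → ∀ v, act b R₁ v = act b R' v :=
    fun h v => DFunLike.congr_fun (hr.act_eq h) v
  by_cases ha : Adj b i j
  · have h1 : act b R₁ (simpleVec b i + simpleVec b j) ≤ 0 := by
      rw [← refl_simpleVec_of_adj b hsl ha]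
      simpa using hi
    have h2 : act b R₁ (simpleVec b i) ≤ 0 := by
      intro k
      have h3 := h1 k
      have h4 := hj k
      simp only [map_add, Pi.add_apply, Pi.zero_apply] at h3 h4 ⊢
      linarith
    obtain ⟨R₂, hl₂, hR₂, hp₂, hr₂⟩ := ih _ hlen R₁ rfl hR₁ i h2
    have h5 : act b R₂ (simpleVec b j) ≤ 0 := by
      have h6 := key hr₂ (simpleVec b i + simpleVec b j)
      rw [h6] at h1
      rw [add_comm, ← refl_simpleVec_of_adj b hsl (adj_comm b ha)] at h1
      simpa [refl_refl] using h1
    obtain ⟨R₃, hl₃, hR₃, hp₃, hr₃⟩ := ih _ (by omega) R₂ rfl hR₂ j h5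
    have key₂ : ∀ v, act b R₂ v = act b (R₃ ++ [j]) v :=
      fun v => DFunLike.congr_fun (hr.act_eq hr₃) v
    have h7 : act b R₃ (simpleVec b i) = act b R₁ (simpleVec b j) := by
      have h8 := key hr₂ (simpleVec b j)
      rw [h8, act_append, key₂, act_append]
      simp only [act_cons, act_nil]
      rw [refl_simpleVec_of_adj b hsl (adj_comm b ha), map_add, refl_simpleVec_self,
        refl_simpleVec_of_adj b hsl ha]
      congr 1; abel
    have h9 : 0 ≤ act b (R₃ ++ [i]) (simpleVec b j) := by
      rw [act_append]
      simp only [act_cons, act_nil]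
      rw [refl_simpleVec_of_adj b hsl (adj_comm b ha), map_add, h7]
      exact add_nonneg hp₃ hj
    have h10 : r (R₁ ++ [j]) (R₃ ++ [i] ++ [j] ++ [i]) :=
      hr.equiv.trans (hr.snoc j (hr.equiv.trans hr₂ (hr.snoc i hr₃)))
        (hr.braid R₃ (adj_comm b ha))
    refine ⟨R₃ ++ [i] ++ [j], ?_, Reduced.snoc _ _ (Reduced.snoc _ _ hR₃ (h7 ▸ hj)) h9, ?_, h10⟩
    · simp; omega
    · have h11 : act b (R₁ ++ [j]) (simpleVec b i) =
          act b (R₃ ++ [i] ++ [j] ++ [i]) (simpleVec b i) :=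
        DFunLike.congr_fun (hr.act_eq h10) _
      rw [h11, act_append] at hi
      simp only [act_cons, act_nil] at hi
      rw [refl_simpleVec_self, map_neg] at hi
      simpa using hi
  · have ha' : ¬ Adj b j i := fun h => ha (adj_comm b h)
    have h2 : act b R₁ (simpleVec b i) ≤ 0 := by
      simpa [refl_simpleVec_of_not_adj b hij ha] using hi
    obtain ⟨R₂, hl₂, hR₂, hp₂, hr₂⟩ := ih _ hlen R₁ rfl hR₁ i h2
    have h3 : act b R₂ (simpleVec b j) = act b R₁ (simpleVec b j) := by
      rw [key hr₂]
      simp [refl_simpleVec_of_not_adj b (Ne.symm hij) ha']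
    refine ⟨R₂ ++ [j], by simp; omega, Reduced.snoc _ _ hR₂ (h3 ▸ hj), ?_,
      hr.equiv.trans (hr.snoc j hr₂) (hr.comm R₂ hij ha)⟩
    simpa [refl_simpleVec_of_not_adj b hij ha] using hp₂

lemma IsBraidRel.exists_reduced {b : P.Base} (hsl : b.cartanMatrix.IsSimplyLaced)
    {r : List b.support → List b.support → Prop} (hr : IsBraidRel b r) (L : List b.support) :
    ∃ R, Reduced b R ∧ r L R := by
  induction L using List.reverseRecOn with
  | nil => exact ⟨[], Reduced.nil, hr.equiv.refl _⟩
  | append_singleton L k ih =>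
    obtain ⟨R, hR, hLR⟩ := ih
    by_cases h : act b R (simpleVec b k) ≤ 0
    · obtain ⟨R', -, hR', -, hRR'⟩ := hr.exchange hsl _ R rfl hR k h
      exact ⟨R', hR', hr.equiv.trans (hr.snoc k (hr.equiv.trans hLR hRR')) (hr.sq R' k)⟩
    · exact ⟨R ++ [k], Reduced.snoc _ _ hR
        ((isRootVec_act b R (isRootVec_simpleVec b k)).nonneg_of_not_nonpos h), hr.snoc k hLR⟩

lemma IsBraidRel.append {b : P.Base} {r : List b.support → List b.support → Prop}
    (hr : IsBraidRel b r) {L L' : List b.support} (h : r L L') (T : List b.support) :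
    r (L ++ T) (L' ++ T) := by
  induction T using List.reverseRecOn with
  | nil => simpa using h
  | append_singleton T k ih =>
    simpa using hr.snoc k ih

lemma IsBraidRel.append_reverse {b : P.Base} {r : List b.support → List b.support → Prop}
    (hr : IsBraidRel b r) (L T : List b.support) : r (L ++ T ++ T.reverse) L := by
  induction T using List.reverseRecOn with
  | nil => simpa using hr.equiv.refl L
  | append_singleton T k ih =>
    have := hr.append (hr.sq (L ++ T) k) T.reverse
    simp only [List.append_assoc, List.reverse_append, List.reverse_singleton] at this ih ⊢
    exact hr.equiv.trans this ih

lemma Reduced.eq_nil {b : P.Base} {R : List b.support} (hR : Reduced b R)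
    (h : ∀ v, act b R v = v) : R = [] := by
  cases hR with
  | nil => rfl
  | snoc L k hL hk =>
    exfalso
    have h1 := h (simpleVec b k)
    simp only [act_append, act_cons, act_nil, refl_simpleVec_self, map_neg] at h1
    refine (isRootVec_act b L (isRootVec_simpleVec b k)).not_nonpos_of_nonneg hk ?_
    have h2 : 0 ≤ simpleVec b k := by simp [simpleVec]
    rw [← h1] at h2
    simpa using h2

/-- Words with the same action on the root lattice are related by every braid relation: every word
is related to a reduced word, and the only reduced word acting trivially is the empty one. -/
lemma IsBraidRel.rel_of_act_eq {b : P.Base} (hsl : b.cartanMatrix.IsSimplyLaced)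
    {r : List b.support → List b.support → Prop} (hr : IsBraidRel b r) {L L' : List b.support}
    (h : ∀ v, act b L v = act b L' v) : r L L' := by
  obtain ⟨R, hR, hLR⟩ := hr.exists_reduced hsl (L ++ L'.reverse)
  have h1 : R = [] := by
    refine hR.eq_nil fun v => ?_
    rw [← DFunLike.congr_fun (hr.act_eq hLR) v, act_append, h]
    have := act_reverse_act b L'.reverse v
    rwa [List.reverse_reverse] at this
  subst h1
  have h2 := hr.append_reverse L L'.reverse
  rw [List.reverse_reverse] at h2
  have h3 := hr.append hLR L'
  exact hr.equiv.trans (hr.equiv.symm h2) h3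

end

/-! ### Laurent monomials and monomial substitutions -/

section

lemma const_eq_algebraMap (b : P.Base) (c : ℂ) : const b c = algebraMap ℂ (RatField b) c := by
  rw [const, IsScalarTower.algebraMap_apply ℂ (MvPolynomial b.support ℂ) (RatField b)]
  rfl

lemma sqrtC_ne_zero {q : ℕ} (hq : 0 < q) : sqrtC q ≠ 0 := by
  rw [sqrtC, Complex.ofReal_ne_zero]
  exact (Real.sqrt_pos.2 (by exact_mod_cast hq)).ne'

lemma sqrtC_sq (q : ℕ) : sqrtC q ^ 2 = q := by
  rw [sqrtC, ← Complex.ofReal_pow, Real.sq_sqrt (Nat.cast_nonneg q)]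
  simp

lemma const_ne_zero (b : P.Base) {c : ℂ} (hc : c ≠ 0) : const b c ≠ 0 := by
  rw [const_eq_algebraMap]
  exact (map_ne_zero _).2 hc

lemma xvar_ne_zero (b : P.Base) (k : b.support) : xvar b k ≠ 0 := by
  intro h
  rw [xvar, ← map_zero (algebraMap (MvPolynomial b.support ℂ) (RatField b))] at h
  exact MvPolynomial.X_ne_zero k (IsFractionRing.injective (MvPolynomial b.support ℂ) _ h)

/-- The Laurent monomial `y^v`, where `y_j = √q x_j`. In the variables `y` the simple reflections
act on monomials through their linear action on exponents. -/
def ymon (b : P.Base) (q : ℕ) (v : b.support → ℤ) : RatField b :=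
  ∏ j : b.support, (const b (sqrtC q) * xvar b j) ^ v j

lemma ymon_add (b : P.Base) {q : ℕ} (hq : 0 < q) (v w : b.support → ℤ) :
    ymon b q (v + w) = ymon b q v * ymon b q w := by
  rw [ymon, ymon, ymon, ← Finset.prod_mul_distrib]
  exact Finset.prod_congr rfl fun j _ =>
    zpow_add₀ (mul_ne_zero (const_ne_zero b (sqrtC_ne_zero hq)) (xvar_ne_zero b j)) _ _

@[simp] lemma ymon_zero (b : P.Base) (q : ℕ) : ymon b q 0 = 1 := by simp [ymon]

lemma ymon_ne_zero (b : P.Base) {q : ℕ} (hq : 0 < q) (v : b.support → ℤ) : ymon b q v ≠ 0 :=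
  Finset.prod_ne_zero_iff.2 fun j _ => zpow_ne_zero _
    (mul_ne_zero (const_ne_zero b (sqrtC_ne_zero hq)) (xvar_ne_zero b j))

lemma ymon_zsmul (b : P.Base) (q : ℕ) (n : ℤ) (v : b.support → ℤ) :
    ymon b q (n • v) = ymon b q v ^ n := by
  rw [ymon, ymon, ← Finset.prod_zpow]
  refine Finset.prod_congr rfl fun j _ => ?_
  rw [Pi.smul_apply, smul_eq_mul, mul_comm n, zpow_mul]

lemma ymon_neg (b : P.Base) (q : ℕ) (v : b.support → ℤ) :
    ymon b q (-v) = (ymon b q v)⁻¹ := by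
  rw [← neg_one_zsmul, ymon_zsmul, zpow_neg_one]

lemma ymon_simpleVec (b : P.Base) (q : ℕ) (k : b.support) :
    ymon b q (simpleVec b k) = const b (sqrtC q) * xvar b k := by
  rw [ymon, Finset.prod_eq_single k] <;> simp +contextual [simpleVec]

/-- The monoid homomorphism `v ↦ y^v`. -/
def ymonHom (b : P.Base) {q : ℕ} (hq : 0 < q) : Multiplicative (b.support → ℤ) →* RatField b where
  toFun v := ymon b q v.toAdd
  map_one' := ymon_zero b q
  map_mul' v w := ymon_add b hq v.toAdd w.toAdd

lemma ymon_sum (b : P.Base) {q : ℕ} (hq : 0 < q) {κ : Type*} (S : Finset κ)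
    (v : κ → b.support → ℤ) : ymon b q (∑ i ∈ S, v i) = ∏ i ∈ S, ymon b q (v i) := by
  have := map_prod (ymonHom b hq) (fun i => Multiplicative.ofAdd (v i)) S
  rwa [← ofAdd_sum] at this

lemma xvar_eq (b : P.Base) {q : ℕ} (hq : 0 < q) (k : b.support) :
    xvar b k = (sqrtC q)⁻¹ • ymon b q (simpleVec b k) := by
  rw [ymon_simpleVec, Algebra.smul_def, const_eq_algebraMap, ← mul_assoc, ← map_mul,
    inv_mul_cancel₀ (sqrtC_ne_zero hq), map_one, one_mul]

lemma algebraMap_monomial (b : P.Base) {q : ℕ} (hq : 0 < q) (m : b.support →₀ ℕ) (c : ℂ) :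
    algebraMap (MvPolynomial b.support ℂ) (RatField b) (MvPolynomial.monomial m c) =
      (c * (sqrtC q)⁻¹ ^ (∑ j, m j)) • ymon b q (fun j => m j) := by
  rw [MvPolynomial.monomial_eq, Finsupp.prod_fintype _ _ (fun _ => pow_zero _),
    map_mul (algebraMap (MvPolynomial b.support ℂ) (RatField b)), map_prod,
    ymon, Algebra.smul_def, map_mul (algebraMap ℂ (RatField b)), mul_assoc, ← Finset.prod_pow_eq_pow_sum, map_prod,
    ← Finset.prod_mul_distrib]
  congr 1
  refine Finset.prod_congr rfl fun j _ => ?_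
  rw [map_pow, map_pow, zpow_natCast, ← mul_pow, ← mul_assoc, const_eq_algebraMap, ← map_mul,
    inv_mul_cancel₀ (sqrtC_ne_zero hq), map_one, one_mul, xvar]

lemma sum_smul_ymon_eq_zero (b : P.Base) {q : ℕ} (hq : 0 < q) (S : Finset (b.support → ℤ))
    (c : (b.support → ℤ) → ℂ) (h : ∑ v ∈ S, c v • ymon b q v = 0) : ∀ v ∈ S, c v = 0 := by
  classical
  -- multiplying by a monomial `y^w` makes all the exponents nonnegative
  let w : b.support → ℤ := fun j => ∑ v ∈ S, |v j|
  have hw : ∀ v ∈ S, ∀ j, 0 ≤ v j + w j := by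
    intro v hv j
    have h1 := Finset.single_le_sum (f := fun v : b.support → ℤ => |v j|)
      (fun v _ => abs_nonneg _) hv
    have h2 := neg_abs_le (v j)
    simp only [w]
    linarith
  let e : (b.support → ℤ) → (b.support →₀ ℕ) :=
    fun v => Finsupp.equivFunOnFinite.symm fun j => (v j + w j).toNat
  have he : ∀ v ∈ S, (fun j => (e v j : ℤ)) = v + w := by
    intro v hv
    funext j
    simpa [e] using hw v hv j
  have hinj : ∀ v ∈ S, ∀ v' ∈ S, e v = e v' → v = v' := by
    intro v hv v' hv' hvv
    have := he v hv
    rw [hvv, he v' hv'] at this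
    exact (add_right_cancel this).symm
  let p : MvPolynomial b.support ℂ :=
    ∑ v ∈ S, MvPolynomial.monomial (e v) (c v * sqrtC q ^ (∑ j, e v j))
  have hp : algebraMap _ (RatField b) p = 0 := by
    have h1 : (∑ v ∈ S, c v • ymon b q v) * ymon b q w = 0 := by rw [h, zero_mul]
    rw [← h1, map_sum, Finset.sum_mul]
    refine Finset.sum_congr rfl fun v hv => ?_
    rw [algebraMap_monomial b hq, he v hv, smul_mul_assoc, ← ymon_add b hq, mul_assoc, ← mul_pow,
      mul_inv_cancel₀ (sqrtC_ne_zero hq), one_pow, mul_one]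
  have hp0 : p = 0 := by
    rw [← map_zero (algebraMap (MvPolynomial b.support ℂ) (RatField b))] at hp
    exact IsFractionRing.injective (MvPolynomial b.support ℂ) _ hp
  intro v hv
  have h2 := congrArg (MvPolynomial.coeff (e v)) hp0
  simp only [p, MvPolynomial.coeff_sum, MvPolynomial.coeff_monomial, MvPolynomial.coeff_zero] at h2
  rw [Finset.sum_eq_single v] at h2
  · simpa [pow_ne_zero, sqrtC_ne_zero hq] using h2
  · intro v' hv' hne
    rw [if_neg fun h3 => hne (hinj _ hv' _ hv h3)]
  · exact fun h3 => absurd hv h3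

/-- The Laurent monomials are linearly independent. -/
lemma linearIndependent_ymon (b : P.Base) {q : ℕ} (hq : 0 < q) :
    LinearIndependent ℂ (ymon b q) :=
  linearIndependent_iff'.2 fun S c h v hv => sum_smul_ymon_eq_zero b hq S c h v hv

/-- Polynomials are linear combinations of Laurent monomials. -/
lemma algebraMap_mem_span (b : P.Base) {q : ℕ} (hq : 0 < q) (p : MvPolynomial b.support ℂ) :
    algebraMap _ (RatField b) p ∈ Submodule.span ℂ (Set.range (ymon b q)) := by
  induction p using MvPolynomial.induction_on' with
  | monomial m c =>
    rw [algebraMap_monomial b hq]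
    exact Submodule.smul_mem _ _ (Submodule.subset_span ⟨_, rfl⟩)
  | add p p' hp hp' =>
    rw [map_add]
    exact add_mem hp hp'

/-- A substitution of scaled monomials with independent exponents does not kill polynomials. -/
lemma eval_monomials_injective (b : P.Base) {q : ℕ} (hq : 0 < q) (g : b.support → RatField b)
    (A : (b.support → ℤ) →+ (b.support → ℤ)) (hA : Function.Injective A) (c : b.support → ℂ)
    (hc : ∀ j, c j ≠ 0) (hg : ∀ j, g j = c j • ymon b q (A (simpleVec b j))) :
    Function.Injective (MvPolynomial.aeval (R := ℂ) g) := by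
  classical
  rw [injective_iff_map_eq_zero]
  intro p hp
  let d : (b.support →₀ ℕ) → (b.support → ℤ) := fun m => A fun j => m j
  have hd : Function.Injective d := by
    intro m m' h
    have h1 := hA h
    ext j
    exact_mod_cast congrFun h1 j
  have hmon : ∀ m : b.support →₀ ℕ, ∏ j, g j ^ m j = (∏ j, c j ^ m j) • ymon b q (d m) := by
    intro m
    have h1 : d m = ∑ j, (m j : ℤ) • A (simpleVec b j) := by
      simp only [d, ← map_zsmul, ← map_sum]
      congr 1
      funext k
      simp [simpleVec, Finset.sum_apply, Pi.single_apply]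
    rw [h1, ymon_sum b hq, Algebra.smul_def, map_prod, ← Finset.prod_mul_distrib]
    refine Finset.prod_congr rfl fun j _ => ?_
    rw [hg, Algebra.smul_def, mul_pow, map_pow, ymon_zsmul, zpow_natCast]
  rw [MvPolynomial.aeval_def, MvPolynomial.eval₂_eq'] at hp
  have h1 : ∑ m ∈ p.support, (p.coeff m * ∏ j, c j ^ m j) • ymon b q (d m) = 0 := by
    rw [← hp]
    refine Finset.sum_congr rfl fun m _ => ?_
    rw [hmon, mul_smul, Algebra.smul_def]
  have h2 := linearIndependent_iff'.1 ((linearIndependent_ymon b hq).comp d hd) p.support _ h1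
  ext m
  by_cases hm : m ∈ p.support
  · have h3 := h2 m hm
    rw [mul_eq_zero, or_iff_left
      (Finset.prod_ne_zero_iff.2 fun j _ => pow_ne_zero _ (hc j))] at h3
    simpa using h3
  · simpa using hm

/-- The substitution of a tuple at which no nonzero polynomial vanishes, as an endomorphism of the
field of rational functions. -/
def substHom (b : P.Base) (g : b.support → RatField b)
    (hg : Function.Injective (MvPolynomial.aeval (R := ℂ) g)) : RatField b →ₐ[ℂ] RatField b :=
  IsFractionRing.liftAlgHom hg

lemma substHom_algebraMap (b : P.Base) (g : b.support → RatField b)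
    (hg : Function.Injective (MvPolynomial.aeval (R := ℂ) g)) (p : MvPolynomial b.support ℂ) :
    substHom b g hg (algebraMap _ _ p) = MvPolynomial.aeval g p :=
  IsFractionRing.lift_algebraMap (g := (MvPolynomial.aeval (R := ℂ) g).toRingHom) hg p

lemma substHom_xvar (b : P.Base) (g : b.support → RatField b)
    (hg : Function.Injective (MvPolynomial.aeval (R := ℂ) g)) (j : b.support) :
    substHom b g hg (xvar b j) = g j := by
  rw [xvar, substHom_algebraMap, MvPolynomial.aeval_X]

lemma ratSubst_eq_substHom (b : P.Base) (g : b.support → RatField b)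
    (hg : Function.Injective (MvPolynomial.aeval (R := ℂ) g)) (f : RatField b) :
    ratSubst b g f = substHom b g hg f := by
  have h : ∀ p : MvPolynomial b.support ℂ, MvPolynomial.eval₂
      ((algebraMap (MvPolynomial b.support ℂ) (RatField b)).comp MvPolynomial.C) g p =
      substHom b g hg (algebraMap _ _ p) := by
    intro p
    rw [substHom_algebraMap, MvPolynomial.aeval_def]
    congr 1
  rw [ratSubst, h, h, ← map_div₀]
  congr 1
  rw [div_eq_iff]
  · exact (IsLocalization.sec_spec (nonZeroDivisors (MvPolynomial b.support ℂ)) f).symm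
  · exact IsFractionRing.to_map_ne_zero_of_mem_nonZeroDivisors
      (IsLocalization.sec (nonZeroDivisors (MvPolynomial b.support ℂ)) f).2.2

lemma algHom_smul (b : P.Base) (F : RatField b →ₐ[ℂ] RatField b) (c : ℂ) (f : RatField b) :
    F (c • f) = c • F f := by
  rw [Algebra.smul_def, map_mul, AlgHom.commutes, Algebra.smul_def]

lemma substHom_ymon (b : P.Base) (q : ℕ) (g : b.support → RatField b)
    (hg : Function.Injective (MvPolynomial.aeval (R := ℂ) g)) (v : b.support → ℤ) :
    substHom b g hg (ymon b q v) = ∏ j, (sqrtC q • g j) ^ v j := by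
  rw [ymon, map_prod]
  refine Finset.prod_congr rfl fun j _ => ?_
  rw [map_zpow₀, const_eq_algebraMap, ← Algebra.smul_def, algHom_smul, substHom_xvar]

/-- Two field endomorphisms over `ℂ` that agree on Laurent monomials are equal. -/
lemma algHom_ext_ymon (b : P.Base) {q : ℕ} (hq : 0 < q) {F G : RatField b →ₐ[ℂ] RatField b}
    (h : ∀ v, F (ymon b q v) = G (ymon b q v)) (f : RatField b) : F f = G f := by
  have h1 : ∀ p : MvPolynomial b.support ℂ, F (algebraMap _ _ p) = G (algebraMap _ _ p) := by
    intro p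
    refine Submodule.span_induction (p := fun x _ => F x = G x) ?_ (by simp) ?_ ?_
      (algebraMap_mem_span b hq p)
    · rintro _ ⟨v, rfl⟩
      exact h v
    · intro x y _ _ hx hy
      rw [map_add, map_add, hx, hy]
    · intro c x _ hx
      rw [algHom_smul, algHom_smul, hx]
  obtain ⟨u, v, -, rfl⟩ := IsFractionRing.div_surjective (A := MvPolynomial b.support ℂ) f
  rw [map_div₀, map_div₀, h1, h1]

variable [P.IsCrystallographic]

omit [P.IsCrystallographic] in
lemma sum_smul_simpleVec (b : P.Base) (v : b.support → ℤ) : ∑ j, v j • simpleVec b j = v := by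
  classical
  funext k
  simp [simpleVec, Finset.sum_apply, Pi.single_apply]

lemma sigmaPt_eq (b : P.Base) (hsl : b.cartanMatrix.IsSimplyLaced) {q : ℕ} (hq : 0 < q)
    (i j : b.support) :
    sigmaPt b q i j = (sqrtC q)⁻¹ • ymon b q (refl b i (simpleVec b j)) := by
  have hs := const_ne_zero b (sqrtC_ne_zero hq)
  have hx := xvar_ne_zero b
  have hqs : const b q = const b (sqrtC q) * const b (sqrtC q) := by
    simp only [const_eq_algebraMap]
    rw [← map_mul, ← sq, sqrtC_sq]
  rw [Algebra.smul_def, map_inv₀, ← const_eq_algebraMap, sigmaPt]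
  split_ifs with h1 h2
  · subst h1
    rw [refl_simpleVec_self, ymon_neg, ymon_simpleVec, hqs]
    field_simp
  · rw [refl_simpleVec_of_adj b hsl (adj_comm b h2), ymon_add b hq, ymon_simpleVec, ymon_simpleVec]
    field_simp
  · rw [refl_simpleVec_of_not_adj b h1 fun h => h2 (adj_comm b h), ymon_simpleVec]
    field_simp

lemma sigmaPt_injective (b : P.Base) (hsl : b.cartanMatrix.IsSimplyLaced) {q : ℕ} (hq : 0 < q)
    (i : b.support) : Function.Injective (MvPolynomial.aeval (R := ℂ) (sigmaPt b q i)) :=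
  eval_monomials_injective b hq _ (refl b i) (refl_injective b i) (fun _ => (sqrtC q)⁻¹)
    (fun _ => inv_ne_zero (sqrtC_ne_zero hq)) (sigmaPt_eq b hsl hq i)

omit [P.IsCrystallographic] in
open Classical in
lemma epsPt_eq (b : P.Base) {q : ℕ} (hq : 0 < q) (i j : b.support) :
    epsPt b i j = ((if Adj b i j then -1 else 1) * (sqrtC q)⁻¹) • ymon b q (simpleVec b j) := by
  rw [mul_smul, ← xvar_eq b hq, epsPt]
  split_ifs <;> simp

omit [P.IsCrystallographic] in
lemma epsPt_injective (b : P.Base) (i : b.support) :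
    Function.Injective (MvPolynomial.aeval (R := ℂ) (epsPt b i)) := by
  classical
  refine eval_monomials_injective b (q := 1) one_pos _ (AddMonoidHom.id _) Function.injective_id
    (fun j => (if Adj b i j then -1 else 1) * (sqrtC 1)⁻¹) (fun j => ?_) (epsPt_eq b one_pos i)
  have := inv_ne_zero (sqrtC_ne_zero one_pos)
  split_ifs <;> simpa using this

/-- The change of variables `f(x) ↦ f(σ_i x)`. -/
def sigmaHom (b : P.Base) (hsl : b.cartanMatrix.IsSimplyLaced) {q : ℕ} (hq : 0 < q)
    (i : b.support) : RatField b →ₐ[ℂ] RatField b :=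
  substHom b (sigmaPt b q i) (sigmaPt_injective b hsl hq i)

/-- The change of variables `f(x) ↦ f(ε_i x)`. -/
def epsHom (b : P.Base) (i : b.support) : RatField b →ₐ[ℂ] RatField b :=
  substHom b (epsPt b i) (epsPt_injective b i)

lemma sigmaSubst_eq (b : P.Base) (hsl : b.cartanMatrix.IsSimplyLaced) {q : ℕ} (hq : 0 < q)
    (i : b.support) (f : RatField b) : sigmaSubst b q i f = sigmaHom b hsl hq i f :=
  ratSubst_eq_substHom b _ _ f

lemma epsSubst_eq (b : P.Base) (i : b.support) (f : RatField b) :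
    epsSubst b i f = epsHom b i f :=
  ratSubst_eq_substHom b _ _ f

lemma sigmaHom_ymon (b : P.Base) (hsl : b.cartanMatrix.IsSimplyLaced) {q : ℕ} (hq : 0 < q)
    (i : b.support) (v : b.support → ℤ) :
    sigmaHom b hsl hq i (ymon b q v) = ymon b q (refl b i v) := by
  rw [sigmaHom, substHom_ymon b q]
  conv_rhs => rw [← sum_smul_simpleVec b v, map_sum, ymon_sum b hq]
  refine Finset.prod_congr rfl fun j _ => ?_
  rw [map_zsmul, ymon_zsmul, sigmaPt_eq b hsl hq, smul_smul, mul_inv_cancel₀ (sqrtC_ne_zero hq),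
    one_smul]

/-- The sign changes `ε_i` act on monomials through the parity of `⟨v, α_i^∨⟩`: modulo `2`, this
is the sum of the coordinates of `v` at the neighbours of `i`. -/
lemma epsHom_ymon (b : P.Base) (hsl : b.cartanMatrix.IsSimplyLaced) {q : ℕ} (hq : 0 < q)
    (i : b.support) (v : b.support → ℤ) :
    epsHom b i (ymon b q v) = (-1) ^ pair b i v * ymon b q v := by
  classical
  rw [epsHom, substHom_ymon b q]
  conv_rhs => rw [← sum_smul_simpleVec b v, ymon_sum b hq, sum_smul_simpleVec b v]
  have h1 : pair b i v = ∑ j, v j * pair b i (simpleVec b j) := by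
    conv_lhs => rw [← sum_smul_simpleVec b v, map_sum]
    exact Finset.sum_congr rfl fun j _ => by rw [map_zsmul, smul_eq_mul]
  have h2 : ((-1 : RatField b)) ^ pair b i v = ∏ j, ((-1) ^ pair b i (simpleVec b j)) ^ v j := by
    rw [h1]
    have h3 : ∀ S : Finset b.support, ((-1 : RatField b)) ^ (∑ j ∈ S, v j * pair b i (simpleVec b j))
        = ∏ j ∈ S, ((-1) ^ pair b i (simpleVec b j)) ^ v j := by
      intro S
      induction S using Finset.induction_on with
      | empty => simp
      | insert j S hj ih =>
        rw [Finset.sum_insert hj, Finset.prod_insert hj, zpow_add₀ (by simp), ih, mul_comm (v j),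
          zpow_mul]
    exact h3 _
  rw [h2, ← Finset.prod_mul_distrib]
  refine Finset.prod_congr rfl fun j _ => ?_
  rw [epsPt_eq b hq, smul_smul, mul_left_comm, mul_inv_cancel₀ (sqrtC_ne_zero hq), mul_one,
    ymon_zsmul, ← mul_zpow]
  congr 1
  by_cases hij : i = j
  · subst hij
    have : ¬ Adj b i i := fun h => h.1 rfl
    rw [if_neg this, pair_simpleVec_self, one_smul]
    norm_num
  · by_cases ha : Adj b i j
    · rw [if_pos ha, pair_simpleVec_of_adj b hsl (adj_comm b ha)]
      rw [zpow_neg_one, inv_neg_one, Algebra.smul_def, map_neg, map_one]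
    · rw [if_neg ha, pair_simpleVec_of_not_adj b (Ne.symm hij) fun h => ha (adj_comm b h)]
      simp

end

/-! ### Relations between the changes of variables -/

section

variable [P.IsCrystallographic]

lemma zpow_neg_one_eq {K : Type*} [Field K] {m n : ℤ} (h : Even (m - n)) :
    ((-1 : K)) ^ m = (-1) ^ n := by
  have h1 : m = (m - n) + n := by ring
  rw [h1, zpow_add₀ (by simp), Even.neg_one_zpow h, one_mul]

section

variable (b : P.Base) (hsl : b.cartanMatrix.IsSimplyLaced) {q : ℕ} (hq : 0 < q)

omit [P.IsCrystallographic] in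
lemma map_neg_one_zpow (F : RatField b →ₐ[ℂ] RatField b) (n : ℤ) :
    F ((-1) ^ n) = (-1) ^ n := by
  rw [map_zpow₀, map_neg, map_one]

omit [P.IsCrystallographic] in
lemma map_const (F : RatField b →ₐ[ℂ] RatField b) (c : ℂ) :
    F (const b c) = const b c := by
  rw [const_eq_algebraMap, AlgHom.commutes]

lemma sigmaHom_sigmaHom (i : b.support) (f : RatField b) :
    sigmaHom b hsl hq i (sigmaHom b hsl hq i f) = f :=
  algHom_ext_ymon b hq (F := (sigmaHom b hsl hq i).comp (sigmaHom b hsl hq i))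
    (G := AlgHom.id ℂ _) (fun v => by simp [sigmaHom_ymon, refl_refl]) f

include hsl in
lemma epsHom_epsHom (i : b.support) (f : RatField b) : epsHom b i (epsHom b i f) = f :=
  algHom_ext_ymon b one_pos (F := (epsHom b i).comp (epsHom b i))
    (G := AlgHom.id ℂ _) (fun v => by
      simp only [AlgHom.comp_apply, epsHom_ymon b hsl one_pos, map_mul, map_neg_one_zpow,
        ← mul_assoc, ← mul_zpow]
      simp) f

include hsl in
lemma epsHom_comm (i j : b.support) (f : RatField b) :
    epsHom b j (epsHom b i f) = epsHom b i (epsHom b j f) :=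
  algHom_ext_ymon b one_pos (F := (epsHom b j).comp (epsHom b i))
    (G := (epsHom b i).comp (epsHom b j)) (fun v => by
      simp only [AlgHom.comp_apply, epsHom_ymon b hsl one_pos, map_mul, map_neg_one_zpow]
      ring) f

lemma epsHom_sigmaHom_self (i : b.support) (f : RatField b) :
    epsHom b i (sigmaHom b hsl hq i f) = sigmaHom b hsl hq i (epsHom b i f) :=
  algHom_ext_ymon b hq (F := (epsHom b i).comp (sigmaHom b hsl hq i))
    (G := (sigmaHom b hsl hq i).comp (epsHom b i)) (fun v => by
      simp only [AlgHom.comp_apply, epsHom_ymon b hsl hq, sigmaHom_ymon, map_mul, map_neg_one_zpow]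
      rw [pair_refl, zpow_neg_one_eq]
      exact ⟨-pair b i v, by ring⟩) f

lemma epsHom_sigmaHom_of_adj {i j : b.support} (h : Adj b i j) (f : RatField b) :
    epsHom b j (sigmaHom b hsl hq i f) = sigmaHom b hsl hq i (epsHom b i (epsHom b j f)) :=
  algHom_ext_ymon b hq (F := (epsHom b j).comp (sigmaHom b hsl hq i))
    (G := (sigmaHom b hsl hq i).comp ((epsHom b i).comp (epsHom b j))) (fun v => by
      simp only [AlgHom.comp_apply, epsHom_ymon b hsl hq, sigmaHom_ymon, map_mul, map_neg_one_zpow]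
      rw [← mul_assoc, ← zpow_add₀ (by simp), refl_apply b i v, map_sub, map_zsmul,
        pair_simpleVec_of_adj b hsl h, zpow_neg_one_eq]
      exact ⟨0, by simp⟩) f

lemma epsHom_sigmaHom_of_not_adj {i j : b.support} (hij : i ≠ j) (h : ¬ Adj b i j)
    (f : RatField b) :
    epsHom b j (sigmaHom b hsl hq i f) = sigmaHom b hsl hq i (epsHom b j f) :=
  algHom_ext_ymon b hq (F := (epsHom b j).comp (sigmaHom b hsl hq i))
    (G := (sigmaHom b hsl hq i).comp (epsHom b j)) (fun v => by
      simp only [AlgHom.comp_apply, epsHom_ymon b hsl hq, sigmaHom_ymon, map_mul, map_neg_one_zpow]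
      rw [refl_apply b i v, map_sub, map_zsmul, pair_simpleVec_of_not_adj b hij h]
      simp) f

lemma sigmaHom_braid {i j : b.support} (h : Adj b i j) (f : RatField b) :
    sigmaHom b hsl hq i (sigmaHom b hsl hq j (sigmaHom b hsl hq i f)) =
      sigmaHom b hsl hq j (sigmaHom b hsl hq i (sigmaHom b hsl hq j f)) :=
  algHom_ext_ymon b hq
    (F := (sigmaHom b hsl hq i).comp ((sigmaHom b hsl hq j).comp (sigmaHom b hsl hq i)))
    (G := (sigmaHom b hsl hq j).comp ((sigmaHom b hsl hq i).comp (sigmaHom b hsl hq j)))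
    (fun v => by simp only [AlgHom.comp_apply, sigmaHom_ymon, refl_braid b hsl h]) f

lemma sigmaHom_comm {i j : b.support} (hij : i ≠ j) (h : ¬ Adj b i j) (f : RatField b) :
    sigmaHom b hsl hq i (sigmaHom b hsl hq j f) = sigmaHom b hsl hq j (sigmaHom b hsl hq i f) :=
  algHom_ext_ymon b hq
    (F := (sigmaHom b hsl hq i).comp (sigmaHom b hsl hq j))
    (G := (sigmaHom b hsl hq j).comp (sigmaHom b hsl hq i))
    (fun v => by simp only [AlgHom.comp_apply, sigmaHom_ymon, refl_comm b hij h]) f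

end

/-! ### The normalised operators -/

/-- The coefficient of `f(σ_i x)` in `τ_i f`, as a function of `y = y_i` and `s = √q`. -/
def coefA {K : Type*} [Field K] (s : K) (n : ℕ) (y : K) : K :=
  y ^ (n + 1) * ((1 - s) * (1 + y) * (s + y)) * (2 * (s ^ 2 - y ^ 2))⁻¹

/-- The coefficient of `f(ε_i σ_i x)` in `τ_i f`, as a function of `y = y_i` and `s = √q`. -/
def coefB {K : Type*} [Field K] (s : K) (n : ℕ) (y : K) : K :=
  (-1) ^ n * y ^ (n + 1) * ((1 + s) * (1 - y) * (s + y)) * (2 * (s ^ 2 - y ^ 2))⁻¹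

lemma map_coefA {K : Type*} [Field K] (F : K →+* K) {s : K} (hs : F s = s) (n : ℕ) (y : K) :
    F (coefA s n y) = coefA s n (F y) := by
  simp only [coefA, map_mul, map_pow, map_sub, map_add, map_one, map_inv₀, map_ofNat, hs]

lemma map_coefB {K : Type*} [Field K] (F : K →+* K) {s : K} (hs : F s = s) (n : ℕ) (y : K) :
    F (coefB s n y) = coefB s n (F y) := by
  simp only [coefB, map_mul, map_pow, map_sub, map_add, map_one, map_neg, map_inv₀, map_ofNat, hs]

omit [P.IsCrystallographic] in
/-- A Laurent monomial other than `1` is not constant. -/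
lemma ymon_ne_const (b : P.Base) {q : ℕ} (hq : 0 < q) {v : b.support → ℤ} (hv : v ≠ 0) (c : ℂ) :
    ymon b q v ≠ const b c := by
  classical
  intro h
  have h1 : ∑ w ∈ {v, 0}, (if w = v then 1 else -c) • ymon b q w = 0 := by
    rw [Finset.sum_pair hv, if_pos rfl, if_neg hv.symm, h, ymon_zero, const_eq_algebraMap,
      Algebra.algebraMap_eq_smul_one]
    module
  have h2 := sum_smul_ymon_eq_zero b hq {v, 0} _ h1 v (by simp)
  simp at h2

/-- The operator `τ_i f = (Δ(x) / Δ(σ_i x)) (f|_ℓ σ_i)`. The factor `Δ(x) / Δ(σ_i x)` is `-y_i²`,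
so that `j(w, x) (1|_ℓ w)(x)` is obtained from `1` by applying the operators `τ_i` in turn. -/
def tau (b : P.Base) (hsl : b.cartanMatrix.IsSimplyLaced) {q : ℕ} (hq : 0 < q)
    (l : b.support → ℕ) (i : b.support) : RatField b →+ RatField b where
  toFun f :=
    coefA (const b (sqrtC q)) (l i) (ymon b q (simpleVec b i)) * sigmaHom b hsl hq i f +
    coefB (const b (sqrtC q)) (l i) (ymon b q (simpleVec b i)) * sigmaHom b hsl hq i (epsHom b i f)
  map_zero' := by simp
  map_add' f g := by
    simp only [map_add]
    ring

section

variable (b : P.Base) (hsl : b.cartanMatrix.IsSimplyLaced) {q : ℕ} (hq : 0 < q)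
  (l : b.support → ℕ)

lemma tau_apply (i : b.support) (f : RatField b) : tau b hsl hq l i f =
    coefA (const b (sqrtC q)) (l i) (ymon b q (simpleVec b i)) * sigmaHom b hsl hq i f +
    coefB (const b (sqrtC q)) (l i) (ymon b q (simpleVec b i)) *
      sigmaHom b hsl hq i (epsHom b i f) := rfl

lemma tau_mul {i : b.support} {u : RatField b} (hu : epsHom b i u = u) (f : RatField b) :
    tau b hsl hq l i (u * f) = sigmaHom b hsl hq i u * tau b hsl hq l i f := by
  simp only [tau_apply, map_mul, hu]
  ring

lemma tau_smul (i : b.support) (c : ℂ) (f : RatField b) :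
    tau b hsl hq l i (c • f) = c • tau b hsl hq l i f := by
  rw [Algebra.smul_def, tau_mul b hsl hq l (AlgHom.commutes _ _), AlgHom.commutes,
    ← Algebra.smul_def]

/-- The relation `τ_i² = 1`, expanded in `f` and `f(ε_i x)`. -/
lemma coefA_coefB_square {K : Type*} [Field K] [CharZero K] {s y : K} (hy : y ≠ 0)
    (h1 : s ^ 2 - y ^ 2 ≠ 0) (h2 : s ^ 2 - y⁻¹ ^ 2 ≠ 0) (n : ℕ) :
    coefA s n y * coefA s n y⁻¹ + coefB s n y * coefB s n y⁻¹ = 1 ∧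
    coefA s n y * coefB s n y⁻¹ + coefB s n y * coefA s n y⁻¹ = 0 := by
  have hn : y ^ (n + 1) * y⁻¹ ^ (n + 1) = 1 := by
    rw [← mul_pow, mul_inv_cancel₀ hy, one_pow]
  have hu : ((-1 : K) ^ n) * (-1) ^ n = 1 := by rw [← mul_pow]; simp
  have h4 : (s - y) * (s + y) ≠ 0 := by convert h1 using 1; ring
  have h5 : (s * y - 1) * (s * y + 1) ≠ 0 := by
    intro h
    apply h2
    field_simp
    linear_combination h
  have h6 := left_ne_zero_of_mul h4
  have h7 := right_ne_zero_of_mul h4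
  have h8 := left_ne_zero_of_mul h5
  have h9 := right_ne_zero_of_mul h5
  have h10 : y * s + 1 ≠ 0 := by rwa [mul_comm y s]
  have e1 : s ^ 2 - y ^ 2 = (s - y) * (s + y) := by ring
  have e2 : s ^ 2 - y⁻¹ ^ 2 = (s * y - 1) * (s * y + 1) / y ^ 2 := by field_simp; ring
  have e3 : s + y⁻¹ = (s * y + 1) / y := by field_simp
  have e4 : 1 + y⁻¹ = (1 + y) / y := by field_simp; ring
  have e5 : 1 - y⁻¹ = (y - 1) / y := by field_simp
  have eA : coefA s n y = y ^ (n + 1) * ((1 - s) * (1 + y) / (2 * (s - y))) := by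
    rw [coefA, e1]; field_simp
  have eB : coefB s n y = (-1) ^ n * y ^ (n + 1) * ((1 + s) * (1 - y) / (2 * (s - y))) := by
    rw [coefB, e1]; field_simp
  have eA' : coefA s n y⁻¹ = y⁻¹ ^ (n + 1) * ((1 - s) * (1 + y) / (2 * (s * y - 1))) := by
    rw [coefA, e2, e3, e4]; field_simp
  have eB' : coefB s n y⁻¹ =
      (-1) ^ n * y⁻¹ ^ (n + 1) * ((1 + s) * (y - 1) / (2 * (s * y - 1))) := by
    rw [coefB, e2, e3, e5]; field_simp
  rw [eA, eB, eA', eB']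
  constructor
  · have : (1 - s) * (1 + y) / (2 * (s - y)) * ((1 - s) * (1 + y) / (2 * (s * y - 1))) +
        (1 + s) * (1 - y) / (2 * (s - y)) * ((1 + s) * (y - 1) / (2 * (s * y - 1))) = 1 := by
      field_simp; ring
    linear_combination ((1 - s) * (1 + y) / (2 * (s - y)) * ((1 - s) * (1 + y) / (2 * (s * y - 1))) +
      ((-1 : K) ^ n) * (-1) ^ n *
        ((1 + s) * (1 - y) / (2 * (s - y)) * ((1 + s) * (y - 1) / (2 * (s * y - 1))))) * hn +
      ((1 + s) * (1 - y) / (2 * (s - y)) * ((1 + s) * (y - 1) / (2 * (s * y - 1)))) * hu + this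
  · have : (1 - s) * (1 + y) / (2 * (s - y)) * ((1 + s) * (y - 1) / (2 * (s * y - 1))) +
        (1 + s) * (1 - y) / (2 * (s - y)) * ((1 - s) * (1 + y) / (2 * (s * y - 1))) = 0 := by
      field_simp; ring
    linear_combination ((-1 : K) ^ n * y ^ (n + 1) * y⁻¹ ^ (n + 1)) * this

/-- The braid relation of the operators `τ`, after expanding both sides in the four functions obtained
from `f` by the longest element of the rank two group and the sign changes. -/
lemma coef_braid {K : Type*} [Field K] (s x y g₀ g₁ g₂ g₃ : K) (m n : ℕ) :
    coefA s m x * (coefA s n (x * y) * (coefA s m y * g₀)) +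
      coefB s m x * (coefA s n (-(x * y)) * (coefA s m (-y) * g₂)) +
      (coefA s m x * (coefB s n (x * y) * (coefA s m (-y) * g₃)) +
      coefB s m x * (coefB s n (-(x * y)) * (coefA s m y * g₁))) +
      (coefA s m x * (coefA s n (x * y) * (coefB s m y * g₁)) +
      coefB s m x * (coefA s n (-(x * y)) * (coefB s m (-y) * g₃)) +
      (coefA s m x * (coefB s n (x * y) * (coefB s m (-y) * g₂)) +
      coefB s m x * (coefB s n (-(x * y)) * (coefB s m y * g₀)))) =
    coefA s n y * (coefA s m (x * y) * (coefA s n x * g₀)) +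
      coefB s n y * (coefA s m (-(x * y)) * (coefA s n (-x) * g₁)) +
      (coefA s n y * (coefB s m (x * y) * (coefA s n (-x) * g₃)) +
      coefB s n y * (coefB s m (-(x * y)) * (coefA s n x * g₂))) +
      (coefA s n y * (coefA s m (x * y) * (coefB s n x * g₂)) +
      coefB s n y * (coefA s m (-(x * y)) * (coefB s n (-x) * g₃)) +
      (coefA s n y * (coefB s m (x * y) * (coefB s n (-x) * g₁)) +
      coefB s n y * (coefB s m (-(x * y)) * (coefB s n x * g₀)))) := by
  have hA : ∀ k z, coefA s k (-z) =
      -(-1) ^ k * z ^ (k + 1) * ((1 - s) * (1 - z) * (s - z)) * (2 * (s ^ 2 - z ^ 2))⁻¹ := by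
    intro k z
    rw [coefA, neg_pow z (k + 1), neg_sq, pow_succ (-1)]; ring
  have hB : ∀ k z, coefB s k (-z) = -(-1) ^ k * (-1) ^ k * z ^ (k + 1) *
      ((1 + s) * (1 + z) * (s - z)) * (2 * (s ^ 2 - z ^ 2))⁻¹ := by
    intro k z
    rw [coefB, neg_pow z (k + 1), neg_sq, pow_succ (-1)]; ring
  simp only [hA, hB]
  simp only [coefA, coefB, mul_pow x y]
  generalize (2 * (s ^ 2 - x ^ 2))⁻¹ = d₁
  generalize (2 * (s ^ 2 - y ^ 2))⁻¹ = d₂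
  generalize (2 * (s ^ 2 - x ^ 2 * y ^ 2))⁻¹ = d₃
  generalize x ^ (m + 1) = x₁
  generalize x ^ (n + 1) = x₂
  generalize y ^ (m + 1) = y₁
  generalize y ^ (n + 1) = y₂
  rcases neg_one_pow_eq_or K m with h1 | h1 <;> rcases neg_one_pow_eq_or K n with h2 | h2 <;>
    rw [h1, h2] <;> ring

lemma tau_tau (i : b.support) (f : RatField b) :
    tau b hsl hq l i (tau b hsl hq l i f) = f := by
  set x := ymon b q (simpleVec b i) with hx
  have hv : simpleVec b i ≠ 0 := by
    intro h
    have := pair_simpleVec_self b i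
    rw [h, map_zero] at this
    norm_num at this
  have six : sigmaHom b hsl hq i x = x⁻¹ := by
    rw [hx, sigmaHom_ymon, refl_simpleVec_self, ymon_neg]
  have eix : epsHom b i x = x := by
    rw [hx, epsHom_ymon b hsl hq, pair_simpleVec_self]; norm_num
  have hx0 : x ≠ 0 := ymon_ne_zero b hq _
  have hs : const b (sqrtC q) ^ 2 = const b (q : ℂ) := by
    rw [const_eq_algebraMap, ← map_pow, sqrtC_sq, ← const_eq_algebraMap]
  have h1 : const b (sqrtC q) ^ 2 - x ^ 2 ≠ 0 := by
    rw [hs, sub_ne_zero, hx, ← zpow_natCast, ← ymon_zsmul]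
    exact (ymon_ne_const b hq (smul_ne_zero (by norm_num) hv) _).symm
  have h2 : const b (sqrtC q) ^ 2 - x⁻¹ ^ 2 ≠ 0 := by
    rw [hs, sub_ne_zero, hx, ← ymon_neg, ← zpow_natCast, ← ymon_zsmul]
    exact (ymon_ne_const b hq (smul_ne_zero (by norm_num) (neg_ne_zero.2 hv)) _).symm
  obtain ⟨h3, h4⟩ := coefA_coefB_square hx0 h1 h2 (l i)
  have mA : ∀ (F : RatField b →ₐ[ℂ] RatField b) n z, F (coefA (const b (sqrtC q)) n z) =
      coefA (const b (sqrtC q)) n (F z) := fun F n z => map_coefA F.toRingHom (map_const b F _) n z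
  have mB : ∀ (F : RatField b →ₐ[ℂ] RatField b) n z, F (coefB (const b (sqrtC q)) n z) =
      coefB (const b (sqrtC q)) n (F z) := fun F n z => map_coefB F.toRingHom (map_const b F _) n z
  simp only [tau_apply, map_add, map_mul, mA, mB, six, eix,
    epsHom_sigmaHom_self, epsHom_epsHom b hsl, sigmaHom_sigmaHom, ← hx]
  linear_combination f * h3 + epsHom b i f * h4

lemma tau_braid {i j : b.support} (h : Adj b i j) (f : RatField b) :
    tau b hsl hq l i (tau b hsl hq l j (tau b hsl hq l i f)) =
      tau b hsl hq l j (tau b hsl hq l i (tau b hsl hq l j f)) := by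
  have h' := adj_comm b h
  set x := ymon b q (simpleVec b i) with hx
  set y := ymon b q (simpleVec b j) with hy
  have six : sigmaHom b hsl hq i x = x⁻¹ := by
    rw [hx, sigmaHom_ymon, refl_simpleVec_self, ymon_neg]
  have sjy : sigmaHom b hsl hq j y = y⁻¹ := by
    rw [hy, sigmaHom_ymon, refl_simpleVec_self, ymon_neg]
  have siy : sigmaHom b hsl hq i y = x * y := by
    rw [hy, sigmaHom_ymon, refl_simpleVec_of_adj b hsl h', ymon_add b hq, mul_comm]
  have sjx : sigmaHom b hsl hq j x = x * y := by
    rw [hx, sigmaHom_ymon, refl_simpleVec_of_adj b hsl h, ymon_add b hq]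
  have eix : epsHom b i x = x := by
    rw [hx, epsHom_ymon b hsl hq, pair_simpleVec_self]; norm_num
  have ejy : epsHom b j y = y := by
    rw [hy, epsHom_ymon b hsl hq, pair_simpleVec_self]; norm_num
  have eiy : epsHom b i y = -y := by
    rw [hy, epsHom_ymon b hsl hq, pair_simpleVec_of_adj b hsl h', zpow_neg_one, inv_neg_one,
      neg_one_mul]
  have ejx : epsHom b j x = -x := by
    rw [hx, epsHom_ymon b hsl hq, pair_simpleVec_of_adj b hsl h, zpow_neg_one, inv_neg_one,
      neg_one_mul]
  have hx0 : x ≠ 0 := ymon_ne_zero b hq _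
  have hy0 : y ≠ 0 := ymon_ne_zero b hq _
  have mA : ∀ (F : RatField b →ₐ[ℂ] RatField b) n z, F (coefA (const b (sqrtC q)) n z) =
      coefA (const b (sqrtC q)) n (F z) := fun F n z => map_coefA F.toRingHom (map_const b F _) n z
  have mB : ∀ (F : RatField b →ₐ[ℂ] RatField b) n z, F (coefB (const b (sqrtC q)) n z) =
      coefB (const b (sqrtC q)) n (F z) := fun F n z => map_coefB F.toRingHom (map_const b F _) n z
  have c1 : x⁻¹ * (x * y) = y := by field_simp
  have c2 : x * y * y⁻¹ = x := by field_simp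
  simp only [tau_apply, map_add, map_mul, mA, mB, six, sjy, siy, sjx, eix, ejy, eiy, ejx, map_neg,
    epsHom_sigmaHom_self, epsHom_sigmaHom_of_adj b hsl hq h, epsHom_sigmaHom_of_adj b hsl hq h',
    epsHom_comm b hsl i j, epsHom_epsHom b hsl, sigmaHom_braid b hsl hq h, neg_mul,
    mul_neg, neg_neg, c1, c2, ← hx, ← hy]
  generalize sigmaHom b hsl hq j (sigmaHom b hsl hq i (sigmaHom b hsl hq j f)) = g₀
  generalize sigmaHom b hsl hq j (sigmaHom b hsl hq i (sigmaHom b hsl hq j (epsHom b i f))) = g₁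
  generalize sigmaHom b hsl hq j (sigmaHom b hsl hq i (sigmaHom b hsl hq j (epsHom b j f))) = g₂
  generalize sigmaHom b hsl hq j (sigmaHom b hsl hq i (sigmaHom b hsl hq j
    (epsHom b i (epsHom b j f)))) = g₃
  exact coef_braid _ x y g₀ g₁ g₂ g₃ (l i) (l j)

lemma tau_comm {i j : b.support} (hij : i ≠ j) (h : ¬ Adj b i j) (f : RatField b) :
    tau b hsl hq l i (tau b hsl hq l j f) = tau b hsl hq l j (tau b hsl hq l i f) := by
  have h' : ¬ Adj b j i := fun h1 => h (adj_comm b h1)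
  set x := ymon b q (simpleVec b i) with hx
  set y := ymon b q (simpleVec b j) with hy
  have siy : sigmaHom b hsl hq i y = y := by
    rw [hy, sigmaHom_ymon, refl_simpleVec_of_not_adj b hij.symm h']
  have sjx : sigmaHom b hsl hq j x = x := by
    rw [hx, sigmaHom_ymon, refl_simpleVec_of_not_adj b hij h]
  have eiy : epsHom b i y = y := by
    rw [hy, epsHom_ymon b hsl hq, pair_simpleVec_of_not_adj b hij.symm h', zpow_zero, one_mul]
  have ejx : epsHom b j x = x := by
    rw [hx, epsHom_ymon b hsl hq, pair_simpleVec_of_not_adj b hij h, zpow_zero, one_mul]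
  have mA : ∀ (F : RatField b →ₐ[ℂ] RatField b) n z, F (coefA (const b (sqrtC q)) n z) =
      coefA (const b (sqrtC q)) n (F z) := fun F n z => map_coefA F.toRingHom (map_const b F _) n z
  have mB : ∀ (F : RatField b →ₐ[ℂ] RatField b) n z, F (coefB (const b (sqrtC q)) n z) =
      coefB (const b (sqrtC q)) n (F z) := fun F n z => map_coefB F.toRingHom (map_const b F _) n z
  simp only [tau_apply, map_add, map_mul, mA, mB, siy, sjx, eiy, ejx,
    epsHom_sigmaHom_of_not_adj b hsl hq hij h, epsHom_sigmaHom_of_not_adj b hsl hq hij.symm h',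
    epsHom_comm b hsl i j, sigmaHom_comm b hsl hq hij h, ← hx, ← hy]
  ring

/-- The iterated operator `τ_{iₙ} ∘ ⋯ ∘ τ_{i₁}` attached to the word `σ_{i₁} ⋯ σ_{iₙ}`. -/
def tauWord (L : List b.support) (f : RatField b) : RatField b :=
  L.foldl (fun g i => tau b hsl hq l i g) f

lemma tauWord_snoc (L : List b.support) (i : b.support) (f : RatField b) :
    tauWord b hsl hq l (L ++ [i]) f = tau b hsl hq l i (tauWord b hsl hq l L f) := by
  simp [tauWord]

/-- The iterated operator depends only on the action of the word on the root lattice. -/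
lemma isBraidRel_tauWord : IsBraidRel b fun L L' =>
    act b L = act b L' ∧ ∀ f, tauWord b hsl hq l L f = tauWord b hsl hq l L' f where
  equiv := ⟨fun _ => ⟨rfl, fun _ => rfl⟩, fun h => ⟨h.1.symm, fun f => (h.2 f).symm⟩,
    fun h h' => ⟨h.1.trans h'.1, fun f => (h.2 f).trans (h'.2 f)⟩⟩
  snoc k h := ⟨by ext1 v; simp [h.1], fun f => by rw [tauWord_snoc, tauWord_snoc, h.2]⟩
  sq L k := ⟨by ext1 v; simp [refl_refl], fun f => by rw [tauWord_snoc, tauWord_snoc, tau_tau]⟩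
  braid L i j h := ⟨by ext1 v; simp [refl_braid b hsl h], fun f => by
    simp only [tauWord_snoc, tau_braid b hsl hq l h]⟩
  comm L i j hij h := ⟨by ext1 v; simp [refl_comm b hij h], fun f => by
    simp only [tauWord_snoc, tau_comm b hsl hq l hij h]⟩
  act_eq h := h.1

lemma tauWord_eq_of_act_eq {L L' : List b.support} (h : ∀ v, act b L v = act b L' v)
    (f : RatField b) : tauWord b hsl hq l L f = tauWord b hsl hq l L' f :=
  ((isBraidRel_tauWord b hsl hq l).rel_of_act_eq hsl h).2 f

include hsl in
lemma exists_reduced_act_eq (L : List b.support) :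
    ∃ R, Reduced b R ∧ ∀ v, act b L v = act b R v := by
  obtain ⟨R, hR, h⟩ := (isBraidRel_tauWord b hsl one_pos 0).exists_reduced hsl L
  exact ⟨R, hR, fun v => DFunLike.congr_fun h.1 v⟩

end

end

/-! ### Products over positive roots -/

section

variable [P.IsCrystallographic]

omit [P.IsCrystallographic] in
lemma simpleVec_ne_zero (b : P.Base) (k : b.support) : simpleVec b k ≠ 0 := by
  rw [← rootCoord_simple]
  exact rootCoord_ne_zero b k

/-- The factor `1 - c y^{2v}`. -/
def rootFactor (b : P.Base) (q : ℕ) (c : ℂ) (v : b.support → ℤ) : RatField b :=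
  1 - c • ymon b q ((2 : ℤ) • v)

omit [P.IsCrystallographic] in
lemma rootFactor_ne_zero (b : P.Base) {q : ℕ} (hq : 0 < q) (c : ℂ) {v : b.support → ℤ}
    (hv : v ≠ 0) : rootFactor b q c v ≠ 0 := by
  intro h
  rw [rootFactor, sub_eq_zero] at h
  by_cases hc : c = 0
  · simp [hc] at h
  · refine ymon_ne_const b hq (smul_ne_zero two_ne_zero hv) c⁻¹ ?_
    rw [const_eq_algebraMap, Algebra.algebraMap_eq_smul_one, h, smul_smul, inv_mul_cancel₀ hc,
      one_smul]
    rfl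

lemma sigmaHom_rootFactor (b : P.Base) (hsl : b.cartanMatrix.IsSimplyLaced) {q : ℕ} (hq : 0 < q)
    (k : b.support) (c : ℂ) (v : b.support → ℤ) :
    sigmaHom b hsl hq k (rootFactor b q c v) = rootFactor b q c (refl b k v) := by
  rw [rootFactor, map_sub, map_one, algHom_smul, sigmaHom_ymon, map_zsmul, rootFactor]

lemma epsHom_ymon_two (b : P.Base) (hsl : b.cartanMatrix.IsSimplyLaced) {q : ℕ} (hq : 0 < q)
    (k : b.support) (v : b.support → ℤ) :
    epsHom b k (ymon b q ((2 : ℤ) • v)) = ymon b q ((2 : ℤ) • v) := by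
  rw [epsHom_ymon b hsl hq, map_zsmul, smul_eq_mul, Even.neg_one_zpow ⟨pair b k v, by ring⟩,
    one_mul]

lemma epsHom_rootFactor (b : P.Base) (hsl : b.cartanMatrix.IsSimplyLaced) {q : ℕ} (hq : 0 < q)
    (k : b.support) (c : ℂ) (v : b.support → ℤ) :
    epsHom b k (rootFactor b q c v) = rootFactor b q c v := by
  rw [rootFactor, map_sub, map_one, algHom_smul, epsHom_ymon_two b hsl hq]

section

variable [Finite ι]

open Classical in
/-- The finset of positive roots. -/
def posRoots (b : P.Base) : Finset ι :=
  letI := Fintype.ofFinite ι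
  Finset.univ.filter fun i => b.IsPos i

omit [P.IsCrystallographic] in
lemma mem_posRoots (b : P.Base) (i : ι) : i ∈ posRoots b ↔ b.IsPos i := by
  simp [posRoots]

/-- The product `∏_{α > 0} (1 - c y^{2α})`. -/
def rootProd (b : P.Base) (q : ℕ) (c : ℂ) : RatField b :=
  ∏ i ∈ posRoots b, rootFactor b q c (rootCoord b i)

omit [P.IsCrystallographic] in
lemma rootProd_ne_zero (b : P.Base) {q : ℕ} (hq : 0 < q) (c : ℂ) : rootProd b q c ≠ 0 :=
  Finset.prod_ne_zero_iff.2 fun i _ => rootFactor_ne_zero b hq c (rootCoord_ne_zero b i)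

omit [P.IsCrystallographic] in
lemma posProd_eq (b : P.Base) {q : ℕ} (hq : 0 < q) (c : ℤ) :
    posProd b q c = rootProd b q ((q : ℂ) ^ (-c)) := by
  have hq0 : const b (q : ℂ) ≠ 0 := const_ne_zero b (by exact_mod_cast hq.ne')
  have hsq : const b (q : ℂ) = const b (sqrtC q) ^ 2 := by
    rw [const_eq_algebraMap, const_eq_algebraMap, ← map_pow, sqrtC_sq]
  have hs := const_ne_zero b (sqrtC_ne_zero hq)
  refine Finset.prod_congr rfl fun i _ => ?_
  rw [rootFactor, sub_eq_add_neg (b.height i), add_comm, zpow_add₀ hq0, mul_assoc, Algebra.smul_def]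
  congr 2
  · rw [const_eq_algebraMap, map_zpow₀]
  · rw [xpowTwo, ymon, height_eq_sum_rootCoord, hsq]
    have h1 : ∀ S : Finset b.support, (const b (sqrtC q) ^ 2) ^ (∑ j ∈ S, rootCoord b i j) =
        ∏ j ∈ S, const b (sqrtC q) ^ (2 * rootCoord b i j) := by
      classical
      intro S
      induction S using Finset.induction_on with
      | empty => simp
      | insert j S hj ih =>
        rw [Finset.sum_insert hj, Finset.prod_insert hj, zpow_add₀ (pow_ne_zero 2 hs), ih, zpow_mul]
        rfl
    rw [h1, ← Finset.prod_mul_distrib]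
    refine Finset.prod_congr rfl fun j _ => ?_
    rw [← mul_zpow]
    rfl

variable [P.IsReduced]

/-- The reflection `σ_k` permutes the positive roots other than `α_k`. -/
lemma sigmaHom_rootProd (b : P.Base) (hsl : b.cartanMatrix.IsSimplyLaced) {q : ℕ} (hq : 0 < q)
    (k : b.support) (c : ℂ) :
    sigmaHom b hsl hq k (rootProd b q c) * rootFactor b q c (simpleVec b k) =
      rootProd b q c * rootFactor b q c (-simpleVec b k) := by
  classical
  have hk : (k : ι) ∈ posRoots b := (mem_posRoots b _).2 (Base.isPos_of_mem_support k.2)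
  rw [rootProd, map_prod, ← Finset.mul_prod_erase _ _ hk, ← Finset.mul_prod_erase _ _ hk,
    sigmaHom_rootFactor, rootCoord_simple, refl_simpleVec_self]
  have h1 : ∏ i ∈ (posRoots b).erase k, sigmaHom b hsl hq k (rootFactor b q c (rootCoord b i)) =
      ∏ i ∈ (posRoots b).erase k, rootFactor b q c (rootCoord b i) := by
    have hmem : ∀ i ∈ (posRoots b).erase (k : ι), P.reflectionPerm k i ∈ (posRoots b).erase k := by
      intro i hi
      rw [Finset.mem_erase, mem_posRoots] at hi ⊢
      have h2 := hi.2.reflectionPerm k.2 hi.1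
      refine ⟨fun h => ?_, h2⟩
      have h3 : rootCoord b i = - simpleVec b k := by
        rw [← refl_simpleVec_self, ← rootCoord_simple b k]
        conv_rhs => rw [← h, rootCoord_reflectionPerm, refl_refl]
      have h4 := (isPos_iff_nonneg b i).1 hi.2 k
      rw [h3] at h4
      simp [simpleVec] at h4
    refine Finset.prod_nbij' (fun i => P.reflectionPerm k i) (fun i => P.reflectionPerm k i)
      hmem hmem (fun i _ => by simp) (fun i _ => by simp) fun i _ => ?_
    rw [sigmaHom_rootFactor, rootCoord_reflectionPerm]
  rw [h1]
  ring

/-! ### The average as an invariant -/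

omit [Finite ι] [P.IsReduced] in
/-- The operators `τ_i` are the twisted action multiplied by `Δ(x) / Δ(σ_i x) = -y_i²`. -/
lemma slash_eq_tau (b : P.Base) (hsl : b.cartanMatrix.IsSimplyLaced) {q : ℕ} (hq : 0 < q)
    (l : b.support → ℕ) (i : b.support) (f : RatField b) :
    tau b hsl hq l i f = -ymon b q (simpleVec b i) ^ 2 * slash b q l f i := by
  have hs := const_ne_zero b (sqrtC_ne_zero hq)
  have hsq : const b (q : ℂ) = const b (sqrtC q) ^ 2 := by
    rw [const_eq_algebraMap, const_eq_algebraMap, ← map_pow, sqrtC_sq]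
  have hx := xvar_ne_zero b i
  have h1 : const b (sqrtC q) - const b (sqrtC q) * xvar b i ≠ 0 := by
    rw [← ymon_simpleVec, sub_ne_zero]
    exact (ymon_ne_const b hq (simpleVec_ne_zero b i) _).symm
  have h2 : const b (sqrtC q) ^ 2 - (const b (sqrtC q) * xvar b i) ^ 2 ≠ 0 := by
    rw [← ymon_simpleVec, sub_ne_zero, ← hsq, ← zpow_natCast, ← ymon_zsmul]
    exact (ymon_ne_const b hq (smul_ne_zero two_ne_zero (simpleVec_ne_zero b i)) _).symm
  rw [slash, sigmaSubst_eq b hsl hq, sigmaSubst_eq b hsl hq, plusPart, minusPart, epsSubst_eq,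
    tau_apply, ymon_simpleVec, coefA, coefB, hsq]
  simp only [map_div₀, map_add, map_sub, map_mul, map_pow, map_neg, map_one, map_ofNat]
  generalize sigmaHom b hsl hq i f = g
  generalize sigmaHom b hsl hq i (epsHom b i f) = g'
  generalize xvar b i = x at *
  generalize const b (sqrtC q) = s at *
  have h3 : 1 - x ≠ 0 := by
    intro h
    apply h1
    linear_combination s * h
  have h4 : 1 + x ≠ 0 := by
    intro h
    apply h2
    linear_combination s ^ 2 * (1 - x) * h
  have e2 : s ^ 2 - (s * x) ^ 2 = s ^ 2 * (1 - x) * (1 + x) := by ring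
  rw [e2, mul_comm x s, pow_succ]
  generalize (s * x) ^ l i = t
  generalize (-1 : RatField b) ^ l i = u
  field_simp
  ring

omit [Finite ι] [P.IsReduced] in
lemma epsHom_sigmaHom_of_even (b : P.Base) (hsl : b.cartanMatrix.IsSimplyLaced) {q : ℕ}
    (hq : 0 < q) {u : RatField b} (hu : ∀ k, epsHom b k u = u) (i k : b.support) :
    epsHom b k (sigmaHom b hsl hq i u) = sigmaHom b hsl hq i u := by
  by_cases hik : i = k
  · subst hik
    rw [epsHom_sigmaHom_self, hu]
  · by_cases h : Adj b i k
    · rw [epsHom_sigmaHom_of_adj b hsl hq h, hu, hu]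
    · rw [epsHom_sigmaHom_of_not_adj b hsl hq hik h, hu]

/-- The cocycle `j` turns the twisted action into the iterated operators `τ`. -/
lemma jFactor_mul_slash (b : P.Base) (hsl : b.cartanMatrix.IsSimplyLaced) {q : ℕ} (hq : 0 < q)
    (l : b.support → ℕ) (L : List b.support) (f : RatField b) :
    Delta b q / L.foldl (fun g i => sigmaSubst b q i g) (Delta b q) * L.foldl (slash b q l) f =
      tauWord b hsl hq l L f := by
  have hΔ : Delta b q = rootProd b q 1 := by
    rw [Delta, posProd_eq b hq]; simp
  have h0 : Delta b q ≠ 0 := by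
    rw [hΔ]; exact rootProd_ne_zero b hq 1
  have he : ∀ k, epsHom b k (Delta b q) = Delta b q := by
    intro k
    rw [hΔ, rootProd, map_prod]
    exact Finset.prod_congr rfl fun i _ => epsHom_rootFactor b hsl hq k 1 _
  have hfold : ∀ T : List b.support,
      T.foldl (fun g i => sigmaSubst b q i g) (Delta b q) ≠ 0 ∧
      ∀ k, epsHom b k (T.foldl (fun g i => sigmaSubst b q i g) (Delta b q)) =
        T.foldl (fun g i => sigmaSubst b q i g) (Delta b q) := by
    intro T
    induction T using List.reverseRecOn with
    | nil => exact ⟨h0, he⟩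
    | append_singleton T k ih =>
      simp only [List.foldl_append, List.foldl_cons, List.foldl_nil, sigmaSubst_eq b hsl hq] at ih ⊢
      exact ⟨(map_ne_zero _).2 ih.1, fun j => epsHom_sigmaHom_of_even b hsl hq ih.2 k j⟩
  induction L using List.reverseRecOn with
  | nil => simp [tauWord, h0]
  | append_singleton L k ih =>
    obtain ⟨h1, h2⟩ := hfold L
    rw [tauWord_snoc, ← ih, List.foldl_append, List.foldl_append]
    simp only [List.foldl_cons, List.foldl_nil]
    rw [tau_mul b hsl hq l (by rw [map_div₀, he, h2]), slash_eq_tau, map_div₀, sigmaSubst_eq b hsl hq]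
    have h3 : sigmaHom b hsl hq k (Delta b q) * ymon b q (simpleVec b k) ^ 2 = - Delta b q := by
      have h4 := sigmaHom_rootProd b hsl hq k 1
      have hy := ymon_ne_zero b hq (simpleVec b k)
      have h5 := rootFactor_ne_zero b hq 1 (simpleVec_ne_zero b k)
      have h6 : rootFactor b q 1 (-simpleVec b k) * ymon b q (simpleVec b k) ^ 2 =
          - rootFactor b q 1 (simpleVec b k) := by
        rw [rootFactor, rootFactor, ymon_zsmul, ymon_zsmul, ymon_neg, one_smul, one_smul]
        field_simp
        ring
      rw [← hΔ] at h4
      apply mul_right_cancel₀ h5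
      linear_combination ymon b q (simpleVec b k) ^ 2 * h4 + Delta b q * h6
    have h4 : sigmaHom b hsl hq k (L.foldl (fun g i => sigmaSubst b q i g) (Delta b q)) ≠ 0 :=
      (map_ne_zero _).2 h1
    field_simp
    linear_combination (slash b q l (L.foldl (slash b q l) f) k) * h3

variable [P.IsRootSystem]

/-- The sum `∑_{w ∈ W} j(w, x) (1|_ℓ w)(x)`. -/
def average (b : P.Base) (hsl : b.cartanMatrix.IsSimplyLaced) {q : ℕ} (hq : 0 < q)
    (l : b.support → ℕ) : RatField b :=
  letI : Finite P.weylGroup := finite_weylGroup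
  letI := Fintype.ofFinite P.weylGroup
  ∑ w : P.weylGroup, tauWord b hsl hq l (word b w) 1

lemma numer_eq (b : P.Base) (hsl : b.cartanMatrix.IsSimplyLaced) {q : ℕ} (hq : 0 < q)
    (l : b.support → ℕ) :
    numer b q l = (rootProd b q 1)⁻¹ * average b hsl hq l * rootProd b q (q : ℂ)⁻¹ := by
  rw [numer, fAvg, Den, posProd_eq b hq, Delta, posProd_eq b hq, zpow_neg_one, neg_zero, zpow_zero,
    average]
  congr 2
  refine Finset.sum_congr rfl fun w _ => ?_
  exact jFactor_mul_slash b hsl hq l (word b w) 1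

/-- The average is invariant under the operators `τ_k`, which permute its terms. -/
lemma tau_average (b : P.Base) (hsl : b.cartanMatrix.IsSimplyLaced) {q : ℕ} (hq : 0 < q)
    (l : b.support → ℕ) (k : b.support) :
    tau b hsl hq l k (average b hsl hq l) = average b hsl hq l := by
  have : Finite P.weylGroup := finite_weylGroup
  let := Fintype.ofFinite P.weylGroup
  rw [average, map_sum]
  refine Fintype.sum_equiv (Equiv.mulRight (weylGroup.ofIdx P (k : ι))) _ _ fun w => ?_
  rw [← tauWord_snoc]
  refine tauWord_eq_of_act_eq b hsl hq l (act_eq_of_wordProd_eq b ?_) 1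
  rw [Equiv.coe_mulRight, wordProd_word]
  conv_rhs => rw [← wordProd_word b w]
  simp [wordProd]

end

end

/-! ### Coprimality of binomials -/

section

open MvPolynomial

variable {κ : Type*}

/-- The logarithmic derivation `a x_j ∂_j - b x_k ∂_k`. -/
def logDeriv (j k : κ) (a b : ℂ) : Derivation ℂ (MvPolynomial κ ℂ) (MvPolynomial κ ℂ) :=
  (C a * X j) • pderiv j - (C b * X k) • pderiv k

lemma logDeriv_monomial (j k : κ) (a b : ℂ) (m : κ →₀ ℕ) (c : ℂ) :
    logDeriv j k a b (monomial m c) = C (a * m j - b * m k) * monomial m c := by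
  rw [logDeriv, Derivation.sub_apply, Derivation.smul_apply, Derivation.smul_apply, smul_eq_mul,
    smul_eq_mul, mul_assoc, mul_assoc, X_mul_pderiv_monomial, X_mul_pderiv_monomial, nsmul_eq_mul,
    nsmul_eq_mul, map_sub, map_mul, map_mul, map_natCast, map_natCast]
  ring

lemma not_dvd_logDeriv {d : MvPolynomial κ ℂ} (hd : Irreducible d) {m : κ →₀ ℕ} {c : ℂ}
    (hdm : d ∣ 1 - monomial m c) {j k : κ} {a b : ℂ} (hab : a * m j - b * m k ≠ 0) :
    ¬ d ∣ logDeriv j k a b (1 - monomial m c) := by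
  intro h
  rw [map_sub, Derivation.map_one_eq_zero, logDeriv_monomial, zero_sub, dvd_neg] at h
  have h1 : d ∣ C (a * m j - b * m k) := by
    have := (dvd_mul_of_dvd_right hdm (C (a * m j - b * m k))).add h
    rwa [← mul_add, sub_add_cancel, mul_one] at this
  exact hd.1 (isUnit_of_dvd_unit h1 ((isUnit_iff_ne_zero.2 hab).map C))

/-- If the exponents `m` and `n` are not proportional then `1 - c x^m` and `1 - d x^n` have no
common factor: the logarithmic derivation killing `x^n` shows that the derivative of a common
irreducible factor `p` is not divisible by `p`, so `p²` divides `1 - d x^n`, which is squarefree. -/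
lemma isRelPrime_one_sub_monomial [Finite κ] {m n : κ →₀ ℕ} {c d : ℂ} {j k : κ}
    (h : m j * n k ≠ m k * n j) : IsRelPrime (1 - monomial m c) (1 - monomial n d) := by
  have hmn : (n k : ℂ) * m j - n j * m k ≠ 0 := by
    intro h1
    apply h
    have h2 : (m j : ℂ) * n k = m k * n j := by linear_combination h1
    exact_mod_cast h2
  have hm0 : ∀ (e : κ →₀ ℕ) (i : κ) (a : ℂ), e i ≠ 0 → (1 - monomial e a) ≠ 0 := by
    intro e i a hi h0
    have h1 := congrArg (coeff 0) h0
    have he : e ≠ 0 := fun h' => hi (by simp [h'])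
    classical
    simp [coeff_one, coeff_monomial, he] at h1
  obtain ⟨i, hi⟩ : ∃ i, n i ≠ 0 := by
    by_contra! h0
    exact h (by simp [h0])
  refine WfDvdMonoid.isRelPrime_of_no_irreducible_factors
    (fun h0 => hm0 n i d hi h0.2) fun p hp hpm hpn => ?_
  have hprime := UniqueFactorizationMonoid.irreducible_iff_prime.1 hp
  have h1 := not_dvd_logDeriv hp hpm hmn
  have h2 : ¬ p ∣ logDeriv j k (n k) (n j) p := by
    intro h3
    obtain ⟨u, hu⟩ := hpm
    apply h1
    rw [hu, Derivation.leibniz, smul_eq_mul, smul_eq_mul]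
    exact dvd_add (dvd_mul_right _ _) (dvd_mul_of_dvd_right h3 _)
  have h3 : logDeriv j k (n k) (n j) (1 - monomial n d) = 0 := by
    rw [map_sub, Derivation.map_one_eq_zero, logDeriv_monomial, mul_comm (n k : ℂ), sub_self,
      map_zero, zero_mul, sub_zero]
  have h4 := not_dvd_logDeriv hp hpn (j := i) (k := i) (a := 1) (b := 0) (by simpa using hi)
  obtain ⟨u, hu⟩ := hpn
  rw [hu, Derivation.leibniz, smul_eq_mul, smul_eq_mul] at h3
  have h5 : p ∣ u := by
    refine (hprime.dvd_or_dvd (?_ : p ∣ u * logDeriv j k (n k) (n j) p)).resolve_right h2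
    exact ⟨- logDeriv j k (n k) (n j) u, by linear_combination h3⟩
  obtain ⟨t, rfl⟩ := h5
  apply h4
  rw [hu, Derivation.leibniz, Derivation.leibniz]
  simp only [smul_eq_mul]
  exact ⟨p * logDeriv i i 1 0 t + t * logDeriv i i 1 0 p + t * logDeriv i i 1 0 p, by ring⟩

lemma isRelPrime_one_sub_monomial_of_ne (m : κ →₀ ℕ) {c d : ℂ} (h : c ≠ d) :
    IsRelPrime (1 - monomial m c) (1 - monomial m d) := by
  intro p hc hd
  have h1 : p ∣ C (c - d) := by
    have h2 := (dvd_mul_of_dvd_right hd (C c)).sub (dvd_mul_of_dvd_right hc (C d))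
    have h3 : C c * (1 - monomial m d) - C d * (1 - monomial m c) = C (c - d) := by
      rw [mul_sub, mul_sub, C_mul_monomial, C_mul_monomial, mul_comm d c, map_sub]
      ring
    rwa [h3] at h2
  exact isUnit_of_dvd_unit h1 ((isUnit_iff_ne_zero.2 (sub_ne_zero.2 h)).map C)

lemma isRelPrime_monomial [Finite κ] (m : κ →₀ ℕ) {a : ℂ} (ha : a ≠ 0) {f : MvPolynomial κ ℂ}
    (hf : constantCoeff f ≠ 0) : IsRelPrime (monomial m a) f := by
  have := Fintype.ofFinite κ
  rw [monomial_eq, Finsupp.prod_fintype _ _ (fun _ => pow_zero _)]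
  refine IsRelPrime.mul_left ?_ (IsRelPrime.prod_left fun i _ => IsRelPrime.pow_left ?_)
  · exact ((isUnit_iff_ne_zero.2 ha).map C).isRelPrime_left
  · rw [(X_prime (i := i)).irreducible.isRelPrime_iff_not_dvd]
    rintro ⟨u, rfl⟩
    simp at hf

end

/-! ### Polynomial Laurent monomials -/

/-- The exponent of a monomial given by a vector, whose negative coordinates are replaced by `0`. -/
def expo (b : P.Base) (v : b.support → ℤ) : b.support →₀ ℕ :=
  Finsupp.equivFunOnFinite.symm fun j => (v j).toNat

lemma expo_apply (b : P.Base) (v : b.support → ℤ) (j : b.support) : expo b v j = (v j).toNat := rfl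

/-- The polynomial `1 - c y^{2v}`, for a vector `v` with nonnegative coordinates. -/
def rootPoly (b : P.Base) (q : ℕ) (c : ℂ) (v : b.support → ℤ) : MvPolynomial b.support ℂ :=
  1 - MvPolynomial.monomial (expo b ((2 : ℤ) • v))
    (c * sqrtC q ^ (∑ j, expo b ((2 : ℤ) • v) j))

lemma algebraMap_monomial_expo (b : P.Base) {q : ℕ} (hq : 0 < q) {v : b.support → ℤ} (hv : 0 ≤ v)
    (c : ℂ) : algebraMap (MvPolynomial b.support ℂ) (RatField b) (MvPolynomial.monomial (expo b v)
      (c * sqrtC q ^ (∑ j, expo b v j))) = c • ymon b q v := by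
  rw [algebraMap_monomial b hq, mul_assoc, ← mul_pow, mul_inv_cancel₀ (sqrtC_ne_zero hq), one_pow,
    mul_one]
  congr 2
  funext j
  rw [expo_apply]
  exact Int.toNat_of_nonneg (hv j)

lemma algebraMap_rootPoly (b : P.Base) {q : ℕ} (hq : 0 < q) (c : ℂ) {v : b.support → ℤ}
    (hv : 0 ≤ v) : algebraMap _ (RatField b) (rootPoly b q c v) = rootFactor b q c v := by
  rw [rootPoly, map_sub, map_one, algebraMap_monomial_expo b hq (smul_nonneg zero_le_two hv),
    rootFactor]

lemma expo_ne_zero (b : P.Base) {v : b.support → ℤ} (hv : 0 ≤ v) (hv0 : v ≠ 0) :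
    expo b v ≠ 0 := by
  intro h
  apply hv0
  funext j
  have h1 := DFunLike.congr_fun h j
  rw [expo_apply] at h1
  have h2 := hv j
  simp only [Finsupp.coe_zero, Pi.zero_apply] at h1 h2 ⊢
  omega

lemma constantCoeff_rootPoly (b : P.Base) (q : ℕ) (c : ℂ) {v : b.support → ℤ} (hv : 0 ≤ v)
    (hv0 : v ≠ 0) : MvPolynomial.constantCoeff (rootPoly b q c v) = 1 := by
  classical
  rw [rootPoly, map_sub, map_one, MvPolynomial.constantCoeff_monomial, if_neg, sub_zero]
  exact expo_ne_zero b (smul_nonneg zero_le_two hv) (smul_ne_zero two_ne_zero hv0)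

/-- Factors belonging to different positive roots, or to the same root with different constants, have
no common factor. Here reducedness of the root system enters: distinct positive roots are not
proportional. -/
lemma isRelPrime_rootPoly [P.IsReduced] (b : P.Base) {q : ℕ} {i i' : ι} (hi : b.IsPos i)
    (hi' : b.IsPos i') {c d : ℂ} (hq : 0 < q) (h : i = i' → c ≠ d) :
    IsRelPrime (rootPoly b q c (rootCoord b i)) (rootPoly b q d (rootCoord b i')) := by
  have hp := (isPos_iff_nonneg b i).1 hi
  have hp' := (isPos_iff_nonneg b i').1 hi'
  by_cases hii : i = i'
  · subst hii
    exact isRelPrime_one_sub_monomial_of_ne _ fun h1 => h rfl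
      (mul_right_cancel₀ (pow_ne_zero _ (sqrtC_ne_zero hq)) h1)
  · have hneg : P.root i ≠ - P.root i' := by
      intro h1
      have h2 : rootCoord b i = - rootCoord b i' := by
        apply latticePt_injective b
        rw [← neg_one_zsmul (rootCoord b i'), latticePt_smul, latticePt_rootCoord,
          latticePt_rootCoord, h1, neg_one_zsmul]
      have h3 : rootCoord b i ≤ 0 := by rw [h2]; simpa using hp'
      exact rootCoord_ne_zero b i (le_antisymm h3 hp)
    have hlin := IsReduced.linearIndependent P hii hneg
    obtain ⟨j, k, hjk⟩ : ∃ j k, rootCoord b i j * rootCoord b i' k ≠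
        rootCoord b i k * rootCoord b i' j := by
      by_contra! hall
      obtain ⟨k, hk⟩ : ∃ k, rootCoord b i' k ≠ 0 := by
        by_contra! h0
        exact rootCoord_ne_zero b i' (funext h0)
      have h1 : rootCoord b i' k • rootCoord b i + (- rootCoord b i k) • rootCoord b i' = 0 := by
        funext j
        have := hall j k
        simp only [Pi.add_apply, Pi.smul_apply, smul_eq_mul, Pi.zero_apply]
        linarith
      have h2 := congrArg (latticePt b) h1
      rw [latticePt_add, latticePt_smul, latticePt_smul, latticePt_rootCoord,
        latticePt_rootCoord, ← Int.cast_smul_eq_zsmul ℝ, ← Int.cast_smul_eq_zsmul ℝ] at h2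
      have h3 := (LinearIndependent.pair_iff.1 hlin _ _ (h2.trans (by simp [latticePt]))).1
      exact hk (by exact_mod_cast h3)
    refine isRelPrime_one_sub_monomial (j := j) (k := k) fun h1 => hjk ?_
    simp only [expo_apply, Pi.smul_apply, smul_eq_mul] at h1
    have e : ∀ (n : b.support → ℤ), 0 ≤ n → ∀ a, (((2 * n a).toNat : ℕ) : ℤ) = 2 * n a :=
      fun n hn a => Int.toNat_of_nonneg (mul_nonneg zero_le_two (hn a))
    have h2 : (((2 * rootCoord b i j).toNat * (2 * rootCoord b i' k).toNat : ℕ) : ℤ) =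
      ((2 * rootCoord b i k).toNat * (2 * rootCoord b i' j).toNat : ℕ) := by rw [h1]
    rw [Nat.cast_mul, Nat.cast_mul, e _ hp, e _ hp, e _ hp', e _ hp'] at h2
    linarith

/-! ### The terms of the average -/

section

variable [P.IsCrystallographic]

section

variable [Finite ι]

open Classical in
/-- The positive roots made negative by the word `L`. -/
def invRoots (b : P.Base) (L : List b.support) : Finset ι :=
  (posRoots b).filter fun i => act b L (rootCoord b i) ≤ 0

lemma mem_invRoots (b : P.Base) (L : List b.support) (i : ι) :
    i ∈ invRoots b L ↔ b.IsPos i ∧ act b L (rootCoord b i) ≤ 0 := by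
  classical
  rw [invRoots, Finset.mem_filter, mem_posRoots]

/-- The algebra of polynomials in the monomials `y^β`, where `β` ranges over the positive roots made
negative by the word `L`. -/
def invAlg (b : P.Base) (q : ℕ) (L : List b.support) : Subalgebra ℂ (RatField b) :=
  Algebra.adjoin ℂ ((fun i => ymon b q (rootCoord b i)) '' (invRoots b L : Set ι))

lemma ymon_mem_invAlg (b : P.Base) (q : ℕ) {L : List b.support} {i : ι} (hi : i ∈ invRoots b L) :
    ymon b q (rootCoord b i) ∈ invAlg b q L :=
  Algebra.subset_adjoin ⟨i, hi, rfl⟩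

lemma invRoots_nil (b : P.Base) : invRoots b [] = ∅ := by
  ext i
  rw [mem_invRoots, act_nil]
  simp only [Finset.notMem_empty, iff_false, not_and]
  exact fun hi h => rootCoord_ne_zero b i (le_antisymm h ((isPos_iff_nonneg b i).1 hi))

lemma epsHom_mem_invAlg (b : P.Base) (hsl : b.cartanMatrix.IsSimplyLaced) {q : ℕ} (hq : 0 < q)
    (L : List b.support) (k : b.support) {g : RatField b} (hg : g ∈ invAlg b q L) :
    epsHom b k g ∈ invAlg b q L := by
  have h : invAlg b q L ≤ (invAlg b q L).comap (epsHom b k) := by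
    refine Algebra.adjoin_le ?_
    rintro _ ⟨i, hi, rfl⟩
    change epsHom b k (ymon b q (rootCoord b i)) ∈ invAlg b q L
    rw [epsHom_ymon b hsl hq]
    refine mul_mem ?_ (ymon_mem_invAlg b q hi)
    rcases Int.even_or_odd (pair b k (rootCoord b i)) with h | h
    · rw [h.neg_one_zpow]; exact one_mem _
    · rw [h.neg_one_zpow]; exact neg_mem (one_mem _)
  exact h hg

variable [P.IsReduced]

/-- The positive roots made negative by `w σ_k`, for `w α_k > 0`. -/
lemma invRoots_snoc [DecidableEq ι] (b : P.Base) {L : List b.support} {k : b.support}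
    (hk : 0 ≤ act b L (simpleVec b k)) :
    invRoots b (L ++ [k]) = insert (k : ι) ((invRoots b L).image fun i => P.reflectionPerm k i) := by
  have hne : ∀ i ∈ invRoots b L, i ≠ k := by
    rintro i hi rfl
    rw [mem_invRoots, rootCoord_simple] at hi
    exact (isRootVec_act b L (isRootVec_simpleVec b k)).not_nonpos_of_nonneg hk hi.2
  have hact : ∀ i, act b (L ++ [k]) (rootCoord b i) =
      act b L (rootCoord b (P.reflectionPerm k i)) := by
    intro i
    rw [rootCoord_reflectionPerm]
    simp
  ext i
  rw [Finset.mem_insert, Finset.mem_image, mem_invRoots, hact]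
  constructor
  · rintro ⟨hi, h⟩
    by_cases hik : i = k
    · exact Or.inl hik
    · exact Or.inr ⟨P.reflectionPerm k i, (mem_invRoots b L _).2
        ⟨hi.reflectionPerm k.2 hik, h⟩, by simp⟩
  · rintro (rfl | ⟨i, hi, rfl⟩)
    · refine ⟨Base.isPos_of_mem_support k.2, ?_⟩
      rw [rootCoord_reflectionPerm, rootCoord_simple, refl_simpleVec_self, map_neg]
      simpa using hk
    · have h1 := (mem_invRoots b L i).1 hi
      refine ⟨h1.1.reflectionPerm k.2 (hne i hi), ?_⟩
      simpa using h1.2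

lemma sigmaHom_mem_invAlg (b : P.Base) (hsl : b.cartanMatrix.IsSimplyLaced) {q : ℕ} (hq : 0 < q)
    {L : List b.support} {k : b.support} (hk : 0 ≤ act b L (simpleVec b k)) {g : RatField b}
    (hg : g ∈ invAlg b q L) : sigmaHom b hsl hq k g ∈ invAlg b q (L ++ [k]) := by
  classical
  have h : invAlg b q L ≤ (invAlg b q (L ++ [k])).comap (sigmaHom b hsl hq k) := by
    refine Algebra.adjoin_le ?_
    rintro _ ⟨i, hi, rfl⟩
    change sigmaHom b hsl hq k (ymon b q (rootCoord b i)) ∈ invAlg b q (L ++ [k])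
    rw [sigmaHom_ymon, ← rootCoord_reflectionPerm]
    apply ymon_mem_invAlg
    rw [invRoots_snoc b hk]
    exact Finset.mem_insert_of_mem (Finset.mem_image_of_mem _ hi)
  exact h hg

omit [P.IsCrystallographic] [Finite ι] [P.IsReduced] in
lemma const_mem {b : P.Base} (A : Subalgebra ℂ (RatField b)) (c : ℂ) : const b c ∈ A := by
  rw [const_eq_algebraMap]
  exact A.algebraMap_mem c

omit [P.IsCrystallographic] [Finite ι] [P.IsReduced] in
lemma rootFactor_eq_div (b : P.Base) {q : ℕ} (hq : 0 < q) (v : b.support → ℤ) :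
    rootFactor b q (q : ℂ)⁻¹ v =
      (const b (sqrtC q) ^ 2 - ymon b q v ^ 2) / const b (sqrtC q) ^ 2 := by
  have hs := const_ne_zero b (sqrtC_ne_zero hq)
  rw [rootFactor, ymon_zsmul, sub_div, div_self (pow_ne_zero 2 hs), Algebra.smul_def, map_inv₀,
    ← sqrtC_sq, map_pow, ← const_eq_algebraMap, div_eq_inv_mul]
  rfl

omit [Finite ι] [P.IsReduced] in
/-- The denominator of `τ_k` is the factor of the root `α_k`. -/
lemma rootFactor_mul_tau (b : P.Base) (hsl : b.cartanMatrix.IsSimplyLaced) {q : ℕ} (hq : 0 < q)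
    (l : b.support → ℕ) (k : b.support) (g : RatField b) :
    rootFactor b q (q : ℂ)⁻¹ (simpleVec b k) * tau b hsl hq l k g =
      ymon b q (simpleVec b k) * (const b (2 * sqrtC q ^ 2)⁻¹ * (ymon b q (simpleVec b k) ^ l k *
        (const b (sqrtC q) + ymon b q (simpleVec b k)) *
        ((1 - const b (sqrtC q)) * (1 + ymon b q (simpleVec b k)) * sigmaHom b hsl hq k g +
        (-1) ^ l k * ((1 + const b (sqrtC q)) * (1 - ymon b q (simpleVec b k))) *
          sigmaHom b hsl hq k (epsHom b k g)))) := by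
  have hs := const_ne_zero b (sqrtC_ne_zero hq)
  have h1 : const b (sqrtC q) ^ 2 - ymon b q (simpleVec b k) ^ 2 ≠ 0 := by
    intro h
    have h2 := rootFactor_ne_zero b hq (q : ℂ)⁻¹ (simpleVec_ne_zero b k)
    rw [rootFactor_eq_div b hq, h, zero_div] at h2
    exact h2 rfl
  have h2 : const b (2 * sqrtC q ^ 2)⁻¹ = (2 * const b (sqrtC q) ^ 2)⁻¹ := by
    rw [const_eq_algebraMap, const_eq_algebraMap, map_inv₀, map_mul, map_pow, map_ofNat]
  rw [tau_apply, rootFactor_eq_div b hq, coefA, coefB, h2]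
  field_simp
  ring

/-- The term of the average attached to a reduced word `L`, multiplied by the factors of `D` at the
positive roots made negative by `L`, is a polynomial in the corresponding monomials `y^β`. It is
divisible by one of them unless `L` is empty. -/
lemma term_mem_invAlg (b : P.Base) (hsl : b.cartanMatrix.IsSimplyLaced) {q : ℕ} (hq : 0 < q)
    (l : b.support → ℕ) {L : List b.support} (hL : Reduced b L) :
    (∏ i ∈ invRoots b L, rootFactor b q (q : ℂ)⁻¹ (rootCoord b i)) * tauWord b hsl hq l L 1 ∈
      invAlg b q L ∧ (L ≠ [] → ∃ i ∈ invRoots b L, ∃ g ∈ invAlg b q L,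
        (∏ i ∈ invRoots b L, rootFactor b q (q : ℂ)⁻¹ (rootCoord b i)) * tauWord b hsl hq l L 1 =
          ymon b q (rootCoord b i) * g) := by
  classical
  induction hL with
  | nil =>
    refine ⟨?_, fun h => absurd rfl h⟩
    rw [invRoots_nil, Finset.prod_empty, one_mul]
    exact one_mem _
  | snoc L k hL hk ih =>
    have hne : (k : ι) ∉ (invRoots b L).image fun i => P.reflectionPerm k i := by
      intro h
      obtain ⟨i, hi, hik⟩ := Finset.mem_image.1 h
      have h1 : rootCoord b i = - simpleVec b k := by
        rw [← refl_refl b k (rootCoord b i), ← rootCoord_reflectionPerm, hik, rootCoord_simple,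
          refl_simpleVec_self]
      have h2 := (isPos_iff_nonneg b i).1 ((mem_invRoots b L i).1 hi).1 k
      rw [h1] at h2
      simp [simpleVec] at h2
    have hk_mem : (k : ι) ∈ invRoots b (L ++ [k]) := by
      rw [invRoots_snoc b hk]; exact Finset.mem_insert_self _ _
    set t := ∏ i ∈ invRoots b L, rootFactor b q (q : ℂ)⁻¹ (rootCoord b i) with ht
    have hε : epsHom b k t = t := by
      rw [ht, map_prod]
      exact Finset.prod_congr rfl fun i _ => epsHom_rootFactor b hsl hq k _ _
    have hprod : ∏ i ∈ invRoots b (L ++ [k]), rootFactor b q (q : ℂ)⁻¹ (rootCoord b i) =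
        rootFactor b q (q : ℂ)⁻¹ (simpleVec b k) * sigmaHom b hsl hq k t := by
      rw [invRoots_snoc b hk, Finset.prod_insert hne, Finset.prod_image, ht, map_prod,
        rootCoord_simple]
      · congr 1
        refine Finset.prod_congr rfl fun i _ => ?_
        rw [rootCoord_reflectionPerm, sigmaHom_rootFactor]
      · intro i _ j _ hij
        exact (P.reflectionPerm k).injective hij
    have key : ∃ g ∈ invAlg b q (L ++ [k]),
        (∏ i ∈ invRoots b (L ++ [k]), rootFactor b q (q : ℂ)⁻¹ (rootCoord b i)) *
          tauWord b hsl hq l (L ++ [k]) 1 = ymon b q (rootCoord b k) * g := by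
      have hy : ymon b q (simpleVec b k) ∈ invAlg b q (L ++ [k]) := by
        rw [← rootCoord_simple]
        exact ymon_mem_invAlg b q hk_mem
      have hσ : ∀ g ∈ invAlg b q L, sigmaHom b hsl hq k g ∈ invAlg b q (L ++ [k]) :=
        fun g hg => sigmaHom_mem_invAlg b hsl hq hk hg
      have hc := const_mem (invAlg b q (L ++ [k]))
      have h1 := one_mem (invAlg b q (L ++ [k]))
      rw [hprod, tauWord_snoc, mul_assoc, ← tau_mul b hsl hq l hε, rootFactor_mul_tau,
        rootCoord_simple]
      refine ⟨_, ?_, rfl⟩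
      refine mul_mem (hc _) (mul_mem (mul_mem (pow_mem hy _) (add_mem (hc _) hy)) (add_mem
        (mul_mem (mul_mem (sub_mem h1 (hc _)) (add_mem h1 hy)) (hσ _ ih.1)) (mul_mem (mul_mem
          (pow_mem (neg_mem h1) _) (mul_mem (add_mem h1 (hc _)) (sub_mem h1 hy)))
            (hσ _ (epsHom_mem_invAlg b hsl hq L k ih.1)))))
    refine ⟨?_, fun _ => ⟨k, hk_mem, key⟩⟩
    obtain ⟨g, hg, he⟩ := key
    rw [he]
    exact mul_mem (ymon_mem_invAlg b q hk_mem) hg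

omit [P.IsReduced] in
lemma exists_poly_of_mem_invAlg (b : P.Base) {q : ℕ} (hq : 0 < q) (L : List b.support)
    {g : RatField b} (hg : g ∈ invAlg b q L) :
    ∃ p : MvPolynomial b.support ℂ, algebraMap _ (RatField b) p = g := by
  have h : invAlg b q L ≤ (IsScalarTower.toAlgHom ℂ (MvPolynomial b.support ℂ) (RatField b)).range := by
    refine Algebra.adjoin_le ?_
    rintro _ ⟨i, hi, rfl⟩
    have := algebraMap_monomial_expo b hq ((isPos_iff_nonneg b i).1 ((mem_invRoots b L i).1 hi).1) 1
    rw [one_smul] at this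
    exact ⟨_, this⟩
  exact h hg

omit [P.IsCrystallographic] [P.IsReduced] in
lemma algebraMap_rootPoly_prod (b : P.Base) {q : ℕ} (hq : 0 < q) (c : ℂ) (S : Finset ι)
    (hS : S ⊆ posRoots b) :
    algebraMap _ (RatField b) (∏ i ∈ S, rootPoly b q c (rootCoord b i)) =
      ∏ i ∈ S, rootFactor b q c (rootCoord b i) := by
  rw [map_prod]
  exact Finset.prod_congr rfl fun i hi => algebraMap_rootPoly b hq c
    ((isPos_iff_nonneg b i).1 ((mem_posRoots b i).1 (hS hi)))

omit [P.IsCrystallographic] [P.IsReduced] in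
lemma constantCoeff_rootPoly_prod (b : P.Base) (q : ℕ) (c : ℂ) (S : Finset ι)
    (hS : S ⊆ posRoots b) :
    MvPolynomial.constantCoeff (∏ i ∈ S, rootPoly b q c (rootCoord b i)) = 1 := by
  rw [map_prod]
  exact Finset.prod_eq_one fun i hi => constantCoeff_rootPoly b q c
    ((isPos_iff_nonneg b i).1 ((mem_posRoots b i).1 (hS hi))) (rootCoord_ne_zero b i)

/-- The product of `D` with the term of the average attached to a reduced word is a polynomial. Its
constant coefficient vanishes unless the word is empty. -/
lemma exists_poly_term (b : P.Base) (hsl : b.cartanMatrix.IsSimplyLaced) {q : ℕ} (hq : 0 < q)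
    (l : b.support → ℕ) {L : List b.support} (hL : Reduced b L) :
    ∃ p : MvPolynomial b.support ℂ,
      algebraMap _ (RatField b) p = rootProd b q (q : ℂ)⁻¹ * tauWord b hsl hq l L 1 ∧
      MvPolynomial.constantCoeff p = if L = [] then 1 else 0 := by
  classical
  have hsub : invRoots b L ⊆ posRoots b := Finset.filter_subset _ _
  have hsplit : rootProd b q (q : ℂ)⁻¹ * tauWord b hsl hq l L 1 =
      (∏ i ∈ posRoots b \ invRoots b L, rootFactor b q (q : ℂ)⁻¹ (rootCoord b i)) *
      ((∏ i ∈ invRoots b L, rootFactor b q (q : ℂ)⁻¹ (rootCoord b i)) *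
        tauWord b hsl hq l L 1) := by
    rw [← mul_assoc, Finset.prod_sdiff hsub, rootProd]
  by_cases hnil : L = []
  · subst hnil
    refine ⟨∏ i ∈ posRoots b, rootPoly b q (q : ℂ)⁻¹ (rootCoord b i), ?_, ?_⟩
    · rw [algebraMap_rootPoly_prod b hq _ _ subset_rfl]
      simp [tauWord, rootProd]
    · rw [if_pos rfl, constantCoeff_rootPoly_prod b q _ _ subset_rfl]
  · obtain ⟨i, hi, g, hg, he⟩ := (term_mem_invAlg b hsl hq l hL).2 hnil
    obtain ⟨p, rfl⟩ := exists_poly_of_mem_invAlg b hq L hg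
    have hpos := (isPos_iff_nonneg b i).1 ((mem_posRoots b i).1 (hsub hi))
    refine ⟨(∏ i ∈ posRoots b \ invRoots b L, rootPoly b q (q : ℂ)⁻¹ (rootCoord b i)) *
      (MvPolynomial.monomial (expo b (rootCoord b i))
        (1 * sqrtC q ^ (∑ j, expo b (rootCoord b i) j)) * p), ?_, ?_⟩
    · rw [hsplit, he, map_mul, map_mul, algebraMap_rootPoly_prod b hq _ _ Finset.sdiff_subset,
        algebraMap_monomial_expo b hq hpos, one_smul]
    · rw [if_neg hnil, map_mul, map_mul, MvPolynomial.constantCoeff_monomial,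
        if_neg (expo_ne_zero b hpos (rootCoord_ne_zero b i)), zero_mul, mul_zero]

variable [P.IsRootSystem]

omit [P.IsCrystallographic] [Finite ι] [P.IsReduced] in
lemma weylGroup_eq_one (w : P.weylGroup) (h : ∀ i, w • P.root i = P.root i) : w = 1 := by
  apply Subtype.ext
  apply Equiv.weightHom_injective
  apply LinearEquiv.toLinearMap_injective
  apply LinearMap.ext_on (IsRootSystem.span_root_eq_top (P := P))
  rintro _ ⟨i, rfl⟩
  exact h i

/-- The product of `D` with the average is a polynomial with constant coefficient `1`. -/
lemma exists_poly_average (b : P.Base) (hsl : b.cartanMatrix.IsSimplyLaced) {q : ℕ} (hq : 0 < q)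
    (l : b.support → ℕ) : ∃ p : MvPolynomial b.support ℂ,
      algebraMap _ (RatField b) p = rootProd b q (q : ℂ)⁻¹ * average b hsl hq l ∧
      MvPolynomial.constantCoeff p = 1 := by
  classical
  have : Finite P.weylGroup := finite_weylGroup
  have := Fintype.ofFinite P.weylGroup
  have hterm : ∀ w : P.weylGroup, ∃ p : MvPolynomial b.support ℂ,
      algebraMap _ (RatField b) p =
        rootProd b q (q : ℂ)⁻¹ * tauWord b hsl hq l (word b w) 1 ∧
      MvPolynomial.constantCoeff p = if w = 1 then 1 else 0 := by
    intro w
    obtain ⟨R, hR, hact⟩ := exists_reduced_act_eq b hsl (word b w)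
    obtain ⟨p, hp, hp0⟩ := exists_poly_term b hsl hq l hR
    refine ⟨p, by rw [hp, tauWord_eq_of_act_eq b hsl hq l hact], hp0.trans ?_⟩
    have hiff : R = [] ↔ w = 1 := by
      constructor
      · rintro rfl
        refine weylGroup_eq_one w fun i => ?_
        rw [← wordProd_word b w, ← latticePt_rootCoord b i, ← latticePt_act, hact, act_nil]
      · rintro rfl
        refine hR.eq_nil fun v => ?_
        rw [← hact]
        apply latticePt_injective b
        rw [latticePt_act, wordProd_word, one_smul]
    simp only [hiff]
  choose p hp hp0 using hterm
  refine ⟨∑ w, p w, ?_, ?_⟩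
  · rw [map_sum, average, Finset.mul_sum]
    refine (Finset.sum_congr rfl fun w _ => hp w).trans ?_
    congr!
  · rw [map_sum, Finset.sum_congr rfl fun w _ => hp0 w]
    simp

end

end

/-! ### Divisibility of the average -/

/-- The algebra of Laurent polynomials with the functions `1 - y^{2α} / q` inverted, for all
roots `α`. It is stable under the operators `τ_k`. -/
def regAlg (b : P.Base) (q : ℕ) : Subalgebra ℂ (RatField b) :=
  Algebra.adjoin ℂ (Set.range (ymon b q) ∪
    Set.range fun i => (rootFactor b q (q : ℂ)⁻¹ (rootCoord b i))⁻¹)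

lemma ymon_mem_regAlg (b : P.Base) (q : ℕ) (v : b.support → ℤ) : ymon b q v ∈ regAlg b q :=
  Algebra.subset_adjoin (Or.inl ⟨v, rfl⟩)

lemma inv_rootFactor_mem_regAlg (b : P.Base) (q : ℕ) (i : ι) :
    (rootFactor b q (q : ℂ)⁻¹ (rootCoord b i))⁻¹ ∈ regAlg b q :=
  Algebra.subset_adjoin (Or.inr ⟨i, rfl⟩)

lemma rootFactor_mem_regAlg (b : P.Base) (q : ℕ) (c : ℂ) (v : b.support → ℤ) :
    rootFactor b q c v ∈ regAlg b q :=
  sub_mem (one_mem _) ((regAlg b q).smul_mem (ymon_mem_regAlg b q _) c)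

lemma algebraMap_mem_regAlg (b : P.Base) {q : ℕ} (hq : 0 < q) (p : MvPolynomial b.support ℂ) :
    algebraMap _ (RatField b) p ∈ regAlg b q := by
  have h : Submodule.span ℂ (Set.range (ymon b q)) ≤ Subalgebra.toSubmodule (regAlg b q) := by
    rw [Submodule.span_le]
    rintro _ ⟨v, rfl⟩
    exact ymon_mem_regAlg b q v
  exact h (algebraMap_mem_span b hq p)

lemma rootFactor_neg (b : P.Base) {q : ℕ} (hq : 0 < q) {c : ℂ} (hc : c ≠ 0) (v : b.support → ℤ) :
    rootFactor b q c (-v) = (-c) • (ymon b q ((2 : ℤ) • v))⁻¹ * rootFactor b q c⁻¹ v := by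
  have h := ymon_ne_zero b hq ((2 : ℤ) • v)
  rw [rootFactor, rootFactor, smul_neg, ymon_neg]
  generalize ymon b q ((2 : ℤ) • v) = Y at h ⊢
  rw [Algebra.smul_def, Algebra.smul_def, Algebra.smul_def, map_neg, map_inv₀]
  have hc' : algebraMap ℂ (RatField b) c ≠ 0 := (map_ne_zero _).2 hc
  field_simp
  ring

section

variable [P.IsCrystallographic] (b : P.Base) (hsl : b.cartanMatrix.IsSimplyLaced) {q : ℕ}
  (hq : 0 < q)

lemma sigmaHom_mem_regAlg (k : b.support) {g : RatField b} (hg : g ∈ regAlg b q) :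
    sigmaHom b hsl hq k g ∈ regAlg b q := by
  have h : regAlg b q ≤ (regAlg b q).comap (sigmaHom b hsl hq k) := by
    refine Algebra.adjoin_le ?_
    rintro _ (⟨v, rfl⟩ | ⟨i, rfl⟩)
    · change sigmaHom b hsl hq k (ymon b q v) ∈ regAlg b q
      rw [sigmaHom_ymon]
      exact ymon_mem_regAlg b q _
    · change sigmaHom b hsl hq k (rootFactor b q (q : ℂ)⁻¹ (rootCoord b i))⁻¹ ∈ regAlg b q
      rw [map_inv₀, sigmaHom_rootFactor, ← rootCoord_reflectionPerm]
      exact inv_rootFactor_mem_regAlg b q _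
  exact h hg

include hsl hq in
lemma epsHom_mem_regAlg (k : b.support) {g : RatField b} (hg : g ∈ regAlg b q) :
    epsHom b k g ∈ regAlg b q := by
  have h : regAlg b q ≤ (regAlg b q).comap (epsHom b k) := by
    refine Algebra.adjoin_le ?_
    rintro _ (⟨v, rfl⟩ | ⟨i, rfl⟩)
    · change epsHom b k (ymon b q v) ∈ regAlg b q
      rw [epsHom_ymon b hsl hq]
      refine mul_mem ?_ (ymon_mem_regAlg b q _)
      rcases Int.even_or_odd (pair b k v) with h | h
      · rw [h.neg_one_zpow]; exact one_mem _
      · rw [h.neg_one_zpow]; exact neg_mem (one_mem _)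
    · change epsHom b k (rootFactor b q (q : ℂ)⁻¹ (rootCoord b i))⁻¹ ∈ regAlg b q
      rw [map_inv₀, epsHom_rootFactor b hsl hq]
      exact inv_rootFactor_mem_regAlg b q _
  exact h hg

lemma tau_mem_regAlg (l : b.support → ℕ) (k : b.support) {g : RatField b} (hg : g ∈ regAlg b q) :
    tau b hsl hq l k g ∈ regAlg b q := by
  have h := rootFactor_mul_tau b hsl hq l k g
  have hne := rootFactor_ne_zero b hq (q : ℂ)⁻¹ (simpleVec_ne_zero b k)
  have hinv := inv_rootFactor_mem_regAlg b q (k : ι)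
  rw [rootCoord_simple] at hinv
  have hy := ymon_mem_regAlg b q (simpleVec b k)
  have hc := const_mem (regAlg b q)
  have h1 := one_mem (regAlg b q)
  have hσ : ∀ g ∈ regAlg b q, sigmaHom b hsl hq k g ∈ regAlg b q :=
    fun g hg => sigmaHom_mem_regAlg b hsl hq k hg
  rw [eq_comm, ← inv_mul_eq_iff_eq_mul₀ hne, eq_comm] at h
  rw [h]
  exact mul_mem hinv (mul_mem hy (mul_mem (hc _) (mul_mem (mul_mem (pow_mem hy _)
    (add_mem (hc _) hy)) (add_mem (mul_mem (mul_mem (sub_mem h1 (hc _)) (add_mem h1 hy)) (hσ _ hg))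
      (mul_mem (mul_mem (pow_mem (neg_mem h1) _) (mul_mem (add_mem h1 (hc _)) (sub_mem h1 hy)))
        (hσ _ (epsHom_mem_regAlg b hsl hq k hg)))))))

/-- The multiples in `regAlg` of `1 - y^{2v}`, as a subspace of the field of rational functions. -/
def multiples (b : P.Base) (q : ℕ) (v : b.support → ℤ) : Submodule ℂ (RatField b) where
  carrier := {x | ∃ g ∈ regAlg b q, x = rootFactor b q 1 v * g}
  zero_mem' := ⟨0, zero_mem _, by simp⟩
  add_mem' := by
    rintro _ _ ⟨g, hg, rfl⟩ ⟨g', hg', rfl⟩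
    exact ⟨g + g', add_mem hg hg', by ring⟩
  smul_mem' := by
    rintro c _ ⟨g, hg, rfl⟩
    exact ⟨c • g, (regAlg b q).smul_mem hg c, by rw [mul_smul_comm]⟩

omit [P.IsCrystallographic] in
lemma mul_mem_multiples {b : P.Base} {q : ℕ} {v : b.support → ℤ} {x g : RatField b}
    (hx : x ∈ multiples b q v) (hg : g ∈ regAlg b q) : g * x ∈ multiples b q v := by
  obtain ⟨g', hg', rfl⟩ := hx
  exact ⟨g * g', mul_mem hg hg', by ring⟩

omit [P.IsCrystallographic] in
lemma rootFactor_mem_multiples (b : P.Base) (q : ℕ) (v : b.support → ℤ) :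
    rootFactor b q 1 v ∈ multiples b q v := ⟨1, one_mem _, by ring⟩

omit [P.IsCrystallographic] in
include hq in
lemma one_sub_zpow_mem_multiples (v : b.support → ℤ) {n : ℤ} (hn : Even n) :
    1 - ymon b q v ^ n ∈ multiples b q v := by
  obtain ⟨t, rfl⟩ := hn
  have hY := ymon_ne_zero b hq ((2 : ℤ) • v)
  have h : ∀ t : ℤ, 1 - ymon b q ((2 : ℤ) • v) ^ t ∈ multiples b q v := by
    intro t
    have hmem : ∀ t : ℤ, ymon b q ((2 : ℤ) • v) ^ t ∈ regAlg b q := by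
      intro t
      rw [← ymon_zsmul]
      exact ymon_mem_regAlg b q _
    have hF := rootFactor_mem_multiples b q v
    have hFe : rootFactor b q 1 v = 1 - ymon b q ((2 : ℤ) • v) := by rw [rootFactor, one_smul]
    induction t using Int.induction_on with
    | zero => simp
    | succ t ih =>
      have := add_mem ih (mul_mem_multiples hF (hmem t))
      convert this using 1
      rw [hFe, zpow_add₀ hY, zpow_one]
      ring
    | pred t ih =>
      have := sub_mem ih (mul_mem_multiples hF (hmem (-t - 1)))
      convert this using 1
      rw [hFe, zpow_sub₀ hY, zpow_one]
      field_simp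
      ring
  have := h t
  rwa [← ymon_zsmul, smul_smul, mul_two, ymon_zsmul] at this

/-- The operator `τ_k` is congruent to `-1` modulo `1 - y_k²` on polynomials. -/
lemma tau_add_self_mem (l : b.support → ℕ) (k : b.support) (p : MvPolynomial b.support ℂ) :
    tau b hsl hq l k (algebraMap _ (RatField b) p) + algebraMap _ (RatField b) p ∈
      multiples b q (simpleVec b k) := by
  have h := algebraMap_mem_span b hq p
  generalize algebraMap _ (RatField b) p = g at h
  induction h using Submodule.span_induction with
  | zero => simp
  | add x y _ _ hx hy =>
    rw [map_add, add_add_add_comm]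
    exact add_mem hx hy
  | smul c x _ hx =>
    rw [tau_smul, ← smul_add]
    exact Submodule.smul_mem _ c hx
  | mem x hx =>
    obtain ⟨v, rfl⟩ := hx
    set y := ymon b q (simpleVec b k) with hy
    set s := const b (sqrtC q) with hs
    have hy0 : y ≠ 0 := ymon_ne_zero b hq _
    have hs0 : s ≠ 0 := const_ne_zero b (sqrtC_ne_zero hq)
    have hF := rootFactor_ne_zero b hq (q : ℂ)⁻¹ (simpleVec_ne_zero b k)
    have hFe := rootFactor_eq_div b hq (simpleVec b k)
    have hne : s ^ 2 - y ^ 2 ≠ 0 := by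
      intro h0
      rw [hFe, ← hs, ← hy, h0, zero_div] at hF
      exact hF rfl
    have hinv : (s ^ 2 - y ^ 2)⁻¹ ∈ regAlg b q := by
      have h1 := mul_mem (inv_rootFactor_mem_regAlg b q (k : ι))
        (const_mem (regAlg b q) (sqrtC q ^ 2)⁻¹)
      rw [rootCoord_simple, hFe, ← hs, ← hy] at h1
      convert h1 using 1
      rw [const_eq_algebraMap, map_inv₀, map_pow, ← const_eq_algebraMap, ← hs]
      field_simp
    have hsy : s + y ∈ regAlg b q := add_mem (const_mem _ _) (ymon_mem_regAlg b q _)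
    have href : ymon b q (refl b k v) = ymon b q v * y ^ (- pair b k v) := by
      rw [refl_apply, sub_eq_add_neg, ← neg_smul, ymon_add b hq, ymon_zsmul]
    have hpow : ∀ n : ℤ, y ^ n ∈ regAlg b q := by
      intro n
      rw [hy, ← ymon_zsmul]
      exact ymon_mem_regAlg b q _
    have hv := ymon_mem_regAlg b q v
    rw [tau_apply, epsHom_ymon b hsl hq, map_mul, map_neg_one_zpow, sigmaHom_ymon, href, ← hy, ← hs,
      coefA, coefB]
    rcases Int.even_or_odd (l k + pair b k v) with he | he
    · have hu : ((-1 : RatField b)) ^ pair b k v * (-1) ^ l k = 1 := by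
        rw [← zpow_natCast, ← zpow_add₀ (by simp), add_comm]
        exact he.neg_one_zpow
      have h1 := one_sub_zpow_mem_multiples b hq (simpleVec b k) (n := l k + 2 - pair b k v) (by
        obtain ⟨t, ht⟩ := he
        exact ⟨t - pair b k v + 1, by linarith⟩)
      have h2 := add_mem (mul_mem_multiples h1 hv) (mul_mem_multiples
        (rootFactor_mem_multiples b q (simpleVec b k))
        (mul_mem hv (mul_mem (hpow (l k + 1 - pair b k v)) (mul_mem hsy hinv))))
      convert h2 using 1
      rw [rootFactor, one_smul, ymon_zsmul, ← hy, sub_eq_add_neg _ (pair b k v),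
        sub_eq_add_neg _ (pair b k v), zpow_add₀ hy0, zpow_add₀ hy0, zpow_add₀ hy0, zpow_add₀ hy0,
        pow_succ, zpow_natCast]
      have hz : y ^ (2 : ℤ) = y ^ 2 := zpow_ofNat y 2
      rw [zpow_one, hz]
      have h3 : y ^ l k * y * ((1 - s) * (1 + y) * (s + y)) * (2 * (s ^ 2 - y ^ 2))⁻¹ +
          y ^ l k * y * ((1 + s) * (1 - y) * (s + y)) * (2 * (s ^ 2 - y ^ 2))⁻¹ =
          - (y ^ l k * y ^ 2) + (1 - y ^ 2) * (y ^ l k * y * ((s + y) * (s ^ 2 - y ^ 2)⁻¹)) := by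
        field_simp
        ring
      linear_combination (ymon b q v * y ^ (-pair b k v)) * h3 + (y ^ l k * y *
        ((1 + s) * (1 - y) * (s + y)) * (2 * (s ^ 2 - y ^ 2))⁻¹ *
          (ymon b q v * y ^ (-pair b k v))) * hu
    · have hu : ((-1 : RatField b)) ^ pair b k v * (-1) ^ l k = -1 := by
        rw [← zpow_natCast, ← zpow_add₀ (by simp), add_comm]
        exact he.neg_one_zpow
      have h1 := one_sub_zpow_mem_multiples b hq (simpleVec b k) (n := l k + 1 - pair b k v) (by
        obtain ⟨t, ht⟩ := he
        exact ⟨t - pair b k v + 1, by linarith⟩)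
      have h2 := mul_mem_multiples h1 hv
      convert h2 using 1
      rw [← hy, sub_eq_add_neg _ (pair b k v), zpow_add₀ hy0, zpow_add₀ hy0, pow_succ, zpow_natCast,
        zpow_one]
      have h3 : y ^ l k * y * ((1 - s) * (1 + y) * (s + y)) * (2 * (s ^ 2 - y ^ 2))⁻¹ -
          y ^ l k * y * ((1 + s) * (1 - y) * (s + y)) * (2 * (s ^ 2 - y ^ 2))⁻¹ =
          - (y ^ l k * y) := by
        field_simp
        ring
      linear_combination (ymon b q v * y ^ (-pair b k v)) * h3 + (y ^ l k * y *
        ((1 + s) * (1 - y) * (s + y)) * (2 * (s ^ 2 - y ^ 2))⁻¹ *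
          (ymon b q v * y ^ (-pair b k v))) * hu

omit [P.IsCrystallographic] in
include hq in
/-- Elements of `regAlg` have denominators coprime to `1 - y^{2α}`. -/
lemma exists_denominator [P.IsReduced] (hq1 : q ≠ 1) {i : ι} (hi : b.IsPos i) {g : RatField b}
    (hg : g ∈ regAlg b q) : ∃ m p : MvPolynomial b.support ℂ,
      IsRelPrime (rootPoly b q 1 (rootCoord b i)) m ∧ m ≠ 0 ∧
      algebraMap _ (RatField b) m * g = algebraMap _ (RatField b) p := by
  have hpi := (isPos_iff_nonneg b i).1 hi
  have hqc : (q : ℂ) ≠ 0 := by exact_mod_cast hq.ne'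
  have hq1c : (q : ℂ) ≠ 1 := by exact_mod_cast hq1
  have hcc : MvPolynomial.constantCoeff (rootPoly b q 1 (rootCoord b i)) ≠ 0 := by
    rw [constantCoeff_rootPoly b q 1 hpi (rootCoord_ne_zero b i)]
    exact one_ne_zero
  have hrp0 : ∀ (c : ℂ) (j : ι), b.IsPos j → rootPoly b q c (rootCoord b j) ≠ 0 := by
    intro c j hj h0
    have := constantCoeff_rootPoly b q c ((isPos_iff_nonneg b j).1 hj) (rootCoord_ne_zero b j)
    rw [h0, map_zero] at this
    exact zero_ne_one this
  induction hg using Algebra.adjoin_induction with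
  | algebraMap c =>
    refine ⟨1, MvPolynomial.C c, isRelPrime_one_right, one_ne_zero, ?_⟩
    rw [map_one, one_mul, ← const_eq_algebraMap, const]
  | add x y _ _ hx hy =>
    obtain ⟨m, p, h1, h2, h3⟩ := hx
    obtain ⟨m', p', h1', h2', h3'⟩ := hy
    refine ⟨m * m', m' * p + m * p', h1.mul_right h1', mul_ne_zero h2 h2', ?_⟩
    rw [map_mul, map_add, map_mul, map_mul, ← h3, ← h3']
    ring
  | mul x y _ _ hx hy =>
    obtain ⟨m, p, h1, h2, h3⟩ := hx
    obtain ⟨m', p', h1', h2', h3'⟩ := hy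
    refine ⟨m * m', p * p', h1.mul_right h1', mul_ne_zero h2 h2', ?_⟩
    rw [map_mul, map_mul, ← h3, ← h3']
    ring
  | mem x hx =>
    rcases hx with ⟨v, rfl⟩ | ⟨j, rfl⟩
    · -- `y^v = y^{v⁺} / y^{v⁻}`
      have h1 := algebraMap_monomial_expo b hq (v := v⁻) (negPart_nonneg v) 1
      have h2 := algebraMap_monomial_expo b hq (v := v⁺) (posPart_nonneg v) 1
      have ha : (1 * sqrtC q ^ (∑ j, expo b v⁻ j)) ≠ 0 := by
        rw [one_mul]; exact pow_ne_zero _ (sqrtC_ne_zero hq)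
      refine ⟨_, MvPolynomial.monomial (expo b v⁺) (1 * sqrtC q ^ (∑ j, expo b v⁺ j)),
        (isRelPrime_monomial (expo b v⁻) ha hcc).symm, ?_, ?_⟩
      · rwa [Ne, MvPolynomial.monomial_eq_zero]
      · rw [h1, h2, one_smul, one_smul, ← ymon_add b hq]
        congr 1
        rw [add_comm]
        exact (sub_eq_iff_eq_add.1 (posPart_sub_negPart v)).symm
    · by_cases hj : b.IsPos j
      · refine ⟨rootPoly b q (q : ℂ)⁻¹ (rootCoord b j), 1, ?_, hrp0 _ j hj, ?_⟩
        · refine isRelPrime_rootPoly b hi hj hq fun _ h => hq1c ?_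
          exact inv_eq_one.1 h.symm
        · beta_reduce
          rw [algebraMap_rootPoly b hq _ ((isPos_iff_nonneg b j).1 hj), map_one,
            mul_inv_cancel₀ (rootFactor_ne_zero b hq _ (rootCoord_ne_zero b j))]
      · -- a negative root: `1 - y^{-2β} / q` is a unit multiple of `1 - q y^{2β}`
        let _ := P.indexNeg
        have hj' : b.IsPos (-j) := (Base.IsPos.or_neg b j).resolve_left hj
        have hneg : rootCoord b j = - rootCoord b (-j) := by
          apply latticePt_injective b
          rw [← neg_one_zsmul (rootCoord b (-j)), latticePt_smul, latticePt_rootCoord,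
            latticePt_rootCoord]
          simp
        have hpj := (isPos_iff_nonneg b (-j)).1 hj'
        refine ⟨rootPoly b q (q : ℂ) (rootCoord b (-j)),
          MvPolynomial.monomial (expo b ((2 : ℤ) • rootCoord b (-j)))
            (-q * sqrtC q ^ (∑ k, expo b ((2 : ℤ) • rootCoord b (-j)) k)),
          isRelPrime_rootPoly b hi hj' hq fun _ h => hq1c h.symm, hrp0 _ _ hj', ?_⟩
        have h0 := rootFactor_ne_zero b hq (q : ℂ) (rootCoord_ne_zero b (-j))
        have hY := ymon_ne_zero b hq ((2 : ℤ) • rootCoord b (-j))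
        beta_reduce
        rw [algebraMap_rootPoly b hq _ hpj, algebraMap_monomial_expo b hq
          (smul_nonneg zero_le_two hpj), hneg, rootFactor_neg b hq (inv_ne_zero hqc), inv_inv]
        generalize ymon b q ((2 : ℤ) • rootCoord b (-j)) = Y at hY ⊢
        rw [Algebra.smul_def, Algebra.smul_def, map_neg, map_inv₀, map_neg]
        have hc' : algebraMap ℂ (RatField b) q ≠ 0 := (map_ne_zero _).2 hqc
        field_simp

end

section

variable [P.IsCrystallographic] [Finite ι] [P.IsReduced] [P.IsRootSystem] (b : P.Base)
  (hsl : b.cartanMatrix.IsSimplyLaced) {q : ℕ} (hq : 0 < q)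

include hq in
/-- Multiplying the congruence `τ_k(D h) ≡ -D h` by the factor `F` of `D` at `α_k` turns it into
`(F + F') D h ≡ 0`, where `F'` is the factor at `-α_k`. Modulo `1 - y_k²` the function `F + F'` is
the nonzero constant `2 (1 - 1/q)`, so `D h ≡ 0`. -/
lemma average_mem_multiples_simple (hq1 : q ≠ 1) (l : b.support → ℕ) (k : b.support) :
    average b hsl hq l ∈ multiples b q (simpleVec b k) := by
  obtain ⟨p, hp, -⟩ := exists_poly_average b hsl hq l
  set D := rootProd b q (q : ℂ)⁻¹ with hD
  set h := average b hsl hq l with hh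
  set F := rootFactor b q (q : ℂ)⁻¹ (simpleVec b k) with hF
  set F' := rootFactor b q (q : ℂ)⁻¹ (-simpleVec b k) with hF'
  have hqc : (q : ℂ) ≠ 0 := by exact_mod_cast hq.ne'
  have hD0 : D ≠ 0 := rootProd_ne_zero b hq _
  have hF0 : F ≠ 0 := rootFactor_ne_zero b hq _ (simpleVec_ne_zero b k)
  have hε : epsHom b k D = D := by
    rw [hD, rootProd, map_prod]
    exact Finset.prod_congr rfl fun i _ => epsHom_rootFactor b hsl hq k _ _
  have hσ := sigmaHom_rootProd b hsl hq k (q : ℂ)⁻¹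
  rw [← hD, ← hF, ← hF'] at hσ
  have hτ : tau b hsl hq l k (D * h) = sigmaHom b hsl hq k D * h := by
    rw [tau_mul b hsl hq l hε, hh, tau_average]
  have hcong := tau_add_self_mem b hsl hq l k p
  rw [hp, hτ] at hcong
  have hFmem := rootFactor_mem_regAlg b q (q : ℂ)⁻¹ (simpleVec b k)
  have h1 := mul_mem_multiples hcong hFmem
  have h2 : F * (sigmaHom b hsl hq k D * h + D * h) = (F + F') * (D * h) := by
    linear_combination h * hσ
  rw [← hF, h2] at h1
  -- `q y² (F + F')` is the constant `2 (q - 1) y²` modulo `1 - y²`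
  set Y := ymon b q ((2 : ℤ) • simpleVec b k) with hY
  have hY0 : Y ≠ 0 := ymon_ne_zero b hq _
  have hFF : (algebraMap ℂ _ (q : ℂ) * Y) * (F + F') =
      algebraMap ℂ _ (2 * ((q : ℂ) - 1)) * Y - rootFactor b q 1 (simpleVec b k) ^ 2 := by
    have hc' : algebraMap ℂ (RatField b) q ≠ 0 := (map_ne_zero _).2 hqc
    rw [hF, hF', rootFactor, rootFactor, rootFactor, smul_neg, ymon_neg, ← hY, Algebra.smul_def,
      Algebra.smul_def, one_smul, map_mul, map_sub, map_one, map_inv₀, map_ofNat]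
    field_simp
    ring
  have hYmem : Y ∈ regAlg b q := ymon_mem_regAlg b q _
  have hDh : D * h ∈ regAlg b q := by rw [← hp]; exact algebraMap_mem_regAlg b hq p
  have h3 := mul_mem_multiples h1 (mul_mem ((regAlg b q).algebraMap_mem (q : ℂ)) hYmem)
  have h4 := mul_mem_multiples (rootFactor_mem_multiples b q (simpleVec b k))
    (mul_mem (rootFactor_mem_regAlg b q 1 (simpleVec b k)) hDh)
  have h5 := add_mem h3 h4
  have h6 : algebraMap ℂ _ (q : ℂ) * Y * ((F + F') * (D * h)) +
      rootFactor b q 1 (simpleVec b k) * (D * h) * rootFactor b q 1 (simpleVec b k) =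
      algebraMap ℂ _ (2 * ((q : ℂ) - 1)) * Y * (D * h) := by
    linear_combination (D * h) * hFF
  rw [h6] at h5
  have hYinv : Y⁻¹ ∈ regAlg b q := by
    rw [hY, ← ymon_neg]; exact ymon_mem_regAlg b q _
  have hDinv : D⁻¹ ∈ regAlg b q := by
    rw [hD, rootProd, ← Finset.prod_inv_distrib]
    exact prod_mem fun i _ => inv_rootFactor_mem_regAlg b q i
  have h7 := mul_mem_multiples h5 (mul_mem (mul_mem hDinv hYinv)
    ((regAlg b q).algebraMap_mem (2 * ((q : ℂ) - 1))⁻¹))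
  convert h7 using 1
  have hcne : algebraMap ℂ (RatField b) (2 * ((q : ℂ) - 1)) ≠ 0 := by
    refine (map_ne_zero _).2 (mul_ne_zero two_ne_zero (sub_ne_zero.2 ?_))
    exact_mod_cast hq1
  rw [map_inv₀]
  field_simp

/-- The average is divisible by `1 - y^{2α}` for every root `α`: every root is carried to a simple root
by simple reflections, and the operators `τ_k` fix the average. -/
lemma average_mem_multiples (hq1 : q ≠ 1) (l : b.support → ℕ) (i : ι) :
    average b hsl hq l ∈ multiples b q (rootCoord b i) := by
  refine b.induction_reflect i (p := fun i => average b hsl hq l ∈ multiples b q (rootCoord b i))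
    ?_ ?_ ?_
  · rintro i ⟨g, hg, he⟩
    have hneg : rootCoord b (P.reflectionPerm i i) = - rootCoord b i := by
      apply latticePt_injective b
      rw [← neg_one_zsmul (rootCoord b i), latticePt_smul, latticePt_rootCoord,
        latticePt_rootCoord, root_reflectionPerm, reflection_apply_self, neg_one_zsmul]
    have h0 := rootFactor_neg b hq one_ne_zero (- rootCoord b i)
    rw [neg_neg, inv_one] at h0
    refine ⟨(-1 : ℂ) • (ymon b q ((2 : ℤ) • (-rootCoord b i)))⁻¹ * g, mul_mem ?_ hg, ?_⟩
    · rw [← ymon_neg]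
      exact (regAlg b q).smul_mem (ymon_mem_regAlg b q _) _
    · rw [he, h0, hneg]; ring
  · intro k hk
    rw [show (k : ι) = ((⟨k, hk⟩ : b.support) : ι) from rfl, rootCoord_simple]
    exact average_mem_multiples_simple b hsl hq hq1 l ⟨k, hk⟩
  · rintro i j ⟨g, hg, he⟩ hj
    refine ⟨tau b hsl hq l ⟨j, hj⟩ g, tau_mem_regAlg b hsl hq l _ hg, ?_⟩
    have h1 := rootCoord_reflectionPerm b ⟨j, hj⟩ i
    conv_lhs => rw [← tau_average b hsl hq l ⟨j, hj⟩, he,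
      tau_mul b hsl hq l (epsHom_rootFactor b hsl hq _ _ _), sigmaHom_rootFactor, ← h1]

include hsl hq in
/-- `N(x; ℓ)` is a polynomial with constant coefficient `1`. -/
lemma exists_poly_numer (hq1 : q ≠ 1) (l : b.support → ℕ) :
    ∃ p : MvPolynomial b.support ℂ, algebraMap _ (RatField b) p = numer b q l ∧
      MvPolynomial.coeff 0 p = 1 := by
  obtain ⟨H, hH, hH0⟩ := exists_poly_average b hsl hq l
  have hdvd : ∀ i ∈ posRoots b, rootPoly b q 1 (rootCoord b i) ∣ H := by
    intro i hi
    rw [mem_posRoots] at hi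
    obtain ⟨g, hg, he⟩ := average_mem_multiples b hsl hq hq1 l i
    have hD : rootProd b q (q : ℂ)⁻¹ ∈ regAlg b q :=
      prod_mem fun i _ => rootFactor_mem_regAlg b q _ _
    obtain ⟨m, p, h1, h2, h3⟩ := exists_denominator b hq hq1 hi (mul_mem hD hg)
    have h4 : m * H = rootPoly b q 1 (rootCoord b i) * p := by
      apply IsFractionRing.injective (MvPolynomial b.support ℂ) (RatField b)
      rw [map_mul, map_mul, ← h3, hH, he, algebraMap_rootPoly b hq _ ((isPos_iff_nonneg b i).1 hi)]
      ring
    exact h1.dvd_of_dvd_mul_left ⟨p, h4⟩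
  obtain ⟨p, hp⟩ : ∏ i ∈ posRoots b, rootPoly b q 1 (rootCoord b i) ∣ H := by
    refine Finset.prod_dvd_of_isRelPrime ?_ hdvd
    intro i hi j hj hij
    exact isRelPrime_rootPoly b ((mem_posRoots b i).1 hi) ((mem_posRoots b j).1 hj) hq
      fun h => absurd h hij
  refine ⟨p, ?_, ?_⟩
  · have h0 : rootProd b q 1 ≠ 0 := rootProd_ne_zero b hq 1
    rw [numer_eq b hsl hq l, mul_assoc, mul_comm (average b hsl hq l), ← hH, hp, map_mul,
      algebraMap_rootPoly_prod b hq _ _ subset_rfl, ← rootProd, inv_mul_cancel_left₀ h0]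
  · rw [hp, map_mul, constantCoeff_rootPoly_prod b q _ _ subset_rfl, one_mul] at hH0
    exact hH0

end

/-! ### The functional equations of the coefficients of `N` -/

section

variable [P.IsCrystallographic]

/-- The reflection `λ ↦ σ_k λ + (l_k + 1) α_k` of the root lattice; it is the reflection
`λ ↦ θ - σ_k (θ - λ)`. -/
def dotRefl (b : P.Base) (l : b.support → ℕ) (k : b.support) (v : b.support → ℤ) :
    b.support → ℤ :=
  refl b k v + ((l k : ℤ) + 1) • simpleVec b k

lemma dotRefl_eq (b : P.Base) (l : b.support → ℕ) (k : b.support) (v : b.support → ℤ) :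
    dotRefl b l k v = v + ((l k : ℤ) + 1 - pair b k v) • simpleVec b k := by
  rw [dotRefl, refl_apply, sub_smul]
  abel

lemma pair_dotRefl (b : P.Base) (l : b.support → ℕ) (k : b.support) (v : b.support → ℤ) :
    pair b k (dotRefl b l k v) = 2 * ((l k : ℤ) + 1) - pair b k v := by
  rw [dotRefl, map_add, pair_refl, map_zsmul, pair_simpleVec_self, smul_eq_mul]
  ring

lemma dotRefl_dotRefl (b : P.Base) (l : b.support → ℕ) (k : b.support) :
    Function.Involutive (dotRefl b l k) := by
  intro v
  rw [dotRefl_eq b l k (dotRefl b l k v), pair_dotRefl, dotRefl_eq, add_assoc, ← add_smul]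
  rw [show (l k : ℤ) + 1 - pair b k v + (l k + 1 - (2 * (l k + 1) - pair b k v)) = 0 by ring,
    zero_smul, add_zero]

lemma dotRefl_add_smul (b : P.Base) (l : b.support → ℕ) (k : b.support) (v : b.support → ℤ)
    (n : ℤ) : dotRefl b l k (v + n • simpleVec b k) = dotRefl b l k v - n • simpleVec b k := by
  rw [dotRefl, dotRefl, map_add, map_zsmul, refl_simpleVec_self, smul_neg]
  abel

lemma eq_dotRefl (b : P.Base) {l : b.support → ℕ} {k : b.support} {lam mu : b.support → ℤ}
    (h : latticePt b mu = P.reflection k (latticePt b lam) + (l k + 1) • P.root k) :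
    mu = dotRefl b l k lam := by
  apply latticePt_injective b
  rw [h, dotRefl, latticePt_add, latticePt_refl, latticePt_smul, ← rootCoord_simple,
    latticePt_rootCoord]
  congr 1
  exact_mod_cast (natCast_zsmul (P.root k) (l k + 1)).symm

lemma latticePt_dotRefl (b : P.Base) (l : b.support → ℕ) (k : b.support) (lam : b.support → ℤ) :
    latticePt b (dotRefl b l k lam) =
      P.reflection k (latticePt b lam) + (l k + 1) • P.root k := by
  rw [dotRefl, latticePt_add, latticePt_refl, latticePt_smul, ← rootCoord_simple,
    latticePt_rootCoord]
  congr 1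
  exact_mod_cast natCast_zsmul (P.root k) (l k + 1)

end

/-- The coefficients of a polynomial in the basis of Laurent monomials `y^v`. -/
def yCoeff (b : P.Base) (q : ℕ) (p : MvPolynomial b.support ℂ) : (b.support → ℤ) →₀ ℂ :=
  ∑ m ∈ p.support, Finsupp.single (fun j => (m j : ℤ))
    (MvPolynomial.coeff m p * (sqrtC q)⁻¹ ^ (∑ j, m j))

lemma linearCombination_yCoeff (b : P.Base) {q : ℕ} (hq : 0 < q) (p : MvPolynomial b.support ℂ) :
    Finsupp.linearCombination ℂ (ymon b q) (yCoeff b q p) = algebraMap _ (RatField b) p := by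
  rw [yCoeff, map_sum]
  conv_rhs => rw [← MvPolynomial.support_sum_monomial_coeff p, map_sum]
  refine Finset.sum_congr rfl fun m _ => ?_
  rw [Finsupp.linearCombination_single, algebraMap_monomial b hq]

lemma coeffL_eq_yCoeff (b : P.Base) {q : ℕ} (hq : 0 < q) (p : MvPolynomial b.support ℂ)
    (v : b.support → ℤ) : coeffL b p v = yCoeff b q p v * sqrtC q ^ (∑ j, v j) := by
  classical
  have hs := sqrtC_ne_zero hq
  rw [yCoeff, Finsupp.finsetSum_apply, coeffL]
  split_ifs with h
  · set m₀ : b.support →₀ ℕ := Finsupp.equivFunOnFinite.symm fun j => (v j).toNat with hm₀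
    have hv : (fun j => (m₀ j : ℤ)) = v := by
      funext j
      exact Int.toNat_of_nonneg (h j)
    rw [Finset.sum_eq_single m₀]
    · have hsum : ∑ j, v j = ((∑ j, m₀ j : ℕ) : ℤ) := by
        rw [← hv]; push_cast; rfl
      rw [hv, Finsupp.single_eq_same, hsum, zpow_natCast, mul_assoc, ← mul_pow,
        inv_mul_cancel₀ hs, one_pow, mul_one]
    · intro m _ hm
      rw [Finsupp.single_eq_of_ne]
      intro h'
      apply hm
      ext j
      have := congrFun (h'.symm.trans hv.symm) j
      exact_mod_cast this
    · intro hm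
      rw [MvPolynomial.notMem_support_iff.1 hm, zero_mul, Finsupp.single_zero, Finsupp.zero_apply]
  · rw [Finset.sum_eq_zero, zero_mul]
    intro m _
    rw [Finsupp.single_eq_of_ne]
    rintro rfl
    exact h fun j => Int.natCast_nonneg _

lemma phi_eq [P.IsCrystallographic] (b : P.Base) (hsl : b.cartanMatrix.IsSimplyLaced)
    (l : b.support → ℕ) (k : b.support) (v : b.support → ℤ) :
    phi b l k v = l k + 2 * v k - pair b k v := by
  rw [phi, pair_eq b hsl]
  ring

section

variable [P.IsCrystallographic] (b : P.Base) (hsl : b.cartanMatrix.IsSimplyLaced) {q : ℕ}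
  (hq : 0 < q)

/-- The action of `τ_k` on the monomials of one parity, with the denominator `q - y_k²` cleared. -/
lemma tau_ymon_of_even (l : b.support → ℕ) (k : b.support) (v : b.support → ℤ)
    (hv : Even (l k + pair b k v)) :
    (const b (sqrtC q) ^ 2 - ymon b q (simpleVec b k) ^ 2) * tau b hsl hq l k (ymon b q v) =
      (const b (sqrtC q) + ymon b q (simpleVec b k)) *
        (1 - const b (sqrtC q) * ymon b q (simpleVec b k)) * ymon b q (dotRefl b l k v) := by
  have hF := rootFactor_ne_zero b hq (q : ℂ)⁻¹ (simpleVec_ne_zero b k)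
  have hne : const b (sqrtC q) ^ 2 - ymon b q (simpleVec b k) ^ 2 ≠ 0 := by
    intro h0
    rw [rootFactor_eq_div b hq, h0, zero_div] at hF
    exact hF rfl
  have hu : ((-1 : RatField b)) ^ pair b k v * (-1) ^ l k = 1 := by
    rw [← zpow_natCast, ← zpow_add₀ (by simp), add_comm]
    exact hv.neg_one_zpow
  rw [tau_apply, epsHom_ymon b hsl hq, map_mul, map_neg_one_zpow, sigmaHom_ymon, dotRefl,
    ymon_add b hq, ymon_zsmul, coefA, coefB]
  have hz : ymon b q (simpleVec b k) ^ ((l k : ℤ) + 1) = ymon b q (simpleVec b k) ^ (l k + 1) := by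
    exact_mod_cast zpow_natCast (ymon b q (simpleVec b k)) (l k + 1)
  rw [hz]
  set y := ymon b q (simpleVec b k)
  set s := const b (sqrtC q)
  have h3 : (s ^ 2 - y ^ 2) * (y ^ (l k + 1) * ((1 - s) * (1 + y) * (s + y)) *
      (2 * (s ^ 2 - y ^ 2))⁻¹ + y ^ (l k + 1) * ((1 + s) * (1 - y) * (s + y)) *
      (2 * (s ^ 2 - y ^ 2))⁻¹) = (s + y) * (1 - s * y) * y ^ (l k + 1) := by
    field_simp
    ring
  linear_combination ymon b q (refl b k v) * h3 + (s ^ 2 - y ^ 2) * (y ^ (l k + 1) *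
    ((1 + s) * (1 - y) * (s + y)) * (2 * (s ^ 2 - y ^ 2))⁻¹ * ymon b q (refl b k v)) * hu

/-- The action of `τ_k` on the monomials of the other parity. -/
lemma tau_ymon_of_odd (l : b.support → ℕ) (k : b.support) (v : b.support → ℤ)
    (hv : Odd (l k + pair b k v)) :
    (const b (sqrtC q) ^ 2 - ymon b q (simpleVec b k) ^ 2) * tau b hsl hq l k (ymon b q v) =
      (ymon b q (simpleVec b k) ^ 2 - const b (sqrtC q) ^ 2) * ymon b q (dotRefl b l k v) := by
  have hF := rootFactor_ne_zero b hq (q : ℂ)⁻¹ (simpleVec_ne_zero b k)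
  have hne : const b (sqrtC q) ^ 2 - ymon b q (simpleVec b k) ^ 2 ≠ 0 := by
    intro h0
    rw [rootFactor_eq_div b hq, h0, zero_div] at hF
    exact hF rfl
  have hu : ((-1 : RatField b)) ^ pair b k v * (-1) ^ l k = -1 := by
    rw [← zpow_natCast, ← zpow_add₀ (by simp), add_comm]
    exact hv.neg_one_zpow
  rw [tau_apply, epsHom_ymon b hsl hq, map_mul, map_neg_one_zpow, sigmaHom_ymon, dotRefl,
    ymon_add b hq, ymon_zsmul, coefA, coefB]
  have hz : ymon b q (simpleVec b k) ^ ((l k : ℤ) + 1) = ymon b q (simpleVec b k) ^ (l k + 1) := by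
    exact_mod_cast zpow_natCast (ymon b q (simpleVec b k)) (l k + 1)
  rw [hz]
  set y := ymon b q (simpleVec b k)
  set s := const b (sqrtC q)
  have h3 : (s ^ 2 - y ^ 2) * (y ^ (l k + 1) * ((1 - s) * (1 + y) * (s + y)) *
      (2 * (s ^ 2 - y ^ 2))⁻¹ - y ^ (l k + 1) * ((1 + s) * (1 - y) * (s + y)) *
      (2 * (s ^ 2 - y ^ 2))⁻¹) = (y ^ 2 - s ^ 2) * y ^ (l k + 1) := by
    field_simp
    ring
  linear_combination ymon b q (refl b k v) * h3 + (s ^ 2 - y ^ 2) * (y ^ (l k + 1) *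
    ((1 + s) * (1 - y) * (s + y)) * (2 * (s ^ 2 - y ^ 2))⁻¹ * ymon b q (refl b k v)) * hu

/-- If `d τ_k` acts on the monomials in the support of `A` as multiplication by `c` followed by the
reflection of exponents, then it does so on their linear combination. -/
lemma tau_linearCombination (l : b.support → ℕ) (k : b.support) (A : (b.support → ℤ) →₀ ℂ)
    (c d : RatField b)
    (h : ∀ v ∈ A.support, d * tau b hsl hq l k (ymon b q v) = c * ymon b q (dotRefl b l k v)) :
    d * tau b hsl hq l k (Finsupp.linearCombination ℂ (ymon b q) A) =
      c * Finsupp.linearCombination ℂ (ymon b q)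
        (Finsupp.equivMapDomain (dotRefl_dotRefl b l k).toPerm A) := by
  rw [Finsupp.linearCombination_equivMapDomain, Finsupp.linearCombination_apply,
    Finsupp.linearCombination_apply, Finsupp.sum, Finsupp.sum, map_sum, Finset.mul_sum,
    Finset.mul_sum]
  refine Finset.sum_congr rfl fun v hv => ?_
  rw [tau_smul, mul_smul_comm, h v hv, mul_smul_comm]
  rfl

omit [P.IsCrystallographic] in
include hq in
lemma linearCombination_shift (A : (b.support → ℤ) →₀ ℂ) (u : b.support → ℤ) :
    Finsupp.linearCombination ℂ (ymon b q) (Finsupp.equivMapDomain (Equiv.addRight u) A) =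
      ymon b q u * Finsupp.linearCombination ℂ (ymon b q) A := by
  rw [Finsupp.linearCombination_equivMapDomain, Finsupp.linearCombination_apply,
    Finsupp.linearCombination_apply, Finsupp.sum, Finsupp.sum, Finset.mul_sum]
  refine Finset.sum_congr rfl fun v _ => ?_
  rw [mul_smul_comm, ← ymon_add b hq, add_comm u]
  rfl

end

section

variable [P.IsCrystallographic] [Finite ι] [P.IsReduced] [P.IsRootSystem] (b : P.Base)
  (hsl : b.cartanMatrix.IsSimplyLaced) {q : ℕ} (hq : 0 < q)

/-- The functional equation of `N` under `τ_k`. -/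
lemma tau_numer (l : b.support → ℕ) (k : b.support) :
    (const b (sqrtC q) ^ 2 - ymon b q (simpleVec b k) ^ 2) * tau b hsl hq l k (numer b q l) =
      (1 - const b (sqrtC q) ^ 2 * ymon b q (simpleVec b k) ^ 2) * numer b q l := by
  set Δ := rootProd b q 1 with hΔ
  set D := rootProd b q (q : ℂ)⁻¹ with hD
  have hΔ0 : Δ ≠ 0 := rootProd_ne_zero b hq _
  have hε : ∀ c, epsHom b k (rootProd b q c) = rootProd b q c := by
    intro c
    rw [rootProd, map_prod]
    exact Finset.prod_congr rfl fun i _ => epsHom_rootFactor b hsl hq k _ _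
  have hs0 : const b (sqrtC q) ≠ 0 := const_ne_zero b (sqrtC_ne_zero hq)
  have hy0 := ymon_ne_zero b hq (simpleVec b k)
  have h1 := sigmaHom_rootProd b hsl hq k 1
  have h2 := sigmaHom_rootProd b hsl hq k (q : ℂ)⁻¹
  have hF1 := rootFactor_ne_zero b hq 1 (simpleVec_ne_zero b k)
  have hσΔ : sigmaHom b hsl hq k Δ ≠ 0 := (map_ne_zero _).2 hΔ0
  rw [rootFactor_eq_div b hq, rootFactor_eq_div b hq, ymon_neg, ← hD] at h2
  rw [rootFactor, rootFactor, one_smul, one_smul, ymon_zsmul, ymon_zsmul, ymon_neg, ← hΔ,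
    zpow_ofNat, zpow_ofNat] at h1
  rw [rootFactor, one_smul, ymon_zsmul, zpow_ofNat] at hF1
  have hu : epsHom b k (Δ⁻¹ * D) = Δ⁻¹ * D := by
    rw [map_mul, map_inv₀, hε, hε]
  have hN : numer b q l = (Δ⁻¹ * D) * average b hsl hq l := by
    rw [numer_eq b hsl hq l]
    ring
  rw [hN, tau_mul b hsl hq l hu, tau_average, map_mul, map_inv₀]
  set y := ymon b q (simpleVec b k)
  set s := const b (sqrtC q)
  have h1' : sigmaHom b hsl hq k Δ * y ^ 2 = - Δ := by
    apply mul_right_cancel₀ hF1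
    field_simp at h1
    linear_combination h1
  have h2' : sigmaHom b hsl hq k D * (s ^ 2 - y ^ 2) * y ^ 2 = D * (s ^ 2 * y ^ 2 - 1) := by
    field_simp at h2
    linear_combination h2
  have h3 : (s ^ 2 - y ^ 2) * ((sigmaHom b hsl hq k Δ)⁻¹ * sigmaHom b hsl hq k D) =
      (1 - s ^ 2 * y ^ 2) * (Δ⁻¹ * D) := by
    generalize sigmaHom b hsl hq k Δ = Δ' at h1' hσΔ ⊢
    have hΔe : Δ = - (Δ' * y ^ 2) := by rw [h1', neg_neg]
    rw [hΔe]
    field_simp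
    linear_combination h2'
  linear_combination average b hsl hq l * h3

include hsl hq in
/-- The functional equations for the coefficients of `N` with respect to the monomials `y^v`. -/
lemma yCoeff_numer (l : b.support → ℕ) (k : b.support) {p : MvPolynomial b.support ℂ}
    (hp : algebraMap _ (RatField b) p = numer b q l) (w : b.support → ℤ) :
    (Even (l k + pair b k w) →
      yCoeff b q p w - q * yCoeff b q p (w - (2 : ℤ) • simpleVec b k) =
        sqrtC q * yCoeff b q p (dotRefl b l k w) +
        (1 - q) * yCoeff b q p (dotRefl b l k w + simpleVec b k) -
        sqrtC q * yCoeff b q p (dotRefl b l k w + (2 : ℤ) • simpleVec b k)) ∧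
    (Odd (l k + pair b k w) →
      yCoeff b q p w - q * yCoeff b q p (w - (2 : ℤ) • simpleVec b k) =
        yCoeff b q p (dotRefl b l k w + (2 : ℤ) • simpleVec b k) -
        q * yCoeff b q p (dotRefl b l k w)) := by
  classical
  set A := yCoeff b q p with hA
  set L := Finsupp.linearCombination ℂ (ymon b q) with hL
  set Ae := A.filter fun v => Even (l k + pair b k v) with hAe
  set Ao := A.filter fun v => ¬ Even (l k + pair b k v) with hAo
  have hsum : Ae + Ao = A := Finsupp.filter_add_filter_not A _
  have hN := tau_numer b hsl hq l k
  rw [← hp, ← linearCombination_yCoeff b hq, ← hA, ← hL] at hN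
  have hτ : tau b hsl hq l k (L A) = tau b hsl hq l k (L Ae) + tau b hsl hq l k (L Ao) := by
    rw [← map_add, ← map_add, hsum]
  have he := tau_linearCombination b hsl hq l k Ae _ _ fun v hv =>
    tau_ymon_of_even b hsl hq l k v (by
      rw [Finsupp.support_filter, Finset.mem_filter] at hv
      exact hv.2)
  have ho := tau_linearCombination b hsl hq l k Ao _ _ fun v hv =>
    tau_ymon_of_odd b hsl hq l k v (by
      rw [Finsupp.support_filter, Finset.mem_filter] at hv
      exact Int.not_even_iff_odd.1 hv.2)
  set Re := Finsupp.equivMapDomain (dotRefl_dotRefl b l k).toPerm Ae with hRe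
  set Ro := Finsupp.equivMapDomain (dotRefl_dotRefl b l k).toPerm Ao with hRo
  have hsh1 : ∀ B, ymon b q (simpleVec b k) * L B =
      L (Finsupp.equivMapDomain (Equiv.addRight (simpleVec b k)) B) := fun B =>
    (linearCombination_shift b hq B _).symm
  have hsh2 : ∀ B, ymon b q (simpleVec b k) ^ 2 * L B =
      L (Finsupp.equivMapDomain (Equiv.addRight ((2 : ℤ) • simpleVec b k)) B) := fun B => by
    rw [hL, linearCombination_shift b hq B, ymon_zsmul, zpow_ofNat]
  have hc : ∀ (c : ℂ) B, const b c * L B = L (c • B) := fun c B => by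
    rw [map_smul, const_eq_algebraMap, ← Algebra.smul_def]
  have hzero : L (A - sqrtC q ^ 2 •
      Finsupp.equivMapDomain (Equiv.addRight ((2 : ℤ) • simpleVec b k)) A -
      sqrtC q • Re -
      Finsupp.equivMapDomain (Equiv.addRight (simpleVec b k)) Re +
      sqrtC q ^ 2 • Finsupp.equivMapDomain (Equiv.addRight (simpleVec b k)) Re +
      sqrtC q • Finsupp.equivMapDomain (Equiv.addRight ((2 : ℤ) • simpleVec b k)) Re -
      Finsupp.equivMapDomain (Equiv.addRight ((2 : ℤ) • simpleVec b k)) Ro +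
      sqrtC q ^ 2 • Ro) = 0 := by
    simp only [map_add, map_sub, ← hc, ← hsh1, ← hsh2]
    rw [show const b (sqrtC q ^ 2) = const b (sqrtC q) ^ 2 by
      rw [const_eq_algebraMap, map_pow, ← const_eq_algebraMap]]
    rw [hτ, mul_add, he, ho] at hN
    linear_combination -hN
  have hz := (linearIndependent_iff.1 (linearIndependent_ymon b hq)) _ hzero
  have hw := DFunLike.congr_fun hz w
  have hpr : ∀ n : ℤ, Even (l k + pair b k (dotRefl b l k w + n • simpleVec b k)) ↔
      Even (l k + pair b k w) := by
    intro n
    rw [map_add, pair_dotRefl, map_zsmul, pair_simpleVec_self, smul_eq_mul]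
    simp only [Int.even_add, Int.even_sub, Int.even_mul, even_two, true_or, or_true, true_iff,
      iff_true]
  have hpr0 := hpr 0
  have hpr1 := hpr 1
  have hpr2 := hpr 2
  have hm1 : dotRefl b l k (w - simpleVec b k) = dotRefl b l k w + simpleVec b k := by
    have := dotRefl_add_smul b l k w (-1)
    rwa [neg_smul, one_smul, ← sub_eq_add_neg, sub_neg_eq_add] at this
  have hm2 : dotRefl b l k (w - (2 : ℤ) • simpleVec b k) =
      dotRefl b l k w + (2 : ℤ) • simpleVec b k := by
    have := dotRefl_add_smul b l k w (-2)
    rwa [neg_smul, ← sub_eq_add_neg, sub_neg_eq_add] at this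
  rw [zero_smul, add_zero] at hpr0
  rw [one_smul] at hpr1
  simp only [Finsupp.add_apply, Finsupp.sub_apply, Finsupp.smul_apply, hRe, hRo,
    Finsupp.equivMapDomain_apply, Equiv.addRight_symm, Equiv.coe_addRight, ← sub_eq_add_neg,
    Function.Involutive.toPerm_symm, Function.Involutive.coe_toPerm, hm1, hm2, hAe, hAo,
    Finsupp.filter_apply, hpr0, hpr1, hpr2, smul_eq_mul, Finsupp.zero_apply, sqrtC_sq] at hw
  constructor
  · intro h
    simp only [h, if_true, not_true, if_false] at hw
    linear_combination hw
  · intro h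
    rw [← Int.not_even_iff_odd] at h
    simp only [h, if_false, not_false_iff, if_true] at hw
    linear_combination hw

include hsl hq in
/-- The common factor `1 - √q y_k` of the even part of the functional equation can be cancelled,
because the coefficients have finite support. -/
lemma yCoeff_numer_even (l : b.support → ℕ) (k : b.support) {p : MvPolynomial b.support ℂ}
    (hp : algebraMap _ (RatField b) p = numer b q l) (w : b.support → ℤ)
    (hw : Even (l k + pair b k w)) :
    yCoeff b q p w + sqrtC q * yCoeff b q p (w - simpleVec b k) =
      sqrtC q * yCoeff b q p (dotRefl b l k w) +
        yCoeff b q p (dotRefl b l k w + simpleVec b k) := by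
  classical
  set A := yCoeff b q p with hA
  set X : (b.support → ℤ) → ℂ := fun v => A v + sqrtC q * A (v - simpleVec b k) -
    sqrtC q * A (dotRefl b l k v) - A (dotRefl b l k v + simpleVec b k) with hX
  have hm : ∀ (n : ℕ), dotRefl b l k (w - (n : ℤ) • simpleVec b k) =
      dotRefl b l k w + (n : ℤ) • simpleVec b k := by
    intro n
    have := dotRefl_add_smul b l k w (-n)
    rwa [neg_smul, ← sub_eq_add_neg, sub_neg_eq_add] at this
  have hstep : ∀ n : ℕ, X (w - (n : ℤ) • simpleVec b k) =
      sqrtC q * X (w - ((n + 1 : ℕ) : ℤ) • simpleVec b k) := by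
    intro n
    have h1 := (yCoeff_numer b hsl hq l k hp (w - (n : ℤ) • simpleVec b k)).1 (by
      rw [map_sub, map_zsmul, pair_simpleVec_self, smul_eq_mul]
      simp only [Int.even_add, Int.even_sub, Int.even_mul, even_two, or_true, iff_true]
      exact Int.even_add.1 hw)
    simp only [hX]
    rw [hm] at h1 ⊢
    rw [hm (n + 1)]
    have e1 : w - ((n + 1 : ℕ) : ℤ) • simpleVec b k =
        w - (n : ℤ) • simpleVec b k - simpleVec b k := by
      push_cast; rw [add_smul, one_smul]; abel
    have e2 : dotRefl b l k w + ((n + 1 : ℕ) : ℤ) • simpleVec b k =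
        dotRefl b l k w + (n : ℤ) • simpleVec b k + simpleVec b k := by
      push_cast; rw [add_smul, one_smul]; abel
    have e3 : ∀ u : b.support → ℤ, u + simpleVec b k + simpleVec b k =
        u + (2 : ℤ) • simpleVec b k := by
      intro u; rw [two_smul]; abel
    have e4 : ∀ u : b.support → ℤ, u - simpleVec b k - simpleVec b k =
        u - (2 : ℤ) • simpleVec b k := by
      intro u; rw [two_smul]; abel
    rw [e1, e2, e3, e4]
    rw [← hA, ← sqrtC_sq] at h1
    linear_combination h1
  have hpow : ∀ n : ℕ, X w = sqrtC q ^ n * X (w - (n : ℤ) • simpleVec b k) := by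
    intro n
    induction n with
    | zero => simp
    | succ n ih => rw [ih, hstep n]; ring
  -- far away on the line through `w` in the direction of `α_k` all coefficients vanish
  obtain ⟨B, hB⟩ : ∃ B : ℕ, ∀ v, A v ≠ 0 → -(B : ℤ) < v k ∧ v k < B := by
    refine ⟨∑ v ∈ A.support, (v k).natAbs + 1, fun v hv => ?_⟩
    have := Finset.single_le_sum (f := fun v : b.support → ℤ => (v k).natAbs)
      (fun _ _ => Nat.zero_le _) (Finsupp.mem_support_iff.2 hv)
    omega
  have hvan : ∀ v : b.support → ℤ, (B : ℤ) ≤ |v k| → A v = 0 := by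
    intro v hv
    by_contra h
    have := hB v h
    rw [le_abs] at hv
    omega
  have hkk : simpleVec b k k = 1 := by simp [simpleVec]
  have hX0 : X w = 0 := by
    set n : ℕ := B + (w k).natAbs + (dotRefl b l k w k).natAbs with hn
    rw [hpow n]
    simp only [hX]
    rw [hm, hvan, hvan, hvan, hvan]
    · simp
    all_goals
      simp only [Pi.add_apply, Pi.sub_apply, Pi.smul_apply, hkk, smul_eq_mul, mul_one, le_abs]
      omega
  simp only [hX] at hX0
  linear_combination hX0

include hsl hq in
/-- The coefficients of `N` satisfy the functional equations. -/
lemma functionalEquations_numer (l : b.support → ℕ) {p : MvPolynomial b.support ℂ}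
    (hp : algebraMap _ (RatField b) p = numer b q l) : FunctionalEquations b q l p := by
  intro k lam mu hmu _
  obtain rfl := eq_dotRefl b hmu
  have hs := sqrtC_ne_zero hq
  have hkk : ∑ j, simpleVec b k j = 1 := by simp [simpleVec]
  have hphi : phi b l k (dotRefl b l k lam) =
      l k + pair b k lam + 2 * (dotRefl b l k lam k - (l k + 1)) := by
    rw [phi_eq b hsl, pair_dotRefl]; ring
  have hexp : ∑ j, (lam - dotRefl b l k lam + simpleVec b k) j =
      ∑ j, lam j - ∑ j, dotRefl b l k lam j + 1 := by
    simp only [Pi.add_apply, Pi.sub_apply, Finset.sum_add_distrib, Finset.sum_sub_distrib, hkk]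
  have hq2 : (q : ℂ) = sqrtC q ^ 2 := (sqrtC_sq q).symm
  constructor
  · intro he
    have he' : Even (l k + pair b k lam) := by
      rw [hphi, Int.even_add] at he
      exact he.2 (even_two_mul _)
    have h := yCoeff_numer_even b hsl hq l k hp lam he'
    simp only [coeffL_eq_yCoeff b hq, hexp]
    simp only [Pi.add_apply, Pi.sub_apply, Finset.sum_add_distrib, Finset.sum_sub_distrib, hkk]
    rw [zpow_add₀ hs, zpow_add₀ hs, zpow_sub₀ hs, zpow_sub₀ hs, zpow_one, hq2]
    field_simp
    linear_combination h
  · intro ho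
    have ho' : Odd (l k + pair b k lam) := by
      rw [hphi, Int.odd_add] at ho
      exact ho.2 (even_two_mul _)
    have h := (yCoeff_numer b hsl hq l k hp lam).2 ho'
    rw [ofNat_zsmul] at h
    simp only [coeffL_eq_yCoeff b hq, hexp]
    simp only [Pi.add_apply, Pi.sub_apply, Pi.smul_apply, Finset.sum_add_distrib,
      Finset.sum_sub_distrib, ← Finset.smul_sum, hkk]
    rw [zpow_add₀ hs, zpow_add₀ hs, zpow_sub₀ hs, zpow_sub₀ hs, zpow_one, hq2]
    rw [hq2] at h
    rw [show (2 • (1 : ℤ)) = 2 from rfl, zpow_ofNat]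
    field_simp
    linear_combination -h

end

/-! ### Weights of `V_θ` -/

section

variable [P.IsCrystallographic] (b : P.Base)

open Classical in
/-- The Chevalley generator `f_k`. -/
def fGen (k : b.support) : SerreLie b :=
  LieSubmodule.Quotient.mk (N := CartanMatrix.Relations.toIdeal ℂ b.cartanMatrix)
    (FreeLieAlgebra.of ℂ (CartanMatrix.Generators.F k))

open Classical in
lemma mk_eq_zero_of_mem_toSet
    {x : FreeLieAlgebra ℂ (CartanMatrix.Generators b.support)}
    (hx : x ∈ CartanMatrix.Relations.toSet ℂ b.cartanMatrix) :
    (LieSubmodule.Quotient.mk (N := CartanMatrix.Relations.toIdeal ℂ b.cartanMatrix) x :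
      SerreLie b) = 0 :=
  (Submodule.Quotient.mk_eq_zero _).2 (LieSubmodule.subset_lieSpan hx)

lemma lie_hGen_eGen (i j : b.support) :
    ⁅hGen b i, eGen b j⁆ = b.cartanMatrix i j • eGen b j := by
  classical
  have h := mk_eq_zero_of_mem_toSet b (x := CartanMatrix.Relations.HE ℂ b.cartanMatrix (i, j))
    (by simp only [CartanMatrix.Relations.toSet, Set.mem_union, Set.mem_range_self, true_or, or_true])
  exact sub_eq_zero.1 h

lemma lie_hGen_fGen (i j : b.support) :
    ⁅hGen b i, fGen b j⁆ = -(b.cartanMatrix i j • fGen b j) := by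
  classical
  have h := mk_eq_zero_of_mem_toSet b (x := CartanMatrix.Relations.HF ℂ b.cartanMatrix (i, j))
    (by simp only [CartanMatrix.Relations.toSet, Set.mem_union, Set.mem_range_self, true_or, or_true])
  exact eq_neg_of_add_eq_zero_left h

lemma lie_eGen_fGen_self (i : b.support) : ⁅eGen b i, fGen b i⁆ = hGen b i := by
  classical
  have h := mk_eq_zero_of_mem_toSet b (x := CartanMatrix.Relations.EF ℂ (i, i))
    (by simp only [CartanMatrix.Relations.toSet, Set.mem_union, Set.mem_range_self, true_or, or_true])
  simp only [CartanMatrix.Relations.EF, Function.uncurry_apply_pair, if_true] at h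
  exact sub_eq_zero.1 h

end

section

variable [P.IsRootSystem] [P.IsCrystallographic] (b : P.Base)

omit [P.IsCrystallographic] in
open Classical in
lemma toLinearMap_fundWeight (k j : b.support) :
    P.toLinearMap (fundWeight b k) (P.coroot j) = if k = j then 1 else 0 := by
  rw [fundWeight, LinearMap.apply_symm_toPerfPair_self, Module.Basis.coord_apply,
    ← b.toCoweightBasis_apply, Module.Basis.repr_self, Finsupp.single_apply]
  simp only [eq_comm]

omit [P.IsCrystallographic] in
lemma toLinearMap_theta (l : b.support → ℕ) (j : b.support) :
    P.toLinearMap (theta b l) (P.coroot j) = l j + 1 := by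
  classical
  simp only [theta, map_add, map_sum, LinearMap.add_apply, LinearMap.sum_apply, map_nsmul,
    LinearMap.smul_apply, toLinearMap_fundWeight]
  simp [add_comm]

lemma toLinearMap_theta_sub (l : b.support → ℕ) (v : b.support → ℤ) (j : b.support) :
    P.toLinearMap (theta b l - latticePt b v) (P.coroot j) = ((l j + 1 - pair b j v : ℤ) : ℝ) := by
  rw [map_sub, LinearMap.sub_apply, toLinearMap_theta, toLinearMap_latticePt]
  push_cast
  rfl

end

section

variable [Fintype ι]

/-! ### The invariant form -/

lemma rootForm_root_self_pos (i : ι) : 0 < P.RootForm (P.root i) (P.root i) := by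
  rw [rootForm_root_self]
  refine Finset.sum_pos' (fun _ _ => mul_self_nonneg _) ⟨i, Finset.mem_univ _, ?_⟩
  rw [pairing_same]
  norm_num

lemma two_mul_rootForm_root (x : M) (i : ι) :
    2 * P.RootForm x (P.root i) =
      P.toLinearMap x (P.coroot i) * P.RootForm (P.root i) (P.root i) := by
  have h := P.rootForm_reflection_reflection_apply i x (P.root i)
  rw [reflection_apply_self, reflection_apply, map_neg, map_sub, LinearMap.sub_apply, map_smul,
    LinearMap.smul_apply, smul_eq_mul] at h
  have hc : P.coroot' i x = P.toLinearMap x (P.coroot i) := rfl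
  rw [hc] at h
  linear_combination -h

lemma rootForm_self_nonneg (x : M) : 0 ≤ P.RootForm x x := by
  rw [rootForm_apply_apply]
  exact Finset.sum_nonneg fun _ _ => mul_self_nonneg _

lemma rootForm_add_zsmul_root_self (x : M) (i : ι) (n : ℤ) :
    P.RootForm (x + n • P.root i) (x + n • P.root i) = P.RootForm x x +
      P.RootForm (P.root i) (P.root i) * (n * (n + P.toLinearMap x (P.coroot i))) := by
  have h1 := two_mul_rootForm_root (P := P) x i
  have h2 : P.RootForm (P.root i) x = P.RootForm x (P.root i) := P.rootForm_symmetric.eq _ _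
  rw [← Int.cast_smul_eq_zsmul ℝ]
  simp only [map_add, LinearMap.add_apply, map_smul, LinearMap.smul_apply, smul_eq_mul]
  rw [h2]
  linear_combination (n : ℝ) * h1

variable [P.IsCrystallographic]

/-- The quadratic form given by the Cartan matrix, symmetrised by the lengths of the simple roots,
is positive semidefinite. -/
lemma sum_mul_pair_nonneg (b : P.Base) (v : b.support → ℤ) :
    0 ≤ ∑ k, (v k * pair b k v : ℝ) * P.RootForm (P.root k) (P.root k) := by
  have h : ∑ k, (v k * pair b k v : ℝ) * P.RootForm (P.root k) (P.root k) =
      2 * P.RootForm (latticePt b v) (latticePt b v) := by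
    nth_rewrite 2 [latticePt]
    rw [map_sum, Finset.mul_sum]
    refine Finset.sum_congr rfl fun k _ => ?_
    have := two_mul_rootForm_root (P := P) (latticePt b v) (k : ι)
    rw [toLinearMap_latticePt] at this
    rw [← Int.cast_smul_eq_zsmul ℝ, map_smul, smul_eq_mul]
    linear_combination -(v k : ℝ) * this
  rw [h]
  exact mul_nonneg zero_le_two (rootForm_self_nonneg _)

end

section

variable [P.IsCrystallographic] (b : P.Base)

lemma cartanMatrix_symm (hsl : b.cartanMatrix.IsSimplyLaced) (i j : b.support) :
    b.cartanMatrix i j = b.cartanMatrix j i := by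
  change P.pairingIn ℤ i j = P.pairingIn ℤ j i
  by_cases hij : i = j
  · rw [hij]
  by_cases h : Adj b i j
  · rw [pairingIn_of_adj b hsl h, pairingIn_of_adj b hsl (adj_comm b h)]
  · rw [pairingIn_of_not_adj b hij h,
      pairingIn_of_not_adj b (Ne.symm hij) fun h' => h (adj_comm b h')]

variable (V : Type*) [AddCommGroup V] [Module ℂ V] [LieRingModule (SerreLie b) V]
  [LieModule ℂ (SerreLie b) V]

/-- The generator `f_i` maps vectors of weight `ξ` to vectors of weight `ξ - α_i`. -/
lemma hasWeight_fGen (hsl : b.cartanMatrix.IsSimplyLaced) {ξ : M} {x : V}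
    (hx : HasWeight b V ξ x) (i : b.support) :
    HasWeight b V (ξ - P.root i) ⁅fGen b i, x⁆ := by
  intro j
  have hc : ((P.toLinearMap (ξ - P.root i) (P.coroot j) : ℝ) : ℂ) =
      ((P.toLinearMap ξ (P.coroot j) : ℝ) : ℂ) - b.cartanMatrix j i := by
    rw [map_sub, LinearMap.sub_apply, cartanMatrix_symm b hsl]
    push_cast
    congr 1
    change ((P.pairing i j : ℝ) : ℂ) = ((P.pairingIn ℤ i j : ℤ) : ℂ)
    rw [← P.algebraMap_pairingIn ℤ (i : ι) (j : ι)]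
    simp
  rw [leibniz_lie, lie_hGen_fGen, hx j, neg_lie, lie_smul, hc, sub_smul,
    ← Int.cast_smul_eq_zsmul ℂ, smul_lie]
  abel

/-- If `ξ` is a weight of a finite-dimensional representation but `ξ - α_i` is not, then
`⟨ξ, α_i^∨⟩ ≤ 0`. -/
lemma toLinearMap_coroot_nonpos [Module.Finite ℂ V] (hsl : b.cartanMatrix.IsSimplyLaced) {ξ : M}
    {i : b.support} (h : IsWeightOf b V ξ) (h' : ¬ IsWeightOf b V (ξ - P.root i)) :
    P.toLinearMap ξ (P.coroot i) ≤ 0 := by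
  obtain ⟨x, hx0, hx⟩ := h
  have hf : ⁅fGen b i, x⁆ = 0 := by
    by_contra hne
    exact h' ⟨_, hne, hasWeight_fGen b V hsl hx i⟩
  by_cases hh : hGen b i = 0
  · have := hx i
    rw [hh, zero_lie, eq_comm, smul_eq_zero, or_iff_left hx0, Complex.ofReal_eq_zero] at this
    exact this.le
  -- `x` is a primitive vector for the opposite `sl₂`-triple
  have ht : IsSl2Triple (hGen b i) (eGen b i) (fGen b i) :=
    { h_ne_zero := hh
      lie_e_f := lie_eGen_fGen_self b i
      lie_h_e_nsmul := by
        rw [lie_hGen_eGen, b.cartanMatrix_apply_same, ofNat_zsmul]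
      lie_h_f_nsmul := by
        rw [lie_hGen_fGen, b.cartanMatrix_apply_same, ofNat_zsmul] }
  have hp : ht.symm.HasPrimitiveVectorWith x (-((P.toLinearMap ξ (P.coroot i) : ℝ) : ℂ)) :=
    { ne_zero := hx0
      lie_h := by rw [neg_lie, hx i, neg_smul]
      lie_e := hf }
  obtain ⟨n, hn⟩ := hp.exists_nat
  have hn' : -(P.toLinearMap ξ (P.coroot i)) = n := by exact_mod_cast hn
  have := Nat.cast_nonneg (α := ℝ) n
  linarith

end

section

variable [Finite ι] [P.IsRootSystem] [P.IsCrystallographic] (b : P.Base)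
  (V : Type*) [AddCommGroup V] [Module ℂ V] [LieRingModule (SerreLie b) V]
  [LieModule ℂ (SerreLie b) V]

/-- A regular dominant element of `θ - ∑ ℕ α_i` is a weight of `V_θ`. -/
lemma isWeightOf_of_regular_dominant (hsl : b.cartanMatrix.IsSimplyLaced) (l : b.support → ℕ)
    (hV : IsIrrepOfHighestWeight b V (theta b l)) {v : b.support → ℤ} (hv : 0 ≤ v)
    (hdom : ∀ k, pair b k v < l k + 1) : IsWeightOf b V (theta b l - latticePt b v) := by
  classical
  have := hV.finite
  let := Fintype.ofFinite ι
  -- a weight `θ - γ` with `0 ≤ γ ≤ v` and `γ` of maximal height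
  set S := (Finset.Icc 0 v).filter fun γ => IsWeightOf b V (theta b l - latticePt b γ) with hS
  have hne : S.Nonempty := by
    refine ⟨0, ?_⟩
    rw [hS, Finset.mem_filter, Finset.mem_Icc]
    obtain ⟨x, hx0, -, hx⟩ := hV.exists_highest
    refine ⟨⟨le_rfl, hv⟩, x, hx0, ?_⟩
    rwa [show latticePt b 0 = 0 by simp [latticePt], sub_zero]
  obtain ⟨γ, hγ, hmax⟩ := S.exists_max_image (fun γ => ∑ j, γ j) hne
  rw [hS, Finset.mem_filter, Finset.mem_Icc] at hγ
  obtain ⟨⟨hγ0, hγv⟩, hγw⟩ := hγ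
  have hneg : ∀ i, γ i < v i → pair b i (v - γ) < 0 := by
    intro i hi
    have hnot : ¬ IsWeightOf b V (theta b l - latticePt b γ - P.root i) := by
      intro hw
      have hsub : theta b l - latticePt b γ - P.root i =
          theta b l - latticePt b (γ + simpleVec b i) := by
        rw [latticePt_add, ← rootCoord_simple, latticePt_rootCoord]
        abel
      rw [hsub] at hw
      have hmem : γ + simpleVec b i ∈ S := by
        rw [hS, Finset.mem_filter, Finset.mem_Icc]
        refine ⟨⟨add_nonneg hγ0 ?_, ?_⟩, hw⟩
        · exact Pi.single_nonneg.2 zero_le_one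
        · intro j
          rw [Pi.add_apply, simpleVec, Pi.single_apply]
          split_ifs with h
          · rw [h]; exact hi
          · rw [add_zero]; exact hγv j
      have := hmax _ hmem
      simp [Finset.sum_add_distrib, simpleVec] at this
    have h := toLinearMap_coroot_nonpos b V hsl hγw hnot
    rw [toLinearMap_theta_sub] at h
    have h' : (l i : ℤ) + 1 - pair b i γ ≤ 0 := by exact_mod_cast h
    have := hdom i
    rw [map_sub]
    linarith
  -- otherwise `v - γ` would contradict the positivity of the Cartan matrix
  have hvγ : v = γ := by
    by_contra hne
    obtain ⟨i, hi⟩ : ∃ i, γ i < v i := by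
      by_contra! hall
      exact hne (le_antisymm hall hγv)
    have h0 := sum_mul_pair_nonneg b (v - γ)
    have h1 : ∑ k, ((v - γ) k * pair b k (v - γ) : ℝ) * P.RootForm (P.root k) (P.root k) < 0 := by
      refine Finset.sum_neg' (fun k _ => ?_) ⟨i, Finset.mem_univ _, ?_⟩
      · rcases (hγv k).eq_or_lt with h | h
        · simp [h]
        · have h2 := hneg k h
          refine mul_nonpos_of_nonpos_of_nonneg (mul_nonpos_of_nonneg_of_nonpos ?_ ?_)
            (rootForm_root_self_pos _).le
          · exact_mod_cast sub_nonneg.2 h.le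
          · exact_mod_cast h2.le
      · have h2 := hneg i hi
        refine mul_neg_of_neg_of_pos (mul_neg_of_pos_of_neg ?_ ?_) (rootForm_root_self_pos _)
        · exact_mod_cast sub_pos.2 hi
        · exact_mod_cast h2
    exact absurd h0 (not_le.2 h1)
  rw [hvγ]
  exact hγw

end

/-! ### Uniqueness -/

lemma coeffL_sub (b : P.Base) (p p' : MvPolynomial b.support ℂ) (v : b.support → ℤ) :
    coeffL b (p - p') v = coeffL b p v - coeffL b p' v := by
  unfold coeffL
  split_ifs
  · rw [MvPolynomial.coeff_sub]
  · rw [sub_zero]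

lemma coeffL_zero (b : P.Base) (p : MvPolynomial b.support ℂ) :
    coeffL b p 0 = MvPolynomial.coeff 0 p := by
  have h : ∀ j : b.support, 0 ≤ (0 : b.support → ℤ) j := fun _ => le_rfl
  rw [coeffL, if_pos h]
  congr 1
  ext j
  rfl

lemma FunctionalEquations.sub {b : P.Base} {q : ℕ} {l : b.support → ℕ}
    {p p' : MvPolynomial b.support ℂ} (h : FunctionalEquations b q l p)
    (h' : FunctionalEquations b q l p') : FunctionalEquations b q l (p - p') := by
  intro k lam mu hmu hle
  obtain ⟨h1, h2⟩ := h k lam mu hmu hle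
  obtain ⟨h1', h2'⟩ := h' k lam mu hmu hle
  refine ⟨fun he => ?_, fun ho => ?_⟩
  · simp only [coeffL_sub]
    linear_combination h1 he - h1' he
  · simp only [coeffL_sub]
    linear_combination h2 ho - h2' ho

/-- A vector that is positive on the simple coroots lies on no reflection hyperplane. -/
lemma isRegularWeight_of_pos (b : P.Base) {ξ : M}
    (h : ∀ k ∈ b.support, 0 < P.toLinearMap ξ (P.coroot k)) : IsRegularWeight P ξ := by
  have key : ∀ n ∈ AddSubmonoid.closure (P.coroot '' b.support),
      n = 0 ∨ 0 < P.toLinearMap ξ n := by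
    intro n hn
    induction hn using AddSubmonoid.closure_induction with
    | mem n hn =>
      obtain ⟨k, hk, rfl⟩ := hn
      exact Or.inr (h k hk)
    | zero => exact Or.inl rfl
    | add x y _ _ hx hy =>
      rcases hx with rfl | hx
      · rwa [zero_add]
      rcases hy with rfl | hy
      · rw [add_zero]; exact Or.inr hx
      · rw [map_add]; exact Or.inr (add_pos hx hy)
  intro i
  have hi : P.coroot i ≠ 0 := P.ne_zero' i
  rcases b.coroot_mem_or_neg_mem i with h1 | h1
  · exact ((key _ h1).resolve_left hi).ne'
  · have := (key _ h1).resolve_left (neg_ne_zero.2 hi)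
    rw [map_neg, neg_pos] at this
    exact this.ne

section

variable [P.IsCrystallographic]

lemma odd_phi_of_fixed (b : P.Base) (hsl : b.cartanMatrix.IsSimplyLaced)
    (l : b.support → ℕ) (k : b.support) {v : b.support → ℤ} (h : pair b k v = l k + 1) :
    Odd (phi b l k v) := by
  rw [phi_eq b hsl, h]
  exact ⟨v k - 1, by ring⟩

/-- If the coefficients of a solution of the functional equations vanish beyond `u` and its mirror
image on the line through `u` in the direction of `α_k`, and `a_u = 0`, then the coefficient at the
mirror image vanishes too: the functional equation there has only one further term. -/
lemma FunctionalEquations.eq_zero_of_extremal {b : P.Base} {q : ℕ} (hq : 0 < q)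
    {l : b.support → ℕ} {p : MvPolynomial b.support ℂ} (h : FunctionalEquations b q l p)
    (k : b.support) {u : b.support → ℤ} (hu : u ≤ dotRefl b l k u)
    (h1 : coeffL b p (u - simpleVec b k) = 0) (h2 : coeffL b p (u - 2 • simpleVec b k) = 0)
    (h3 : coeffL b p (dotRefl b l k u + simpleVec b k) = 0)
    (h4 : coeffL b p (dotRefl b l k u + 2 • simpleVec b k) = 0)
    (h0 : coeffL b p u = 0) : coeffL b p (dotRefl b l k u) = 0 := by
  have hs := sqrtC_ne_zero hq
  obtain ⟨ha, hb⟩ := h k u _ (latticePt_dotRefl b l k u) hu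
  rcases Int.even_or_odd (phi b l k (dotRefl b l k u)) with he | ho
  · have := ha he
    rw [h1, h3, h0, mul_zero, add_zero, zero_div, add_zero, eq_comm, mul_eq_zero] at this
    exact this.resolve_left (zpow_ne_zero _ hs)
  · have := hb ho
    rw [h2, h4, h0, mul_zero, sub_zero, zero_div, sub_zero, eq_comm, mul_eq_zero] at this
    exact this.resolve_left (mul_ne_zero hs (zpow_ne_zero _ hs))

/-- On a reflection hyperplane the functional equations force an extremal coefficient to vanish:
there `μ = λ`, the parity is odd, and the equation reads `-a_λ = q a_λ`. -/
lemma FunctionalEquations.eq_zero_of_fixed {b : P.Base} (hsl : b.cartanMatrix.IsSimplyLaced)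
    {q : ℕ} {l : b.support → ℕ} {p : MvPolynomial b.support ℂ}
    (h : FunctionalEquations b q l p) (k : b.support) {v : b.support → ℤ}
    (hv : pair b k v = l k + 1) (h2 : coeffL b p (v - 2 • simpleVec b k) = 0)
    (h4 : coeffL b p (v + 2 • simpleVec b k) = 0) : coeffL b p v = 0 := by
  have hfix : dotRefl b l k v = v := by
    rw [dotRefl_eq, hv, sub_self, zero_smul, add_zero]
  have hmu := latticePt_dotRefl b l k v
  rw [hfix] at hmu
  have := (h k v v hmu le_rfl).2 (odd_phi_of_fixed b hsl l k hv)
  have hkk : ∑ j, simpleVec b k j = 1 := by simp [simpleVec]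
  rw [h2, h4, sub_self, zero_add, hkk, zpow_one, ← sq, sqrtC_sq, mul_zero, zero_sub, zero_div,
    sub_zero] at this
  have h5 : ((q : ℂ) + 1) * coeffL b p v = 0 := by linear_combination -this
  exact (mul_eq_zero.1 h5).resolve_left (by exact_mod_cast Nat.succ_ne_zero q)

end

section

variable [P.IsCrystallographic] [P.IsRootSystem] [Fintype ι]

/-- The squared length of `θ - λ`. -/
def distSq (b : P.Base) (l : b.support → ℕ) (v : b.support → ℤ) : ℝ :=
  P.RootForm (theta b l - latticePt b v) (theta b l - latticePt b v)

/-- The squared length of `θ - λ` on a line in the direction of a simple root. -/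
lemma distSq_sub_smul (b : P.Base) (l : b.support → ℕ) (k : b.support) (v : b.support → ℤ)
    (t : ℤ) : distSq b l (v - t • simpleVec b k) = distSq b l v +
      P.RootForm (P.root k) (P.root k) * ((t * (t + (l k + 1 - pair b k v)) : ℤ) : ℝ) := by
  have h : theta b l - latticePt b (v - t • simpleVec b k) =
      theta b l - latticePt b v + t • P.root k := by
    rw [sub_eq_add_neg v, ← neg_smul, latticePt_add, latticePt_smul, ← rootCoord_simple,
      latticePt_rootCoord, neg_smul]
    abel
  rw [distSq, h, rootForm_add_zsmul_root_self, toLinearMap_theta_sub, ← distSq]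
  push_cast
  rfl

lemma distSq_lt (b : P.Base) (l : b.support → ℕ) (k : b.support) (v : b.support → ℤ)
    {t : ℤ} (ht : 0 < t * (t + (l k + 1 - pair b k v))) :
    distSq b l v < distSq b l (v - t • simpleVec b k) := by
  rw [distSq_sub_smul]
  exact lt_add_of_pos_right _ (mul_pos (rootForm_root_self_pos _) (by exact_mod_cast ht))

end

section

variable [Finite ι] [P.IsRootSystem] [P.IsCrystallographic]

/-- A nonzero solution of the functional equations has a nonzero coefficient `a_λ` with `θ - λ`
regular and dominant: among the `λ` with `a_λ ≠ 0` for which `θ - λ` has maximal length, the lowest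
one has this property. -/
lemma FunctionalEquations.exists_regular_dominant {b : P.Base}
    (hsl : b.cartanMatrix.IsSimplyLaced) {q : ℕ} (hq : 0 < q)
    {l : b.support → ℕ} {p : MvPolynomial b.support ℂ} (h : FunctionalEquations b q l p)
    (hp : p ≠ 0) : ∃ v, coeffL b p v ≠ 0 ∧ ∀ k, pair b k v < l k + 1 := by
  let := Fintype.ofFinite ι
  have hmem : ∀ v, v ∈ (yCoeff b q p).support ↔ coeffL b p v ≠ 0 := by
    intro v
    rw [Finsupp.mem_support_iff, coeffL_eq_yCoeff b hq]
    have := zpow_ne_zero (∑ j, v j) (sqrtC_ne_zero hq)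
    rw [Ne, Ne, mul_eq_zero, or_iff_left this]
  have hne : (yCoeff b q p).support.Nonempty := by
    rw [Finsupp.support_nonempty_iff]
    intro h0
    apply hp
    apply IsFractionRing.injective (MvPolynomial b.support ℂ) (RatField b)
    rw [← linearCombination_yCoeff b hq, h0, map_zero, map_zero]
  obtain ⟨v, hv, hmax⟩ := Finset.exists_max_image _
    (fun v : b.support → ℤ => toLex (distSq b l v, -∑ j, v j)) hne
  have hout : ∀ u, distSq b l v < distSq b l u → coeffL b p u = 0 := by
    intro u hu
    by_contra h0
    have := hmax u ((hmem u).2 h0)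
    rw [Prod.Lex.toLex_le_toLex] at this
    rcases this with h1 | h1
    · exact absurd h1 hu.not_gt
    · exact absurd h1.1 hu.ne'
  have hlow : ∀ u, distSq b l u = distSq b l v → ∑ j, u j < ∑ j, v j → coeffL b p u = 0 := by
    intro u hu hlt
    by_contra h0
    have := hmax u ((hmem u).2 h0)
    rw [Prod.Lex.toLex_le_toLex] at this
    rcases this with h1 | h1
    · exact absurd hu h1.ne
    · exact absurd (neg_le_neg_iff.1 h1.2) hlt.not_ge
  have hv0 := (hmem v).1 hv
  refine ⟨v, hv0, fun k => ?_⟩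
  by_contra! hle
  -- `v` lies on or above the middle of its line in the direction of `α_k`; its mirror image is
  -- `v - m α_k`, which is as far from `θ` as `v`
  set m : ℤ := pair b k v - (l k + 1) with hm
  have hm0 : 0 ≤ m := sub_nonneg.2 hle
  have hline : ∀ t : ℤ, 0 < t * (t - m) → coeffL b p (v - t • simpleVec b k) = 0 := by
    intro t ht
    refine hout _ (distSq_lt b l k v ?_)
    rwa [show (l k : ℤ) + 1 - pair b k v = -m by rw [hm]; ring, ← sub_eq_add_neg]
  have hplus : ∀ n : ℕ, 0 < n → coeffL b p (v + n • simpleVec b k) = 0 := by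
    intro n hn
    have := hline (-n) (by nlinarith)
    rwa [neg_smul, sub_neg_eq_add, natCast_zsmul] at this
  have hminus : ∀ n : ℕ, 0 < n → coeffL b p (v - m • simpleVec b k - n • simpleVec b k) = 0 := by
    intro n hn
    have := hline (m + n) (by rw [add_sub_cancel_left]; positivity)
    rwa [add_smul, ← sub_sub, natCast_zsmul] at this
  rcases hm0.eq_or_lt with hm0 | hm0
  · refine hv0 (h.eq_zero_of_fixed hsl k (by linarith) ?_ (hplus 2 two_pos))
    have := hminus 2 two_pos
    rwa [← hm0, zero_smul, sub_zero] at this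
  · set u := v - m • simpleVec b k with hu
    have hrefl : dotRefl b l k u = v := by
      rw [← dotRefl_dotRefl b l k v, dotRefl_eq b l k v, hu, hm]
      congr 1
      rw [sub_eq_add_neg, ← neg_smul]
      congr 2
      ring
    have hdist : distSq b l u = distSq b l v := by
      rw [hu, distSq_sub_smul, show m * (m + (l k + 1 - pair b k v)) = 0 by rw [hm]; ring,
        Int.cast_zero, mul_zero, add_zero]
    have hkk : ∑ j, simpleVec b k j = 1 := by simp [simpleVec]
    have hsum : ∑ j, u j = ∑ j, v j - m := by
      simp only [hu, Pi.sub_apply, Pi.smul_apply, smul_eq_mul, Finset.sum_sub_distrib,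
        ← Finset.mul_sum, hkk, mul_one]
    have huv : u ≤ dotRefl b l k u := by
      rw [hrefl, hu, sub_le_self_iff]
      classical
      exact smul_nonneg hm0.le (Pi.single_nonneg.2 zero_le_one)
    have h1 := hminus 1 one_pos
    have h3 := hplus 1 one_pos
    rw [one_smul] at h1 h3
    have hz := h.eq_zero_of_extremal hq k huv h1 (hminus 2 two_pos) (by rwa [hrefl])
      (by rw [hrefl]; exact hplus 2 two_pos) (hlow u hdist (by linarith))
    rw [hrefl] at hz
    exact hv0 hz

/-- If `θ` is the only regular dominant weight of `V_θ`, a solution of the functional equations with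
constant coefficient `0` vanishes. -/
lemma FunctionalEquations.eq_zero {b : P.Base}
    (V : Type*) [AddCommGroup V] [Module ℂ V] [LieRingModule (SerreLie b) V]
    [LieModule ℂ (SerreLie b) V]
    (hsl : b.cartanMatrix.IsSimplyLaced) {q : ℕ} (hq : 0 < q)
    {l : b.support → ℕ} (hV : IsIrrepOfHighestWeight b V (theta b l))
    (hθ : ∀ ξ : M, IsDominant b ξ → IsRegularWeight P ξ → IsWeightOf b V ξ → ξ = theta b l)
    {p : MvPolynomial b.support ℂ} (h : FunctionalEquations b q l p)
    (h0 : MvPolynomial.coeff 0 p = 0) : p = 0 := by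
  by_contra hp
  obtain ⟨v, hv, hdom⟩ := h.exists_regular_dominant hsl hq hp
  have hv0 : 0 ≤ v := by
    by_contra hneg
    exact hv (if_neg hneg)
  have hpos : ∀ k ∈ b.support, 0 < P.toLinearMap (theta b l - latticePt b v) (P.coroot k) := by
    intro k hk
    rw [toLinearMap_theta_sub b l v ⟨k, hk⟩, Int.cast_pos]
    have := hdom ⟨k, hk⟩
    linarith
  have hw := hθ _ (fun k hk => (hpos k hk).le) (isRegularWeight_of_pos b hpos)
    (isWeightOf_of_regular_dominant b V hsl l hV hv0 hdom)
  rw [sub_eq_self] at hw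
  have : v = 0 := latticePt_injective b (by rw [hw]; simp [latticePt])
  rw [this, coeffL_zero] at hv
  exact hv h0

end

end TwistedWMDS

end

open TwistedWMDS in
theorem theorem5p6 {ι M N : Type*} [Finite ι] [AddCommGroup M] [Module ℝ M]
    [AddCommGroup N] [Module ℝ N] (P : RootPairing ι ℝ M N) [P.IsRootSystem]
    [P.IsCrystallographic] [P.IsReduced] (b : P.Base) (hsl : b.cartanMatrix.IsSimplyLaced)
    (q : ℕ) (hq : IsPrimePow q) (l : b.support → ℕ)
    (V : Type*) [AddCommGroup V] [Module ℂ V] [LieRingModule (SerreLie b) V]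
    [LieModule ℂ (SerreLie b) V] (hV : IsIrrepOfHighestWeight b V (theta b l))
    (hθ : ∀ ξ : M, IsDominant b ξ → IsRegularWeight P ξ → IsWeightOf b V ξ → ξ = theta b l) :
    ∃ p : MvPolynomial b.support ℂ,
      algebraMap (MvPolynomial b.support ℂ) (RatField b) p = numer b q l ∧
      MvPolynomial.coeff 0 p = 1 ∧
      FunctionalEquations b q l p ∧
      ∀ p' : MvPolynomial b.support ℂ,
        MvPolynomial.coeff 0 p' = 1 → FunctionalEquations b q l p' → p' = p := by
  have hq0 : 0 < q := hq.pos
  obtain ⟨p, hp, hp0⟩ := exists_poly_numer b hsl hq0 hq.ne_one l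
  have hFE := functionalEquations_numer b hsl hq0 l hp
  refine ⟨p, hp, hp0, hFE, fun p' hp0' hFE' => ?_⟩
  refine sub_eq_zero.1 ((hFE'.sub hFE).eq_zero V hsl hq0 hV hθ ?_)
  rw [MvPolynomial.coeff_sub, hp0', hp0, sub_self]
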